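/- **Setting.** Let $p,q$ be coprime positive integers, $0\le e'<1$, $\tilde a=(q/p)^{2/3}$. Let $\mathbf r'(\lambda')\in\mathbb R^3$ be the position, at mean longitude $\lambda'$, on the Kepler ellipse with one focus at the origin, semi-major axis $1$, eccentricity $e'$, lying in the plane $z=0$ with periaster in the direction of the first axis. The resonant variables are $(\theta,u,\tilde x,x,\tilde y,y,\lambda',\Xi)$ with $\theta,\lambda'$ angles, $u,\Xi$ real, $x,y$ complex, $\tilde x=-i\bar x$, $\tilde y=-i\bar y$, and the symplectic form $d\theta\wedge du+d\tilde x\wedge dx+d\tilde y\wedge dy+d\lambda'\wedge d\Xi$. Here $\Lambda=\sqrt{\tilde a}+u$ and $\lambda=\theta+\frac pq\lambda'$, and $\mathbf r=\mathbf r(\theta,u,x,y,\lambda')\in\mathbb R^3$ is the position of the particle on the Kepler ellipse (focus at the origin) with mean longitude $\lambda$, semi-major axis $a=\Lambda^2$, and eccentricity $e$, inclination $I\in[0,\pi]$, longitude of periaster $\varpi$ and longitude of node $\Omega$ given by the Poincaré variables $$x=\sqrt{\Lambda(1-\sqrt{1-e^2})}\,e^{i\varpi},\qquad y=\sqrt{\Lambda\sqrt{1-e^2}\,(1-\cos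 I)}\,e^{i\Omega}.$$ All functions below have the periods $\lambda\mapsto\lambda+2\pi$ (at fixed $\lambda'$) and $\lambda'\mapsto\lambda'+2\pi$ (at fixed $\lambda$), i.e. the periods $(2\pi,0)$ and $(-2\pi p/q,2\pi)$ in $(\theta,\lambda')$; at fixed $\theta$ the period in $\lambda'$ is $2\pi q$. The Hamiltonian of the restricted three-body problem is $\Xi+H$, $H=H_K+H_P$, with $$H_K(u)=-\frac1{2(\sqrt{\tilde a}+u)^2}-\frac pq u,\qquad H_P=-\frac{\varepsilon}{\|\mathbf r-\mathbf r'\|}+\frac{\varepsilon}{\|\mathbf r\|}+\varepsilon\frac{\mathbf r\cdot\mathbf r'}{\|\mathbf r'\|^3},$$ and $\bar H=H_K+\bar H_P$, where $\bar H_P=\frac1{2\pi q}\int_0^{2\pi q}H_P\,d\lambda'$ at fixed $(\theta,u,x,y)$. Put $$S_0(\theta,u,x,y,\lambda')=\frac1{2\pi q}\int_0^{2\pi q}s\,(H_P-\bar H_P)(\theta,u,x,y,\lambda'+s)\,ds .$$ For $\sigma,\tilde\Delta,\tau,\rho,\Delta,\kappa>0$ let $\mathfrak D_\kappa$ be the set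 of points with $$|u|\le\kappa\rho,\quad \max(|x|,|\tilde x|)\le\tilde a^{1/4}\Bigl(1-\frac\sigma\kappa\Bigr),\quad |y|^2\le 2\Bigl(1-\frac\tau\kappa\Bigr)(\Lambda-|x|^2),\quad \min_{\lambda'}\|\mathbf r-\mathbf r'\|\ge\frac\Delta\kappa,\quad \min_{\lambda'}\|\mathbf r\|\ge\frac{\tilde\Delta}\kappa,$$ the minima being over all $\lambda'$ at fixed $(\theta,u,x,y)$; the third condition says $\cos^2(I/2)\ge\tau/\kappa$, so inclinations stay away from $\pi$. For a function $S$ of $(\theta,u,x,y,\lambda')$ let $\Phi_1^S$ be the time-one map of its Hamiltonian flow. **Theorem.** For all $p,q,e'$ as above and all $\sigma,\tilde\Delta,\tau>0$ there is a constant $C\ge1$, independent of $\varepsilon,\rho,\Delta$, such that for all $\varepsilon,\rho,\Delta>0$ with $C\varepsilon<1$, $C\rho<1$, $C\Delta<1$, $$C\varepsilon<\rho\Delta^2\quad\text{and}\quad C\varepsilon<\Delta^3$$ the following holds. There is a real function $S(\theta,u,x,y,\lambda')$, smooth near $\mathfrak D_{3/2}$, such that $\Phi_1^S$ is defined and is a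 smooth symplectic transformation onto its image near $\mathfrak D_{4/3}$, maps $\mathfrak D_{4/3}$ into $\mathfrak D_{3/2}$, leaves $\lambda'$ unchanged, and satisfies, on $\mathfrak D_{4/3}$ and for every $W\in\{\theta,u,\tilde x,x,\tilde y,y\}$, $$|\Xi\circ\Phi_1^S-\Xi|\le C\frac\varepsilon\Delta,\qquad |W\circ\Phi_1^S-W|\le C\frac\varepsilon{\Delta^2},$$ $$(\Xi+H)\circ\Phi_1^S=\Xi+\bar H+H_*,$$ $$|H_*|\le C\frac\varepsilon\Delta\,\eta,\qquad \Bigl|\frac{\partial H_*}{\partial W}\Bigr|\le C\frac\varepsilon{\Delta^2}(\eta+\rho),\qquad \eta=\frac\varepsilon{\Delta^3}+\frac\rho\Delta .$$ Moreover the choice $S=S_0$ has all these properties, except that for $W=u$ the last bound is replaced by $\bigl|\frac{\partial H_*}{\partial u}\bigr|\le C\frac\varepsilon{\Delta^2}(\eta+1)$. -/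

import Mathlib

open Set
open scoped ContDiff

noncomputable section

namespace ResonantAveraging

/-! ### The extended phase space

A point is `(θ, u, x, y, λ', Ξ)`, with the angles `θ`, `λ'` lifted to `ℝ` and `x`, `y` the complex
Poincaré variables.  The variables conjugated to `x` and `y` are the functions `x̃ = -i conj x` and
`ỹ = -i conj y` on this (real, eight-dimensional) space. -/

/-- The extended phase space, angles lifted to the real line. -/
abbrev Phase : Type := ℝ × ℝ × ℂ × ℂ × ℝ × ℝ

/-- The physical space `ℝ³` with its Euclidean norm. -/
abbrev Space : Type := EuclideanSpace ℝ (Fin 3)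

def theta (X : Phase) : ℝ := X.1
def u (X : Phase) : ℝ := X.2.1
def x (X : Phase) : ℂ := X.2.2.1
def y (X : Phase) : ℂ := X.2.2.2.1
/-- The mean longitude of the planet. -/
def lamP (X : Phase) : ℝ := X.2.2.2.2.1
/-- The action conjugated to the mean longitude of the planet. -/
def Xi (X : Phase) : ℝ := X.2.2.2.2.2
/-- `x̃ = -i conj x`. -/
def xt (X : Phase) : ℂ := -Complex.I * (starRingEnd ℂ) (x X)
/-- `ỹ = -i conj y`. -/
def yt (X : Phase) : ℂ := -Complex.I * (starRingEnd ℂ) (y X)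

/-- The point `X` with its coordinate `λ'` replaced by `l`. -/
def setLamP (X : Phase) (l : ℝ) : Phase := (theta X, u X, x X, y X, l, Xi X)

/-- The point `X` with its coordinate `Ξ` replaced by `z`. -/
def setXi (X : Phase) (z : ℝ) : Phase := (theta X, u X, x X, y X, lamP X, z)

/-- Labels of the six variables `θ, u, x̃, x, ỹ, y`. -/
inductive Var : Type
  | theta | u | xt | x | yt | y

/-- The six variables as (complex-valued) functions on the phase space. -/
def coord : Var → Phase → ℂ
  | .theta => fun X => (theta X : ℂ)
  | .u => fun X => (u X : ℂ)
  | .xt => xt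
  | .x => x
  | .yt => yt
  | .y => y

/-- Partial derivatives of a real function with respect to `θ, u, x̃, x, ỹ, y`.  With
`x = ξ + i ζ`, `∂/∂x = (∂/∂ξ - i ∂/∂ζ) / 2`, and, since `conj x = i x̃`,
`∂/∂x̃ = i ∂/∂(conj x) = i (∂/∂ξ + i ∂/∂ζ) / 2`; the same for `y`. -/
def partialD (f : Phase → ℝ) (X : Phase) : Var → ℂ
  | .theta => (fderiv ℝ f X (1, 0, 0, 0, 0, 0) : ℝ)
  | .u => (fderiv ℝ f X (0, 1, 0, 0, 0, 0) : ℝ)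
  | .xt => Complex.I * (((fderiv ℝ f X (0, 0, 1, 0, 0, 0) : ℝ) : ℂ)
      + Complex.I * ((fderiv ℝ f X (0, 0, Complex.I, 0, 0, 0) : ℝ) : ℂ)) / 2
  | .x => (((fderiv ℝ f X (0, 0, 1, 0, 0, 0) : ℝ) : ℂ)
      - Complex.I * ((fderiv ℝ f X (0, 0, Complex.I, 0, 0, 0) : ℝ) : ℂ)) / 2
  | .yt => Complex.I * (((fderiv ℝ f X (0, 0, 0, 1, 0, 0) : ℝ) : ℂ)
      + Complex.I * ((fderiv ℝ f X (0, 0, 0, Complex.I, 0, 0) : ℝ) : ℂ)) / 2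
  | .y => (((fderiv ℝ f X (0, 0, 0, 1, 0, 0) : ℝ) : ℂ)
      - Complex.I * ((fderiv ℝ f X (0, 0, 0, Complex.I, 0, 0) : ℝ) : ℂ)) / 2

/-! ### Symplectic geometry -/

/-- The symplectic form `dθ ∧ du + dx̃ ∧ dx + dỹ ∧ dy + dλ' ∧ dΞ` (it takes real values). -/
def symplecticForm (v w : Phase) : ℂ :=
  ((theta v * u w - theta w * u v : ℝ) : ℂ) + (xt v * x w - xt w * x v)
    + (yt v * y w - yt w * y v) + ((lamP v * Xi w - lamP w * Xi v : ℝ) : ℂ)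

/-- The Hamiltonian vector field of `f`, for the equations `θ' = ∂f/∂u`, `u' = -∂f/∂θ`,
`x' = -∂f/∂x̃`, `y' = -∂f/∂ỹ`, `(λ')' = ∂f/∂Ξ`, `Ξ' = -∂f/∂λ'`. -/
def hamVF (f : Phase → ℝ) (X : Phase) : Phase :=
  (fderiv ℝ f X (0, 1, 0, 0, 0, 0), -fderiv ℝ f X (1, 0, 0, 0, 0, 0),
    -partialD f X .xt, -partialD f X .yt,
    fderiv ℝ f X (0, 0, 0, 0, 0, 1), -fderiv ℝ f X (0, 0, 0, 0, 1, 0))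

/-- `Φ` is, on `A`, the time-one map of the Hamiltonian flow of `S`, with trajectories in `B`. -/
def IsTimeOneMap (S : Phase → ℝ) (Φ : Phase → Phase) (A B : Set Phase) : Prop :=
  ∀ X ∈ A, ∃ γ : ℝ → Phase, γ 0 = X ∧ γ 1 = Φ X ∧
    ∀ t ∈ Icc (0 : ℝ) 1, γ t ∈ B ∧ HasDerivWithinAt γ (hamVF S (γ t)) (Icc 0 1) t

/-- `Φ` is a smooth symplectic transformation of the open set `A` onto its image. -/
def IsSymplecticOn (Φ : Phase → Phase) (A : Set Phase) : Prop :=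
  ContDiffOn ℝ ∞ Φ A ∧ InjOn Φ A ∧
    ∀ X ∈ A, ∀ v w : Phase,
      symplecticForm (fderiv ℝ Φ X v) (fderiv ℝ Φ X w) = symplecticForm v w

/-! ### Elliptic motion -/

/-- The eccentric anomaly: the solution `E` of Kepler's equation `E - e sin E = M`
(it exists and is unique for `0 ≤ e < 1`). -/
def eccentricAnomaly (e M : ℝ) : ℝ := Function.invFun (fun E : ℝ => E - e * Real.sin E) M

/-- Position on the ellipse of semi-major axis `a` and eccentricity `e` at mean anomaly `M`, in the
orbital frame (focus at the origin, first axis towards the periaster). -/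
def orbitalPosition (a e M : ℝ) : Fin 3 → ℝ :=
  ![a * (Real.cos (eccentricAnomaly e M) - e),
    a * Real.sqrt (1 - e ^ 2) * Real.sin (eccentricAnomaly e M), 0]

/-- Rotation of angle `α` about the first axis. -/
def rot1 (α : ℝ) : Matrix (Fin 3) (Fin 3) ℝ :=
  !![1, 0, 0; 0, Real.cos α, -Real.sin α; 0, Real.sin α, Real.cos α]

/-- Rotation of angle `α` about the third axis. -/
def rot3 (α : ℝ) : Matrix (Fin 3) (Fin 3) ℝ :=
  !![Real.cos α, -Real.sin α, 0; Real.sin α, Real.cos α, 0; 0, 0, 1]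

/-- Heliocentric position of a body with semi-major axis `a`, eccentricity `e`, inclination `I`,
longitude of the node `Om`, argument of the periaster `w` and mean anomaly `M`. -/
def keplerPosition (a e I Om w M : ℝ) : Space :=
  WithLp.toLp 2 ((rot3 Om * rot1 I * rot3 w).mulVec (orbitalPosition a e M))

/-- Heliocentric position `r'(λ')` of the planet, with eccentricity `e'` and
`(a', I', Ω', ω') = (1, 0, 0, 0)`. -/
def planet (e' l : ℝ) : Space := keplerPosition 1 e' 0 0 0 l

/-! ### The resonant variables and the position of the particle -/

/-- The semi-major axis `ã = (q/p)^(2/3)` of the exact resonance. -/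
def aRes (p q : ℕ) : ℝ := ((q : ℝ) / p) ^ (2 / 3 : ℝ)

/-- `Λ = √a = √ã + u`. -/
def Lam (p q : ℕ) (X : Phase) : ℝ := Real.sqrt (aRes p q) + u X

/-- The eccentricity, from `|x|² = Λ (1 - √(1 - e²))`. -/
def ecc (p q : ℕ) (X : Phase) : ℝ := Real.sqrt (1 - (1 - ‖x X‖ ^ 2 / Lam p q X) ^ 2)

/-- The norm of the angular momentum, `Λ √(1 - e²) = Λ - |x|²`. -/
def angMom (p q : ℕ) (X : Phase) : ℝ := Lam p q X - ‖x X‖ ^ 2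

/-- The inclination, from `|y|² = Λ √(1 - e²) (1 - cos I)`. -/
def incl (p q : ℕ) (X : Phase) : ℝ := Real.arccos (1 - ‖y X‖ ^ 2 / angMom p q X)

/-- The mean longitude `λ = θ + (p/q) λ'` of the particle. -/
def lam (p q : ℕ) (X : Phase) : ℝ := theta X + (p : ℝ) / q * lamP X

/-- The heliocentric position of the particle in the resonant variables: `a = Λ²`,
the longitude of the periaster is `ϖ = arg x`, that of the node is `Ω = arg y`, the argument of the
periaster is `ϖ - Ω`, and the mean anomaly is `λ - ϖ`. -/
def position (p q : ℕ) (X : Phase) : Space :=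
  keplerPosition (Lam p q X ^ 2) (ecc p q X) (incl p q X) (Complex.arg (y X))
    (Complex.arg (x X) - Complex.arg (y X)) (lam p q X - Complex.arg (x X))

/-! ### The Hamiltonians -/

/-- The Keplerian part `H_K`. -/
def HK (p q : ℕ) (X : Phase) : ℝ :=
  -1 / (2 * (Real.sqrt (aRes p q) + u X) ^ 2) - (p : ℝ) / q * u X

/-- The perturbation `H_P`. -/
def HP (p q : ℕ) (e' ε : ℝ) (X : Phase) : ℝ :=
  -ε / ‖position p q X - planet e' (lamP X)‖ + ε / ‖position p q X‖
    + ε * inner ℝ (position p q X) (planet e' (lamP X)) / ‖planet e' (lamP X)‖ ^ 3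

/-- The Hamiltonian `H = H_K + H_P` of the restricted three-body problem (without `Ξ`). -/
def H (p q : ℕ) (e' ε : ℝ) (X : Phase) : ℝ := HK p q X + HP p q e' ε X

/-- The averaged perturbation: the mean of `H_P` over `λ'`, at fixed `(θ, u, x, y)`.  Since
`λ = θ + (p/q) λ'`, the period in `λ'` is `2πq`. -/
def HPbar (p q : ℕ) (e' ε : ℝ) (X : Phase) : ℝ :=
  1 / (2 * Real.pi * q) * ∫ l in (0 : ℝ)..(2 * Real.pi * q), HP p q e' ε (setLamP X l)

/-- The averaged Hamiltonian `H_K + ⟨H_P⟩` (without `Ξ`). -/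
def Hbar (p q : ℕ) (e' ε : ℝ) (X : Phase) : ℝ := HK p q X + HPbar p q e' ε X

/-- The zero-mean primitive in `λ'` of `H_P - ⟨H_P⟩`, given by the integral of
`s (H_P - ⟨H_P⟩)` at `λ' + s` over a period in `s`, divided by the period. -/
def S0 (p q : ℕ) (e' ε : ℝ) (X : Phase) : ℝ :=
  1 / (2 * Real.pi * q) * ∫ s in (0 : ℝ)..(2 * Real.pi * q),
    s * (HP p q e' ε (setLamP X (lamP X + s)) - HPbar p q e' ε X)

/-! ### The collisionless domains -/

/-- The domain `𝔇_κ`.  The minima over `λ'` are taken at fixed `(θ, u, x, y)`.  The third condition,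
`cos² (I/2) ≥ τ/κ`, keeps the Poincaré chart away from its singularity at inclination `π`. -/
def domain (p q : ℕ) (e' σ Δt τ ρ Δ κ : ℝ) : Set Phase :=
  {X | |u X| ≤ κ * ρ ∧
    max ‖x X‖ ‖xt X‖ ≤ aRes p q ^ (1 / 4 : ℝ) * (1 - σ / κ) ∧
    ‖y X‖ ^ 2 ≤ 2 * (1 - τ / κ) * angMom p q X ∧
    (∀ l : ℝ, Δ / κ ≤ ‖position p q (setLamP X l) - planet e' l‖) ∧
    (∀ l : ℝ, Δt / κ ≤ ‖position p q (setLamP X l)‖)}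

/-- Translation of the lifted angles by the period `(2π, 0)` of `(θ, λ')`, i.e. `λ ↦ λ + 2π`. -/
def shiftLam : Phase := (2 * Real.pi, 0, 0, 0, 0, 0)

/-- Translation of the lifted angles by the period `(-2πp/q, 2π)` of `(θ, λ')`, i.e. `λ' ↦ λ' + 2π`
at fixed `λ`. -/
def shiftLamP (p q : ℕ) : Phase := (-(2 * Real.pi * p / q), 0, 0, 0, 2 * Real.pi, 0)

/-! ### The averaging transformation -/

/-- `S` is (the lift of) a smooth function of `(θ, u, x, y, λ')` near `𝔇_{3/2}`, and `Φ`, its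
time-one Hamiltonian map, is a symplectic transformation, defined near `𝔇_{4/3}`, which maps
`𝔇_{4/3}` into `𝔇_{3/2}`, preserves `λ'`, moves `Ξ` by at most `C ε / Δ` and the other variables by
at most `C ε / Δ²`, and conjugates `Ξ + H` to `Ξ + Hbar + R`, where
`|R| ≤ C (ε/Δ) (ε/Δ³ + ρ/Δ)` and `|∂R/∂W| ≤ C (ε/Δ²) (ε/Δ³ + ρ/Δ + slack W)` on `𝔇_{4/3}`. -/
def IsAveraging (p q : ℕ) (e' σ Δt τ ε ρ Δ C : ℝ) (slack : Var → ℝ)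
    (S : Phase → ℝ) (Φ : Phase → Phase) (R : Phase → ℝ) : Prop :=
  ∃ A B : Set Phase, IsOpen A ∧ IsOpen B ∧
    domain p q e' σ Δt τ ρ Δ (4 / 3) ⊆ A ∧ domain p q e' σ Δt τ ρ Δ (3 / 2) ⊆ B ∧
    -- the generating function
    ContDiffOn ℝ ∞ S B ∧
    (∀ X ∈ domain p q e' σ Δt τ ρ Δ (3 / 2),
      S (X + shiftLam) = S X ∧ S (X + shiftLamP p q) = S X ∧ ∀ z : ℝ, S (setXi X z) = S X) ∧
    -- the transformation
    IsTimeOneMap S Φ A B ∧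
    IsSymplecticOn Φ A ∧
    MapsTo Φ (domain p q e' σ Δt τ ρ Δ (4 / 3)) (domain p q e' σ Δt τ ρ Δ (3 / 2)) ∧
    (∀ X ∈ domain p q e' σ Δt τ ρ Δ (4 / 3),
      Φ (X + shiftLam) = Φ X + shiftLam ∧ Φ (X + shiftLamP p q) = Φ X + shiftLamP p q ∧
      lamP (Φ X) = lamP X) ∧
    (∀ X ∈ domain p q e' σ Δt τ ρ Δ (4 / 3),
      |Xi (Φ X) - Xi X| ≤ C * (ε / Δ) ∧
      ∀ W : Var, ‖coord W (Φ X) - coord W X‖ ≤ C * (ε / Δ ^ 2)) ∧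
    -- the transformed Hamiltonian and its remainder
    (∀ X ∈ A, Xi (Φ X) + H p q e' ε (Φ X) = Xi X + Hbar p q e' ε X + R X) ∧
    ContDiffOn ℝ ∞ R A ∧
    ∀ X ∈ domain p q e' σ Δt τ ρ Δ (4 / 3),
      |R X| ≤ C * (ε / Δ * (ε / Δ ^ 3 + ρ / Δ)) ∧
      ∀ W : Var, ‖partialD R X W‖ ≤ C * (ε / Δ ^ 2 * ((ε / Δ ^ 3 + ρ / Δ) + slack W))

/-- The value `1` at the variable `u`, and `ρ` at the others. -/
def slackAtU (ρ : ℝ) : Var → ℝ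
  | .u => 1
  | _ => ρ

end ResonantAveraging

end

/-! Let F = Ξ + H_K, g = H_P - H̄_P, and let ω = Λ⁻³ - p/q be the Keplerian frequency of θ. It
depends on u alone and vanishes at u = 0 by resonance, so it is O(ρ) on the domain. Along a
trajectory γ of the Hamiltonian field of S, F has derivative -(∂S/∂λ' + ω ∂S/∂θ) = -(g + r), where r
is the `residual` of the homological equation. Hence at time one H_* = ∫₀¹ (g(γ 0) - g(γ t) - r(γ
t)) dt + H_P(γ 1) - H_P(γ 0). F is not small, but only its derivative along the flow enters.
Derivatives of H_* are treated in the same way: the differential of F, evaluated on a solution of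
the variational equation, has derivative -(Dg + Dr).

Sizes. Where the distance to the planet is at least Δ/2, H_P is O(ε/Δ) and each of three derivatives
costs a factor 1/Δ (`exists_scaledBound_HP`). Averaging over λ' preserves such bounds, so S₀ obeys
them too. The field of S₀ is then O(ε/Δ²) and its differential O(ε/Δ³). The hypotheses Cε < ρΔ² and
Cε < Δ³ make the displacement small against ρ and Δ, which keeps trajectories in the larger domain
(`exists_thickening`), and make the differential at most 1/2, which gives a smooth symplectic
time-one map (`exists_flow`). The differences of g and H_P contribute (ε/Δ)(ε/Δ³) to H_*, and r
contributes (ε/Δ)(ρ/Δ) (`IsGenerator.remainder_bounds`).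

The generating function. Since ∂S₀/∂λ' = g, the residual of S₀ is ω ∂S₀/∂θ. It is small, but its
u-derivative contains ω', which is not: hence the weaker bound for S₀ (`isGenerator_S0`). With Q a
λ'-primitive of S₀, the function S₀ - ω ∂Q/∂θ has residual -ω² ∂²Q/∂θ², quadratic in ω, so a factor
ρ survives every first derivative (`isGenerator_S0_add_correction`). The correction is controlled
when ρ < Δ; when ρ ≥ Δ the loss is absorbed by η ≥ ρ/Δ ≥ 1, and S₀ itself serves.

The constants come from compactness: the position is smooth in the Poincaré variables, across
circular and planar orbits too (`position_eq_smoothPosition`), and the uniformly elliptic motions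
are compact modulo the periods and the translations of Ξ (`IsPeriodicSmooth.exists_bound`). -/

noncomputable section

namespace ResonantAveraging

/-! ### Smooth dependence of a flow on the initial condition -/

section PathSpace

open Metric Topology unitInterval BoundedContinuousFunction

/-- Superposition with a continuous map, on paths. -/
def superpose {E F : Type} [NormedAddCommGroup E] [NormedAddCommGroup F] (V : E → F)
    (hV : Continuous V) (γ : I →ᵇ E) : I →ᵇ F :=
  BoundedContinuousFunction.mkOfCompact ((⟨V, hV⟩ : C(E, F)).comp γ.toContinuousMap)

@[simp] lemma superpose_apply {E F : Type} [NormedAddCommGroup E] [NormedAddCommGroup F]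
    (V : E → F) (hV : Continuous V) (γ : I →ᵇ E) (t : I) :
    superpose V hV γ t = V (γ t) := rfl

lemma continuous_superpose {E F : Type} [NormedAddCommGroup E] [NormedAddCommGroup F]
    (V : E → F) (hV : Continuous V) : Continuous (superpose V hV) :=
  (ContinuousMap.isometryEquivBoundedOfCompact I F).continuous.comp
    ((ContinuousMap.continuous_postcomp _).comp
      (ContinuousMap.isometryEquivBoundedOfCompact I E).symm.continuous)

variable {E F : Type} [NormedAddCommGroup E] [NormedSpace ℝ E]
  [NormedAddCommGroup F] [NormedSpace ℝ F]

/-- A path of operators acts on paths pointwise. -/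
def pointwiseAction : (I →ᵇ (E →L[ℝ] F)) →L[ℝ] (I →ᵇ E) →L[ℝ] (I →ᵇ F) :=
  LinearMap.mkContinuous₂
    (LinearMap.mk₂ ℝ (fun (a : I →ᵇ (E →L[ℝ] F)) (η : (I →ᵇ E)) =>
        BoundedContinuousFunction.mkOfCompact
          (⟨fun t => a t (η t), a.continuous.clm_apply η.continuous⟩ : C(I, F)))
      (fun a b η => by ext t; simp) (fun c a η => by ext t; simp)
      (fun a η ζ => by ext t; simp) (fun c a η => by ext t; simp)) 1
    (fun a η => by
      rw [one_mul, BoundedContinuousFunction.norm_le (by positivity)]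
      intro t
      exact ((a t).le_opNorm _).trans
        (mul_le_mul (a.norm_coe_le_norm t) (η.norm_coe_le_norm t) (norm_nonneg _) (norm_nonneg a)))

@[simp] lemma pointwiseAction_apply (a : I →ᵇ (E →L[ℝ] F)) (η : (I →ᵇ E)) (t : I) :
    pointwiseAction a η t = a t (η t) := rfl

/-- The map `γ ↦ fderiv ℝ V ∘ γ` is continuous in the sup norm, which provides one radius for the
mean value inequality at all times `t`. -/
lemma hasFDerivAt_superpose (V : E → F) (hV : ContDiff ℝ 1 V) (γ : (I →ᵇ E)) :
    HasFDerivAt (superpose V hV.continuous)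
      (pointwiseAction (superpose (fderiv ℝ V) (hV.continuous_fderiv one_ne_zero) γ)) γ := by
  rw [hasFDerivAt_iff_isLittleO_nhds_zero, Asymptotics.isLittleO_iff]
  intro c hc
  have hcont := (continuous_superpose (fderiv ℝ V) (hV.continuous_fderiv one_ne_zero)).tendsto γ
  obtain ⟨δ, hδ, hδc⟩ := Metric.tendsto_nhds_nhds.1 hcont c hc
  filter_upwards [Metric.ball_mem_nhds (0 : (I →ᵇ E)) hδ] with η hη
  rw [mem_ball_zero_iff] at hη
  rw [BoundedContinuousFunction.norm_le (by positivity)]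
  intro t
  have key : ∀ z ∈ ball (γ t) δ, ‖fderiv ℝ V z - fderiv ℝ V (γ t)‖ ≤ c := by
    intro z hz
    -- The whole path is shifted by a constant so that its value at `t` becomes `z`; continuity at
    -- `γ` in the sup norm then bounds `fderiv ℝ V z`.
    have h1 : dist (γ + BoundedContinuousFunction.const I (z - γ t)) γ < δ := by
      rw [dist_eq_norm, add_sub_cancel_left]
      refine lt_of_le_of_lt ((BoundedContinuousFunction.norm_le (norm_nonneg _)).2 fun s => ?_)
        (by rwa [mem_ball, dist_eq_norm] at hz : ‖z - γ t‖ < δ)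
      simp
    have h2 := hδc h1
    rw [dist_eq_norm] at h2
    have h3 := (BoundedContinuousFunction.norm_coe_le_norm _ t).trans h2.le
    simpa using h3
  have hη' : ‖η t‖ < δ := (η.norm_coe_le_norm t).trans_lt hη
  have h4 := (convex_ball (γ t) δ).norm_image_sub_le_of_norm_hasFDerivWithin_le'
    (f := V) (f' := fderiv ℝ V) (φ := fderiv ℝ V (γ t))
    (fun z _ => ((hV.differentiable one_ne_zero) z).hasFDerivAt.hasFDerivWithinAt) key
    (mem_ball_self hδ) (y := γ t + η t) (by simpa [mem_ball, dist_eq_norm] using hη')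
  have h5 : ‖γ t + η t - γ t‖ ≤ ‖η‖ := by simpa using η.norm_coe_le_norm t
  simp only [add_sub_cancel_left] at h4 h5
  simpa using h4.trans (mul_le_mul_of_nonneg_left h5 hc.le)

/-- The derivative of a superposition is again one, with `fderiv ℝ V`, followed by the continuous
linear `pointwiseAction`; the codomain therefore varies in the induction. -/
lemma contDiff_superpose_nat (n : ℕ) : ∀ {F : Type} [NormedAddCommGroup F] [NormedSpace ℝ F]
    (V : E → F) (hV : ContDiff ℝ ∞ V), ContDiff ℝ n (superpose V hV.continuous) := by
  induction n with
  | zero =>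
    intro F _ _ V hV
    exact contDiff_zero.2 (continuous_superpose V hV.continuous)
  | succ n ih =>
    intro F _ _ V hV
    have h1 : ContDiff ℝ ∞ (fderiv ℝ V) := hV.fderiv_right (by simp)
    push_cast
    rw [contDiff_succ_iff_hasFDerivAt]
    have h2 : ContDiff ℝ n (pointwiseAction (E := E) (F := F)) := ContinuousLinearMap.contDiff _
    refine ⟨fun γ => pointwiseAction (superpose (fderiv ℝ V) h1.continuous γ),
      h2.comp (ih _ h1), fun γ => ?_⟩
    exact hasFDerivAt_superpose V (hV.of_le (by norm_cast)) γ

lemma contDiff_superpose (V : E → F) (hV : ContDiff ℝ ∞ V) :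
    ContDiff ℝ ∞ (superpose V hV.continuous) :=
  contDiff_infty.2 fun n => contDiff_superpose_nat n V hV

/-- The primitive of a path that vanishes at `0`. -/
def pathPrimitive [CompleteSpace F] : (I →ᵇ F) →L[ℝ] (I →ᵇ F) :=
  LinearMap.mkContinuous
    { toFun := fun η => mkOfCompact ⟨fun t => ∫ s in (0 : ℝ)..t, η (projIcc 0 1 zero_le_one s), by
        have h : Continuous fun s => η (projIcc 0 1 zero_le_one s) :=
          η.continuous.comp continuous_projIcc
        exact (intervalIntegral.continuous_primitive
          (fun a b => h.intervalIntegrable a b) 0).comp continuous_subtype_val⟩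
      map_add' := fun η ζ => by
        ext t
        have h : ∀ η : (I →ᵇ F), IntervalIntegrable (fun s => η (projIcc 0 1 zero_le_one s))
            MeasureTheory.volume 0 t := fun η =>
          (η.continuous.comp continuous_projIcc).intervalIntegrable _ _
        simp [intervalIntegral.integral_add (h η) (h ζ)]
      map_smul' := fun c η => by
        ext t
        simp } 1
    (fun η => by
      rw [one_mul, BoundedContinuousFunction.norm_le (norm_nonneg _)]
      intro t
      have := intervalIntegral.norm_integral_le_of_norm_le_const (a := 0) (b := (t : ℝ))
        (f := fun s => η (projIcc 0 1 zero_le_one s)) (C := ‖η‖)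
        (fun s _ => η.norm_coe_le_norm _)
      refine this.trans ?_
      rw [sub_zero, abs_of_nonneg t.2.1]
      exact mul_le_of_le_one_right (norm_nonneg _) t.2.2)

lemma pathPrimitive_apply [CompleteSpace F] (η : (I →ᵇ F)) (t : I) :
    pathPrimitive η t = ∫ s in (0 : ℝ)..t, η (projIcc 0 1 zero_le_one s) := rfl

lemma norm_pathPrimitive_le [CompleteSpace F] (η : I →ᵇ F) : ‖pathPrimitive η‖ ≤ ‖η‖ := by
  refine (BoundedContinuousFunction.norm_le (norm_nonneg _)).2 fun t => ?_
  have := intervalIntegral.norm_integral_le_of_norm_le_const (a := 0) (b := (t : ℝ))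
    (f := fun s => η (projIcc 0 1 zero_le_one s)) (C := ‖η‖)
    (fun s _ => η.norm_coe_le_norm _)
  refine this.trans ?_
  rw [sub_zero, abs_of_nonneg t.2.1]
  exact mul_le_of_le_one_right (norm_nonneg _) t.2.2

/-- A path which satisfies an integral equation satisfies the differential equation. -/
lemma hasDerivWithinAt_of_eq_pathPrimitive [CompleteSpace F] (w η : (I →ᵇ F)) (v : F)
    (h : w = BoundedContinuousFunction.const I v + pathPrimitive η) (t : ℝ) (ht : t ∈ Icc (0 : ℝ) 1) :
    HasDerivWithinAt (fun s => w (projIcc 0 1 zero_le_one s)) (η ⟨t, ht⟩) (Icc 0 1) t := by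
  have hc : Continuous fun s => η (projIcc 0 1 zero_le_one s) :=
    η.continuous.comp continuous_projIcc
  have h1 : HasDerivAt (fun t => v + ∫ s in (0 : ℝ)..t, η (projIcc 0 1 zero_le_one s))
      (η (projIcc 0 1 zero_le_one t)) t :=
    (intervalIntegral.integral_hasDerivAt_right (hc.intervalIntegrable _ _)
      (hc.stronglyMeasurableAtFilter _ _) hc.continuousAt).const_add v
  rw [projIcc_of_mem _ ht] at h1
  refine h1.hasDerivWithinAt.congr_of_mem (fun s hs => ?_) ht
  rw [projIcc_of_mem _ hs, h]
  simp [pathPrimitive_apply]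

/-- A solution of a differential equation satisfies the integral equation. -/
lemma eq_pathPrimitive_of_hasDerivWithinAt [CompleteSpace F] (γ : ℝ → F) (η w : (I →ᵇ F))
    (h : ∀ t (ht : t ∈ Icc (0 : ℝ) 1), HasDerivWithinAt γ (η ⟨t, ht⟩) (Icc 0 1) t)
    (hw : ∀ t : I, w t = γ t) :
    w = BoundedContinuousFunction.const I (γ 0) + pathPrimitive η := by
  ext t
  have hc : Continuous fun s => η (projIcc 0 1 zero_le_one s) :=
    η.continuous.comp continuous_projIcc
  have hcont : ContinuousOn γ (Icc 0 1) := fun s hs => (h s hs).continuousWithinAt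
  have := intervalIntegral.integral_eq_sub_of_hasDerivAt_of_le (a := 0) (b := (t : ℝ)) t.2.1
    (f := γ) (f' := fun s => η (projIcc 0 1 zero_le_one s))
    (hcont.mono (Icc_subset_Icc_right t.2.2)) (fun s hs => by
      have hs' : s ∈ Icc (0 : ℝ) 1 := ⟨hs.1.le, hs.2.le.trans t.2.2⟩
      rw [projIcc_of_mem _ hs']
      exact (h s hs').hasDerivAt (Icc_mem_nhds hs.1 (hs.2.trans_le t.2.2)))
    (hc.intervalIntegrable _ _)
  simp [pathPrimitive_apply, this, hw]

/-- The path which stays at a point. -/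
def constPath : E →L[ℝ] (I →ᵇ E) :=
  LinearMap.mkContinuous
    { toFun := fun x : E => BoundedContinuousFunction.const I x
      map_add' := fun x y => by ext; rfl
      map_smul' := fun c x => by ext; rfl } 1 (fun x => by
        rw [one_mul, BoundedContinuousFunction.norm_le (norm_nonneg _)]
        intro t
        rfl)

@[simp] lemma constPath_apply (x : E) : constPath x = BoundedContinuousFunction.const I x := rfl

end PathSpace

/-- The inverse function theorem for a perturbation of the identity. -/
lemma exists_smooth_local_inverse {X : Type} [NormedAddCommGroup X] [NormedSpace ℝ X]
    [CompleteSpace X] {N : X → X} (hN : ContDiff ℝ ∞ N) {T : X →L[ℝ] X} {a : X}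
    (hT : ‖T‖ < 1) (hNa : HasFDerivAt N (ContinuousLinearMap.id ℝ X - T) a) :
    ∃ g : X → X, ContDiffAt ℝ ∞ g (N a) ∧ g (N a) = a ∧ ∀ᶠ c in nhds (N a), N (g c) = c := by
  -- Neumann series: the identity minus an operator of norm less than one is a unit.
  obtain ⟨e, he⟩ : ∃ e : X ≃L[ℝ] X, (e : X →L[ℝ] X) = ContinuousLinearMap.id ℝ X - T :=
    ⟨ContinuousLinearEquiv.unitsEquiv ℝ X (Units.oneSub T hT), rfl⟩
  rw [← he] at hNa
  have hn0 : (∞ : WithTop ℕ∞) ≠ 0 := by simp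
  exact ⟨hN.contDiffAt.localInverse hNa hn0, hN.contDiffAt.to_localInverse hNa hn0,
    hN.contDiffAt.localInverse_apply_image hNa hn0,
    (hN.contDiffAt.hasStrictFDerivAt' hNa hn0).eventually_right_inverse⟩

/-! ### The flow of a small vector field up to time one -/

section Flow

open Metric Topology unitInterval BoundedContinuousFunction

variable {E : Type} [NormedAddCommGroup E] [NormedSpace ℝ E]

/-- The integral equation `γ = const + ∫ V ∘ γ` can be solved smoothly near a solution along which
the derivative of `V` is small. -/
lemma exists_smooth_integral_solution [CompleteSpace E] (V : E → E) (hV : ContDiff ℝ ∞ V)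
    (γ₀ : (I →ᵇ E)) (hDV : ∀ t, ‖fderiv ℝ V (γ₀ t)‖ ≤ 1 / 2) (x₀ : E)
    (h₀ : γ₀ = BoundedContinuousFunction.const I x₀ + pathPrimitive (superpose V hV.continuous γ₀)) :
    ∃ Γ : E → (I →ᵇ E), ContDiffAt ℝ ∞ Γ x₀ ∧ Γ x₀ = γ₀ ∧
      ∀ᶠ x in 𝓝 x₀, Γ x = BoundedContinuousFunction.const I x +
        pathPrimitive (superpose V hV.continuous (Γ x)) := by
  have hV1 : ContDiff ℝ 1 V := hV.of_le (by norm_cast)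
  -- The integral equation with initial point `x` reads `N γ = constPath x`. The smooth local
  -- inverse of `N`, composed with `constPath`, gives the solution as a function of `x`.
  set N : (I →ᵇ E) → (I →ᵇ E) := fun γ => γ - pathPrimitive (superpose V hV.continuous γ) with hN
  set T : (I →ᵇ E) →L[ℝ] (I →ᵇ E) := pathPrimitive.comp
    (pointwiseAction (superpose (fderiv ℝ V) (hV1.continuous_fderiv one_ne_zero) γ₀)) with hT
  have hTn : ‖T‖ < 1 := by
    have h1 : ‖T‖ ≤ 1 / 2 := by
      refine ContinuousLinearMap.opNorm_le_bound _ (by norm_num) fun η => ?_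
      refine (norm_pathPrimitive_le _).trans
        ((BoundedContinuousFunction.norm_le (by positivity)).2 fun t => ?_)
      change ‖fderiv ℝ V (γ₀ t) (η t)‖ ≤ _
      exact (ContinuousLinearMap.le_opNorm _ _).trans
        (mul_le_mul (hDV t) (η.norm_coe_le_norm t) (norm_nonneg _) (by norm_num))
    linarith
  have hPs : ContDiff ℝ ∞ (pathPrimitive (F := E)) := ContinuousLinearMap.contDiff _
  have hNs : ContDiff ℝ ∞ N := contDiff_id.sub (hPs.comp (contDiff_superpose V hV))
  have hPd := (pathPrimitive (F := E)).hasFDerivAt.comp γ₀ (hasFDerivAt_superpose V hV1 γ₀)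
  have hNd : HasFDerivAt N (ContinuousLinearMap.id ℝ (I →ᵇ E) - T) γ₀ :=
    (hasFDerivAt_id (𝕜 := ℝ) γ₀).sub hPd
  have hN0 : N γ₀ = constPath x₀ := sub_eq_iff_eq_add.2 h₀
  obtain ⟨g, hgs, hg0, hinv⟩ := exists_smooth_local_inverse hNs hTn hNd
  rw [hN0] at hgs hg0 hinv
  have hcs : ContDiff ℝ ∞ (constPath (E := E)) := ContinuousLinearMap.contDiff _
  refine ⟨fun x => g (constPath x), hgs.comp x₀ hcs.contDiffAt, hg0, ?_⟩
  filter_upwards [hcs.continuous.continuousAt.eventually hinv] with x hx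
  exact sub_eq_iff_eq_add.1 hx

lemma lipschitzOnWith_of_norm_fderiv_le_half {V : E → E} {B : Set E} (hB : IsOpen B)
    (hV : ContDiffOn ℝ ∞ V B) (hDV : ∀ X ∈ B, ‖fderiv ℝ V X‖ ≤ 1 / 2) {s : Set E}
    (hs : Convex ℝ s) (hsB : s ⊆ B) : LipschitzOnWith (1 / 2) V s := by
  refine hs.lipschitzOnWith_of_nnnorm_fderiv_le (𝕜 := ℝ)
    (fun x hx => ((hV.contDiffAt (hB.mem_nhds (hsB hx))).differentiableAt (by simp))) fun x hx => ?_
  have := hDV x (hsB hx)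
  rw [← NNReal.coe_le_coe]
  simpa using this

/-- Agreement at time `0` identifies trajectories with a common start; agreement at time `1` is what
makes the time-one map injective. -/
lemma trajectory_unique {V : E → E} {s : Set E} (hV : LipschitzOnWith (1 / 2) V s)
    {γ₁ γ₂ : ℝ → E}
    (h₁ : ∀ t ∈ Icc (0 : ℝ) 1, γ₁ t ∈ s ∧ HasDerivWithinAt γ₁ (V (γ₁ t)) (Icc 0 1) t)
    (h₂ : ∀ t ∈ Icc (0 : ℝ) 1, γ₂ t ∈ s ∧ HasDerivWithinAt γ₂ (V (γ₂ t)) (Icc 0 1) t)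
    (h : γ₁ 0 = γ₂ 0 ∨ γ₁ 1 = γ₂ 1) : EqOn γ₁ γ₂ (Icc 0 1) := by
  rcases h with h | h
  · exact ODE_solution_unique_of_mem_Icc_right (v := fun _ => V) (s := fun _ => s)
      (fun t _ => hV) (fun t ht => (h₁ t ht).2.continuousWithinAt)
      (fun t ht => (h₁ t (Ico_subset_Icc_self ht)).2.mono_of_mem_nhdsWithin
        (Icc_mem_nhdsGE_of_mem ht))
      (fun t ht => (h₁ t (Ico_subset_Icc_self ht)).1)
      (fun t ht => (h₂ t ht).2.continuousWithinAt)
      (fun t ht => (h₂ t (Ico_subset_Icc_self ht)).2.mono_of_mem_nhdsWithin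
        (Icc_mem_nhdsGE_of_mem ht))
      (fun t ht => (h₂ t (Ico_subset_Icc_self ht)).1) h
  · exact ODE_solution_unique_of_mem_Icc_left (v := fun _ => V) (s := fun _ => s)
      (fun t _ => hV) (fun t ht => (h₁ t ht).2.continuousWithinAt)
      (fun t ht => (h₁ t (Ioc_subset_Icc_self ht)).2.mono_of_mem_nhdsWithin
        (Icc_mem_nhdsLE_of_mem ht))
      (fun t ht => (h₁ t (Ioc_subset_Icc_self ht)).1)
      (fun t ht => (h₂ t ht).2.continuousWithinAt)
      (fun t ht => (h₂ t (Ioc_subset_Icc_self ht)).2.mono_of_mem_nhdsWithin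
        (Icc_mem_nhdsLE_of_mem ht))
      (fun t ht => (h₂ t (Ioc_subset_Icc_self ht)).1) h

/-- Picard iteration in the ball itself: a field bounded by `M` needs at least time one to leave a
ball of radius `M`. The fixed point is used directly because its membership in the ball is needed.
-/
lemma exists_trajectory [CompleteSpace E] {V : E → E} {X : E} {M : NNReal}
    (hV : LipschitzOnWith (1 / 2) V (closedBall X M)) (hVM : ∀ Y ∈ closedBall X M, ‖V Y‖ ≤ M) :
    ∃ γ : ℝ → E, γ 0 = X ∧ ∀ t ∈ Icc (0 : ℝ) 1, γ t ∈ closedBall X M ∧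
      HasDerivWithinAt γ (V (γ t)) (Icc 0 1) t := by
  have hPL : IsPicardLindelof (fun _ => V) (tmin := 0) (tmax := 1) ⟨0, left_mem_Icc.2 zero_le_one⟩ X
      M 0 M (1 / 2) :=
    IsPicardLindelof.of_time_independent hVM hV (by simp)
  obtain ⟨α, hα⟩ := ODE.FunSpace.exists_isFixedPt_next hPL (mem_closedBall_self le_rfl)
  have hα0 : α.compProj 0 = X := by
    rw [ODE.FunSpace.compProj_of_mem (left_mem_Icc.2 zero_le_one), ← hα]
    exact ODE.FunSpace.next_apply₀ hPL _ α
  refine ⟨α.compProj, hα0, fun t ht => ⟨α.compProj_mem_closedBall hPL.mul_max_le, ?_⟩⟩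
  refine (ODE.hasDerivWithinAt_picard_Icc (f := fun _ => V) (u := closedBall X M)
    (left_mem_Icc.2 zero_le_one) hPL.continuousOn_uncurry
    α.continuous_compProj.continuousOn (fun _ _ => α.compProj_mem_closedBall hPL.mul_max_le)
    X ht).congr_of_mem (fun t' ht' => ?_) ht
  rw [ODE.FunSpace.compProj_of_mem ht']
  nth_rw 1 [← hα]
  rw [ODE.FunSpace.next_apply]

/-- A smooth vector field on an open set can be globalized near a closed ball. -/
lemma exists_contDiff_eqOn_closedBall [FiniteDimensional ℝ E] {V : E → E} {B : Set E}
    (hB : IsOpen B) (hV : ContDiffOn ℝ ∞ V B) {X : E} {M : ℝ} (hM : 0 < M)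
    (hXB : closedBall X (3 * M) ⊆ B) :
    ∃ W : E → E, ContDiff ℝ ∞ W ∧ EqOn W V (closedBall X (2 * M)) := by
  let b : ContDiffBump X := ⟨2 * M, 3 * M, by linarith, by linarith⟩
  refine ⟨fun Y => b Y • V Y, ?_, fun Y hY => ?_⟩
  · rw [contDiff_iff_contDiffAt]
    intro Y
    by_cases hY : Y ∈ B
    · exact b.contDiff.contDiffAt.smul (hV.contDiffAt (hB.mem_nhds hY))
    · have h1 : Y ∈ (closedBall X (3 * M))ᶜ := fun h => hY (hXB h)
      have h2 : (fun Y => b Y • V Y) =ᶠ[𝓝 Y] fun _ => 0 := by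
        filter_upwards [isClosed_closedBall.isOpen_compl.mem_nhds h1] with Z hZ
        have : b Z = 0 := b.zero_of_le_dist (by
          have : 3 * M < dist Z X := by simpa using hZ
          exact this.le)
        simp [this]
      exact contDiffAt_const.congr_of_eventuallyEq h2
  · have : b Y = 1 := b.one_of_mem_closedBall hY
    simp [this]

/-- A small smooth vector field with small derivative has a flow up to time one, which depends
smoothly on the initial condition; its differential solves the variational equation. -/
theorem exists_flow [FiniteDimensional ℝ E] {V : E → E} {A B : Set E} (hA : IsOpen A)
    (hB : IsOpen B) (hV : ContDiffOn ℝ ∞ V B) {M : ℝ} (hM : 0 < M)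
    (hVM : ∀ X ∈ B, ‖V X‖ ≤ M) (hDV : ∀ X ∈ B, ‖fderiv ℝ V X‖ ≤ 1 / 2)
    (hAB : ∀ X ∈ A, closedBall X (4 * M) ⊆ B) :
    ∃ φ : E → ℝ → E,
      (∀ X ∈ A, φ X 0 = X ∧ ∀ t ∈ Icc (0 : ℝ) 1, φ X t ∈ closedBall X M ∧
        HasDerivWithinAt (φ X) (V (φ X t)) (Icc 0 1) t) ∧
      ContDiffOn ℝ ∞ (fun X => φ X 1) A ∧ InjOn (fun X => φ X 1) A ∧
      ∀ X ∈ A, ∀ v, ∃ w : ℝ → E, w 0 = v ∧ w 1 = fderiv ℝ (fun X => φ X 1) X v ∧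
        ∀ t ∈ Icc (0 : ℝ) 1,
          HasDerivWithinAt w (fderiv ℝ V (φ X t) (w t)) (Icc 0 1) t := by
  have : CompleteSpace E := FiniteDimensional.complete ℝ E
  have hlip : ∀ {s : Set E}, Convex ℝ s → s ⊆ B → LipschitzOnWith (1 / 2) V s :=
    fun hs hsB => lipschitzOnWith_of_norm_fderiv_le_half hB hV hDV hs hsB
  have hball : ∀ X ∈ A, ∀ c ≤ 4 * M, closedBall X c ⊆ B := fun X hX c hc =>
    (closedBall_subset_closedBall hc).trans (hAB X hX)
  have hex : ∀ X, ∃ γ : ℝ → E, X ∈ A → γ 0 = X ∧ ∀ t ∈ Icc (0 : ℝ) 1, γ t ∈ closedBall X M ∧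
      HasDerivWithinAt γ (V (γ t)) (Icc 0 1) t := by
    intro X
    by_cases hX : X ∈ A
    · have hs := hball X hX M (by linarith)
      obtain ⟨γ, hγ⟩ := exists_trajectory (M := ⟨M, hM.le⟩) (hlip (convex_closedBall X M) hs)
        (fun Y hY => hVM Y (hs hY))
      exact ⟨γ, fun _ => hγ⟩
    · exact ⟨fun _ => X, fun h => absurd h hX⟩
  choose φ hφ using hex
  have hlocal : ∀ X ∈ A, ContDiffAt ℝ ∞ (fun X => φ X 1) X ∧
      ∀ v, ∃ w : ℝ → E, w 0 = v ∧ w 1 = fderiv ℝ (fun X => φ X 1) X v ∧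
        ∀ t ∈ Icc (0 : ℝ) 1,
          HasDerivWithinAt w (fderiv ℝ V (φ X t) (w t)) (Icc 0 1) t := by
    intro X hX
    -- Superposition needs a field defined everywhere. The cut-off `W` agrees with `V` on the ball
    -- of radius `2 * M`, which contains all trajectories that start within `M` of `X`.
    obtain ⟨W, hW, hWV⟩ := exists_contDiff_eqOn_closedBall hB hV hM (hball X hX _ (by linarith))
    have hWD : ∀ Y ∈ closedBall X M, fderiv ℝ W Y = fderiv ℝ V Y := by
      intro Y hY
      refine Filter.EventuallyEq.fderiv_eq ?_
      filter_upwards [isOpen_ball.mem_nhds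
        (closedBall_subset_ball (by linarith : M < 2 * M) hY)] with Z hZ
      exact hWV (ball_subset_closedBall hZ)
    have hmem : ∀ t ∈ Icc (0 : ℝ) 1, φ X t ∈ closedBall X M := fun t ht => ((hφ X hX).2 t ht).1
    have hsub : closedBall X M ⊆ closedBall X (2 * M) :=
      closedBall_subset_closedBall (by linarith)
    let γ₀ : I →ᵇ E := mkOfCompact ⟨fun t => φ X t, by
      have : ContinuousOn (φ X) (Icc 0 1) := fun t ht => ((hφ X hX).2 t ht).2.continuousWithinAt
      exact continuousOn_iff_continuous_domRestrict.1 this⟩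
    have hγ₀ : ∀ t : I, γ₀ t = φ X t := fun t => rfl
    have hint : γ₀ = BoundedContinuousFunction.const I X + pathPrimitive (superpose W hW.continuous γ₀) := by
      have h := eq_pathPrimitive_of_hasDerivWithinAt (φ X) (superpose W hW.continuous γ₀) γ₀
        (fun t ht => by
          have h1 := ((hφ X hX).2 t ht).2
          rw [superpose_apply, hγ₀]
          rw [hWV (hsub (hmem t ht))]
          exact h1) hγ₀
      rwa [(hφ X hX).1] at h
    obtain ⟨Γ, hΓs, hΓ0, hΓ⟩ := exists_smooth_integral_solution W hW γ₀
      (fun t => by rw [hγ₀, hWD _ (hmem t t.2)]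
                   exact hDV _ (hball X hX M (by linarith) (hmem t t.2))) X hint
    -- The trajectories `φ Y` were chosen one point at a time. Uniqueness identifies them near `X`
    -- with the smooth family `Γ`.
    have heq : ∀ᶠ Y in 𝓝 X, ∀ t : I, φ Y t = Γ Y t := by
      have hclose : ∀ᶠ Y in 𝓝 X, Γ Y ∈ ball (Γ X) M :=
        hΓs.continuousAt (ball_mem_nhds _ hM)
      filter_upwards [hΓ, hclose, hA.mem_nhds hX, ball_mem_nhds X hM] with Y h1 h2 h3 h4
      have hΓmem : ∀ t : I, Γ Y t ∈ closedBall X (2 * M) := by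
        intro t
        have h5 : dist (Γ Y t) (Γ X t) ≤ M := (BoundedContinuousFunction.dist_coe_le_dist t).trans h2.le
        have h6 := hmem t t.2
        rw [mem_closedBall] at h6 ⊢
        rw [hΓ0, hγ₀] at h5
        linarith [dist_triangle (Γ Y t) (φ X t) X]
      have huniq := trajectory_unique
        (hlip (convex_closedBall X (2 * M)) (hball X hX _ (by linarith)))
        (γ₁ := φ Y) (γ₂ := fun t => Γ Y (projIcc 0 1 zero_le_one t))
        (fun t ht => ⟨by
            have h5 := ((hφ Y h3).2 t ht).1
            rw [mem_closedBall] at h5 ⊢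
            rw [mem_ball] at h4
            linarith [dist_triangle (φ Y t) Y X], ((hφ Y h3).2 t ht).2⟩)
        (fun t ht => ⟨hΓmem _, by
            have h5 := hasDerivWithinAt_of_eq_pathPrimitive (Γ Y) _ Y h1 t ht
            rw [superpose_apply, hWV (hΓmem _)] at h5
            rw [projIcc_of_mem _ ht]
            exact h5⟩)
        (Or.inl (by
          rw [(hφ Y h3).1]
          rw [h1]
          simp [pathPrimitive_apply]))
      intro t
      rw [huniq t.2]
      simp
    have h1e : (fun Y => φ Y 1) =ᶠ[𝓝 X] fun Y => Γ Y 1 := by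
      filter_upwards [heq] with Y hY
      exact hY 1
    have hev : ∀ t : I, ∃ L : (I →ᵇ E) →L[ℝ] E, ∀ γ : (I →ᵇ E), L γ = γ t := fun t =>
      ⟨BoundedContinuousFunction.evalCLM ℝ t, fun γ => rfl⟩
    obtain ⟨L, hL⟩ := hev 1
    have hΓd : HasFDerivAt Γ (fderiv ℝ Γ X) X := (hΓs.differentiableAt (by simp)).hasFDerivAt
    refine ⟨?_, fun v => ?_⟩
    · refine ContDiffAt.congr_of_eventuallyEq ?_ h1e
      have : (fun Y => Γ Y 1) = L ∘ Γ := funext fun Y => (hL _).symm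
      rw [this]
      exact L.contDiff.contDiffAt.comp X hΓs
    · set ζ : (I →ᵇ E) := fderiv ℝ Γ X v with hζ
      have hV1 : ContDiff ℝ 1 W := hW.of_le (by norm_cast)
      -- Differentiating the integral equation of `Γ` in the direction `v` gives the variational
      -- equation in integral form.
      have hζeq : ζ = BoundedContinuousFunction.const I v + pathPrimitive
          (pointwiseAction (superpose (fderiv ℝ W) (hV1.continuous_fderiv one_ne_zero) γ₀) ζ) := by
        have hs := hasFDerivAt_superpose W hV1 (Γ X)
        have h5 := (constPath (E := E)).hasFDerivAt.add (x := X)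
          ((pathPrimitive (F := E)).hasFDerivAt.comp X (hs.comp X hΓd))
        have h6 : Γ =ᶠ[𝓝 X] ((constPath (E := E)) + (pathPrimitive ∘ (superpose W hV1.continuous ∘ Γ))) := by
          filter_upwards [hΓ] with Y hY
          simp only [Pi.add_apply, Function.comp_apply, constPath_apply]
          exact hY
        have h7 := hΓd.unique (h5.congr_of_eventuallyEq h6)
        have h8 := congrArg (fun l : E →L[ℝ] (I →ᵇ E) => l v) h7
        rw [← hΓ0]
        exact h8
      refine ⟨fun t => ζ (projIcc 0 1 zero_le_one t), ?_, ?_, fun t ht => ?_⟩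
      · change ζ (projIcc 0 1 zero_le_one 0) = v
        rw [hζeq]
        simp [pathPrimitive_apply]
      · have h9 : HasFDerivAt (fun Y => φ Y 1) (L.comp (fderiv ℝ Γ X)) X := by
          refine HasFDerivAt.congr_of_eventuallyEq ?_ h1e
          have : (fun Y => Γ Y 1) = L ∘ Γ := funext fun Y => (hL _).symm
          rw [this]
          exact L.hasFDerivAt.comp X hΓd
        rw [h9.fderiv]
        simp only [ContinuousLinearMap.comp_apply, hL, projIcc_right]
        rfl
      · have h10 := hasDerivWithinAt_of_eq_pathPrimitive ζ _ v hζeq t ht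
        rw [pointwiseAction_apply, superpose_apply, hγ₀, hWD _ (hmem t ht)] at h10
        change HasDerivWithinAt _ (fderiv ℝ V (φ X t) (ζ (projIcc 0 1 zero_le_one t))) _ _
        rw [projIcc_of_mem _ ht]
        exact h10
  refine ⟨φ, fun X hX => hφ X hX, fun X hX => (hlocal X hX).1.contDiffWithinAt,
    fun X hX Y hY hXY => ?_, fun X hX => (hlocal X hX).2⟩
  simp only at hXY
  have hX1 := ((hφ X hX).2 1 (by simp)).1
  have hY1 := ((hφ Y hY).2 1 (by simp)).1
  rw [← hXY] at hY1
  -- Trajectories with the common end `φ X 1` stay within `2 * M` of it, hence within `3 * M` of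
  -- `X`, where backward uniqueness applies.
  have hback : ∀ Z ∈ A, φ X 1 ∈ closedBall Z M → ∀ t ∈ Icc (0 : ℝ) 1,
      φ Z t ∈ closedBall (φ X 1) (2 * M) := by
    intro Z hZ hZ1 t ht
    have h1 := ((hφ Z hZ).2 t ht).1
    rw [mem_closedBall] at *
    rw [dist_comm] at hZ1
    linarith [dist_triangle (φ Z t) Z (φ X 1)]
  have hs : closedBall (φ X 1) (2 * M) ⊆ B := by
    refine (closedBall_subset_closedBall' ?_).trans (hball X hX (4 * M) le_rfl)
    rw [mem_closedBall] at hX1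
    linarith
  have h := trajectory_unique (hlip (convex_closedBall _ _) hs) (γ₁ := φ X) (γ₂ := φ Y)
    (fun t ht => ⟨hback X hX hX1 t ht, ((hφ X hX).2 t ht).2⟩)
    (fun t ht => ⟨hback Y hY hY1 t ht, ((hφ Y hY).2 t ht).2⟩) (Or.inr hXY)
  have h0 := h (left_mem_Icc.2 zero_le_one)
  rwa [(hφ X hX).1, (hφ Y hY).1] at h0

end Flow

/-! ### Weighted averages along a direction -/

section WeightedAverage

open Metric Topology MeasureTheory intervalIntegral

variable {E : Type} [NormedAddCommGroup E] [NormedSpace ℝ E]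
  {F : Type} [NormedAddCommGroup F] [NormedSpace ℝ F]

/-- The integral of `φ s • h (X + s • e)` over `0 ≤ s ≤ T`. -/
def weightedAverage (T : ℝ) (φ : ℝ → ℝ) (e : E) (h : E → F) (X : E) : F :=
  ∫ s in (0 : ℝ)..T, φ s • h (X + s • e)

variable {U : Set E} {e : E} {φ : ℝ → ℝ} {T : ℝ}

lemma continuous_weighted_line (hUe : ∀ X ∈ U, ∀ s : ℝ, X + s • e ∈ U) (hφ : Continuous φ)
    {h : E → F} (hh : ContinuousOn h U) {X : E} (hX : X ∈ U) :
    Continuous fun s : ℝ => φ s • h (X + s • e) := by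
  refine hφ.smul ?_
  exact hh.comp_continuous (by fun_prop) (hUe X hX)

/-- Differentiation under the integral. The segments in the direction `e` that start in a compact
ball sweep a compact subset of `U`, on which the derivative is bounded. -/
lemma hasFDerivAt_weightedAverage [FiniteDimensional ℝ E] (hU : IsOpen U)
    (hUe : ∀ X ∈ U, ∀ s : ℝ, X + s • e ∈ U) (hφ : Continuous φ)
    {h : E → F} (hh : ContDiffOn ℝ ∞ h U) {X : E} (hX : X ∈ U) :
    HasFDerivAt (weightedAverage T φ e h) (weightedAverage T φ e (fderiv ℝ h) X) X := by
  have : ProperSpace E := FiniteDimensional.proper ℝ E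
  have hd : ContinuousOn (fderiv ℝ h) U := hh.continuousOn_fderiv_of_isOpen hU (by simp)
  obtain ⟨r, hr, hrU⟩ := nhds_basis_closedBall.mem_iff.1 (hU.mem_nhds hX)
  have hcompact : IsCompact ((fun p : E × ℝ => p.1 + p.2 • e) '' (closedBall X r ×ˢ uIcc 0 T)) :=
    ((isCompact_closedBall X r).prod isCompact_uIcc).image (by fun_prop)
  have hsub : ((fun p : E × ℝ => p.1 + p.2 • e) '' (closedBall X r ×ˢ uIcc 0 T)) ⊆ U := by
    rintro _ ⟨p, hp, rfl⟩
    exact hUe _ (hrU hp.1) _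
  obtain ⟨C, hC⟩ := hcompact.exists_bound_of_continuousOn (hd.mono hsub)
  refine intervalIntegral.hasFDerivAt_integral_of_dominated_of_fderiv_le (μ := volume)
    (F := fun X s => φ s • h (X + s • e)) (F' := fun X s => φ s • fderiv ℝ h (X + s • e))
    (s := closedBall X r) (bound := fun s => |φ s| * C) (closedBall_mem_nhds X hr) ?_ ?_ ?_ ?_ ?_ ?_
  · filter_upwards [hU.mem_nhds hX] with Y hY
    exact (continuous_weighted_line hUe hφ hh.continuousOn hY).aestronglyMeasurable
  · exact (continuous_weighted_line hUe hφ hh.continuousOn hX).intervalIntegrable _ _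
  · exact (continuous_weighted_line hUe hφ hd hX).aestronglyMeasurable
  · refine Filter.Eventually.of_forall fun s hs Y hY => ?_
    rw [norm_smul, Real.norm_eq_abs]
    exact mul_le_mul_of_nonneg_left (hC _ ⟨(Y, s), ⟨hY, uIoc_subset_uIcc hs⟩, rfl⟩)
      (abs_nonneg _)
  · exact (hφ.abs.mul continuous_const).intervalIntegrable _ _
  · refine Filter.Eventually.of_forall fun s _ Y hY => ?_
    have h1 : HasFDerivAt h (fderiv ℝ h (Y + s • e)) (Y + s • e) :=
      ((hh.contDiffAt (hU.mem_nhds (hUe Y (hrU hY) s))).differentiableAt (by simp)).hasFDerivAt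
    exact ((hasFDerivAt_comp_add_right (s • e)).2 h1).const_smul (φ s)

lemma fderiv_weightedAverage [FiniteDimensional ℝ E] (hU : IsOpen U)
    (hUe : ∀ X ∈ U, ∀ s : ℝ, X + s • e ∈ U) (hφ : Continuous φ)
    {h : E → F} (hh : ContDiffOn ℝ ∞ h U) {X : E} (hX : X ∈ U) :
    fderiv ℝ (weightedAverage T φ e h) X = weightedAverage T φ e (fderiv ℝ h) X :=
  (hasFDerivAt_weightedAverage hU hUe hφ hh hX).fderiv

lemma contDiffOn_weightedAverage_nat [FiniteDimensional ℝ E] (hU : IsOpen U)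
    (hUe : ∀ X ∈ U, ∀ s : ℝ, X + s • e ∈ U) (hφ : Continuous φ) (n : ℕ) :
    ∀ {F : Type} [NormedAddCommGroup F] [NormedSpace ℝ F] {h : E → F}, ContDiffOn ℝ ∞ h U →
      ContDiffOn ℝ n (weightedAverage T φ e h) U := by
  induction n with
  | zero =>
    intro F _ _ h hh
    refine contDiffOn_zero.2 fun X hX => ?_
    exact (hasFDerivAt_weightedAverage hU hUe hφ hh hX).continuousAt.continuousWithinAt
  | succ n ih =>
    intro F _ _ h hh
    push_cast
    rw [contDiffOn_succ_iff_fderiv_of_isOpen hU]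
    refine ⟨fun X hX => (hasFDerivAt_weightedAverage hU hUe hφ hh
      hX).differentiableAt.differentiableWithinAt, by simp, ?_⟩
    refine (ih (hh.fderiv_of_isOpen hU (m := ∞) (by simp))).congr fun X hX => ?_
    exact fderiv_weightedAverage hU hUe hφ hh hX

lemma contDiffOn_weightedAverage [FiniteDimensional ℝ E] (hU : IsOpen U)
    (hUe : ∀ X ∈ U, ∀ s : ℝ, X + s • e ∈ U) (hφ : Continuous φ)
    {h : E → F} (hh : ContDiffOn ℝ ∞ h U) : ContDiffOn ℝ ∞ (weightedAverage T φ e h) U :=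
  contDiffOn_infty.2 fun n => contDiffOn_weightedAverage_nat hU hUe hφ n hh

lemma norm_weightedAverage_le (hUe : ∀ X ∈ U, ∀ s : ℝ, X + s • e ∈ U) (hT : 0 ≤ T) {c : ℝ}
    (hc : 0 ≤ c) (hφc : ∀ s ∈ Icc 0 T, |φ s| ≤ c) {h : E → F} {M : ℝ} (hM : ∀ X ∈ U, ‖h X‖ ≤ M)
    {X : E} (hX : X ∈ U) : ‖weightedAverage T φ e h X‖ ≤ T * c * M := by
  have := intervalIntegral.norm_integral_le_of_norm_le_const (a := 0) (b := T)
    (f := fun s => φ s • h (X + s • e)) (C := c * M) (fun s hs => by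
      rw [uIoc_of_le hT] at hs
      rw [norm_smul, Real.norm_eq_abs]
      exact mul_le_mul (hφc s ⟨hs.1.le, hs.2⟩) (hM _ (hUe X hX s)) (norm_nonneg _) hc)
  rw [sub_zero, abs_of_nonneg hT] at this
  unfold weightedAverage
  linarith

/-- Averaging commutes with `fderiv`, so every order inherits the factor `T * c` of the sup norm; no
power of the scale is lost. -/
lemma norm_iteratedFDeriv_weightedAverage_le [FiniteDimensional ℝ E] (hU : IsOpen U)
    (hUe : ∀ X ∈ U, ∀ s : ℝ, X + s • e ∈ U) (hφ : Continuous φ) (hT : 0 ≤ T) {c : ℝ}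
    (hc : 0 ≤ c) (hφc : ∀ s ∈ Icc 0 T, |φ s| ≤ c) {M : ℝ} (n : ℕ) :
    ∀ {F : Type} [NormedAddCommGroup F] [NormedSpace ℝ F] {h : E → F}, ContDiffOn ℝ ∞ h U →
      (∀ X ∈ U, ‖iteratedFDeriv ℝ n h X‖ ≤ M) → ∀ X ∈ U,
      ‖iteratedFDeriv ℝ n (weightedAverage T φ e h) X‖ ≤ T * c * M := by
  induction n with
  | zero =>
    intro F _ _ h hh hM X hX
    simp only [norm_iteratedFDeriv_zero] at hM ⊢
    exact norm_weightedAverage_le hUe hT hc hφc hM hX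
  | succ n ih =>
    intro F _ _ h hh hM X hX
    simp only [← norm_iteratedFDeriv_fderiv] at hM ⊢
    have h1 : fderiv ℝ (weightedAverage T φ e h) =ᶠ[𝓝 X] weightedAverage T φ e (fderiv ℝ h) := by
      filter_upwards [hU.mem_nhds hX] with Y hY
      exact fderiv_weightedAverage hU hUe hφ hh hY
    rw [(h1.iteratedFDeriv (𝕜 := ℝ) n).eq_of_nhds]
    exact ih (hh.fderiv_of_isOpen hU (m := ∞) (by simp)) hM X hX

/-- Integration by parts in the direction of the average. -/
lemma fderiv_weightedAverage_apply_self [FiniteDimensional ℝ E] (hU : IsOpen U)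
    (hUe : ∀ X ∈ U, ∀ s : ℝ, X + s • e ∈ U) {φ' : ℝ → ℝ} (hφ : ∀ s, HasDerivAt φ (φ' s) s)
    (hφ' : Continuous φ') {h : E → ℝ} (hh : ContDiffOn ℝ ∞ h U) {X : E} (hX : X ∈ U) :
    fderiv ℝ (weightedAverage T φ e h) X e =
      φ T * h (X + T • e) - φ 0 * h X - weightedAverage T φ' e h X := by
  have hφc : Continuous φ := continuous_iff_continuousAt.2 fun s => (hφ s).continuousAt
  have hd : ContinuousOn (fderiv ℝ h) U := hh.continuousOn_fderiv_of_isOpen hU (by simp)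
  have hderiv : ∀ s, HasDerivAt (fun s : ℝ => h (X + s • e)) (fderiv ℝ h (X + s • e) e) s := by
    intro s
    have h1 : HasFDerivAt h (fderiv ℝ h (X + s • e)) (X + s • e) :=
      ((hh.contDiffAt (hU.mem_nhds (hUe X hX s))).differentiableAt (by simp)).hasFDerivAt
    have h2 : HasDerivAt (fun s : ℝ => X + s • e) e s := by
      simpa using ((hasDerivAt_id s).smul_const e).const_add X
    exact h1.comp_hasDerivAt s h2
  have hint := continuous_weighted_line hUe hφc hd hX
  rw [fderiv_weightedAverage hU hUe hφc hh hX]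
  unfold weightedAverage
  rw [ContinuousLinearMap.intervalIntegral_apply (hint.intervalIntegrable _ _)]
  have hc2 : Continuous fun s : ℝ => fderiv ℝ h (X + s • e) e :=
    (hd.comp_continuous (by fun_prop) (hUe X hX)).clm_apply continuous_const
  have := intervalIntegral.integral_mul_deriv_eq_deriv_mul (a := 0) (b := T)
    (fun s _ => hφ s) (fun s _ => hderiv s) (hφ'.intervalIntegrable _ _)
    (hc2.intervalIntegrable _ _)
  simpa using this

end WeightedAverage

/-! ### Functions with scaled bounds on their derivatives -/

section ScaledBound

open Topology

variable {E : Type} [NormedAddCommGroup E] [NormedSpace ℝ E]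
  {F : Type} [NormedAddCommGroup F] [NormedSpace ℝ F]

/-- `f` is smooth on `U` and its derivatives of order `k ≤ n` are bounded by `a / δ ^ k`. -/
def ScaledBound (U : Set E) (n : ℕ) (a δ : ℝ) (f : E → F) : Prop :=
  ContDiffOn ℝ ∞ f U ∧ ∀ k ≤ n, ∀ X ∈ U, ‖iteratedFDeriv ℝ k f X‖ ≤ a / δ ^ k

variable {U : Set E} {n : ℕ} {a b δ : ℝ} {f g : E → F}

lemma ScaledBound.mono (hf : ScaledBound U n a δ f) {V : Set E} (hVU : V ⊆ U) {m : ℕ} (hm : m ≤ n)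
    {a' : ℝ} (ha : a ≤ a') (hδ : 0 ≤ δ) : ScaledBound V m a' δ f :=
  ⟨hf.1.mono hVU, fun k hk X hX => (hf.2 k (hk.trans hm) X (hVU hX)).trans (by gcongr)⟩

lemma ScaledBound.contDiffAt (hf : ScaledBound U n a δ f) (hU : IsOpen U) {X : E} (hX : X ∈ U) :
    ContDiffAt ℝ ∞ f X := hf.1.contDiffAt (hU.mem_nhds hX)

lemma ScaledBound.norm_le (hf : ScaledBound U n a δ f) {X : E} (hX : X ∈ U) : ‖f X‖ ≤ a := by
  simpa using hf.2 0 (Nat.zero_le _) X hX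

lemma ScaledBound.norm_fderiv_le (hf : ScaledBound U n a δ f) (hn : 1 ≤ n) {X : E} (hX : X ∈ U) :
    ‖fderiv ℝ f X‖ ≤ a / δ := by
  simpa [norm_iteratedFDeriv_one] using hf.2 1 hn X hX

lemma ScaledBound.norm_fderiv_fderiv_le (hf : ScaledBound U n a δ f) (hn : 2 ≤ n) {X : E}
    (hX : X ∈ U) : ‖fderiv ℝ (fderiv ℝ f) X‖ ≤ a / δ ^ 2 := by
  have := hf.2 2 hn X hX
  rwa [← norm_iteratedFDeriv_fderiv, norm_iteratedFDeriv_one] at this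

lemma ScaledBound.congr (hf : ScaledBound U n a δ f) (hU : IsOpen U) (h : EqOn g f U) :
    ScaledBound U n a δ g := by
  refine ⟨hf.1.congr h, fun k hk X hX => ?_⟩
  have : g =ᶠ[𝓝 X] f := Filter.eventuallyEq_of_mem (hU.mem_nhds hX) h
  rw [(this.iteratedFDeriv (𝕜 := ℝ) k).eq_of_nhds]
  exact hf.2 k hk X hX

lemma ScaledBound.add (hf : ScaledBound U n a δ f) (hg : ScaledBound U n b δ g) (hU : IsOpen U) :
    ScaledBound U n (a + b) δ (fun X => f X + g X) := by
  refine ⟨hf.1.add hg.1, fun k hk X hX => ?_⟩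
  have h1 := iteratedFDeriv_add_apply (i := k)
    ((hf.contDiffAt hU hX).of_le (by exact_mod_cast le_top))
    ((hg.contDiffAt hU hX).of_le (by exact_mod_cast le_top))
  have h2 : (fun X => f X + g X) = f + g := rfl
  rw [h2, h1, add_div]
  exact (norm_add_le _ _).trans (add_le_add (hf.2 k hk X hX) (hg.2 k hk X hX))

lemma ScaledBound.neg (hf : ScaledBound U n a δ f) : ScaledBound U n a δ (fun X => -f X) := by
  refine ⟨hf.1.neg, fun k hk X hX => ?_⟩
  have h2 : (fun X => -f X) = -f := rfl
  rw [h2, iteratedFDeriv_neg_apply, norm_neg]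
  exact hf.2 k hk X hX

lemma ScaledBound.sub (hf : ScaledBound U n a δ f) (hg : ScaledBound U n b δ g) (hU : IsOpen U) :
    ScaledBound U n (a + b) δ (fun X => f X - g X) := by
  simpa [sub_eq_add_neg] using hf.add hg.neg hU

lemma ScaledBound.const_mul {f : E → ℝ} (hf : ScaledBound U n a δ f) (hU : IsOpen U) (c : ℝ) :
    ScaledBound U n (|c| * a) δ (fun X => c * f X) := by
  refine ⟨contDiffOn_const.mul hf.1, fun k hk X hX => ?_⟩
  have h2 : (fun X => c * f X) = c • f := rfl
  rw [h2, iteratedFDeriv_const_smul_apply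
    ((hf.contDiffAt hU hX).of_le (by exact_mod_cast le_top)), norm_smul, Real.norm_eq_abs,
    mul_div_assoc]
  exact mul_le_mul_of_nonneg_left (hf.2 k hk X hX) (abs_nonneg _)

/-- In Leibniz' formula of order `k` all terms carry the same power of `δ`, and the binomial
coefficients add up to `2 ^ k`. -/
lemma ScaledBound.mul {f g : E → ℝ} (hf : ScaledBound U n a δ f) (hg : ScaledBound U n b δ g)
    (hU : IsOpen U) (hδ : 0 < δ) : ScaledBound U n (2 ^ n * (a * b)) δ (fun X => f X * g X) := by
  refine ⟨hf.1.mul hg.1, fun k hk X hX => ?_⟩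
  have h1 := norm_iteratedFDerivWithin_mul_le hf.1 hg.1 hU.uniqueDiffOn hX (n := k)
    (by exact_mod_cast le_top)
  rw [iteratedFDerivWithin_of_isOpen k hU hX] at h1
  refine h1.trans ?_
  have ha : 0 ≤ a := (norm_nonneg _).trans (hf.norm_le hX)
  have hb : 0 ≤ b := (norm_nonneg _).trans (hg.norm_le hX)
  calc ∑ i ∈ Finset.range (k + 1), (k.choose i : ℝ) * ‖iteratedFDerivWithin ℝ i f U X‖ *
        ‖iteratedFDerivWithin ℝ (k - i) g U X‖
      ≤ ∑ i ∈ Finset.range (k + 1), (k.choose i : ℝ) * (a * b / δ ^ k) := by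
        refine Finset.sum_le_sum fun i hi => ?_
        have hi' : i ≤ k := Nat.lt_succ_iff.1 (Finset.mem_range.1 hi)
        rw [iteratedFDerivWithin_of_isOpen i hU hX, iteratedFDerivWithin_of_isOpen (k - i) hU hX,
          mul_assoc]
        refine mul_le_mul_of_nonneg_left ?_ (by positivity)
        calc _ ≤ a / δ ^ i * (b / δ ^ (k - i)) :=
              mul_le_mul (hf.2 i (hi'.trans hk) X hX) (hg.2 (k - i) ((Nat.sub_le _ _).trans hk) X hX)
                (norm_nonneg _) (by positivity)
          _ = a * b / δ ^ k := by
            rw [div_mul_div_comm, ← pow_add, Nat.add_sub_cancel' hi']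
    _ = 2 ^ k * (a * b) / δ ^ k := by
        rw [← Finset.sum_mul, ← Nat.cast_sum, Nat.sum_range_choose]
        push_cast
        ring
    _ ≤ 2 ^ n * (a * b) / δ ^ k := by
        gcongr
        norm_num

lemma ScaledBound.fderiv_apply (hf : ScaledBound U (n + 1) a δ f) (hU : IsOpen U) (v : E) :
    ScaledBound U n (‖v‖ * (a / δ)) δ (fun X => fderiv ℝ f X v) := by
  have hd : ContDiffOn ℝ ∞ (fderiv ℝ f) U := hf.1.fderiv_of_isOpen hU (by simp)
  refine ⟨hd.clm_apply contDiffOn_const, fun k hk X hX => ?_⟩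
  refine (norm_iteratedFDeriv_clm_apply_const (hd.contDiffAt (hU.mem_nhds hX))
    (by exact_mod_cast le_top)).trans ?_
  rw [norm_iteratedFDeriv_fderiv, mul_div_assoc, div_div, ← pow_succ']
  exact mul_le_mul_of_nonneg_left (hf.2 (k + 1) (by omega) X hX) (norm_nonneg _)

lemma ScaledBound.weightedAverage [FiniteDimensional ℝ E] (hf : ScaledBound U n a δ f)
    (hU : IsOpen U) {e : E} {φ : ℝ → ℝ} {T c : ℝ}
    (hUe : ∀ X ∈ U, ∀ s : ℝ, X + s • e ∈ U) (hφ : Continuous φ) (hT : 0 ≤ T)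
    (hc : 0 ≤ c) (hφc : ∀ s ∈ Icc 0 T, |φ s| ≤ c) :
    ScaledBound U n (T * c * a) δ (weightedAverage T φ e f) := by
  refine ⟨contDiffOn_weightedAverage hU hUe hφ hf.1, fun k hk X hX => ?_⟩
  rw [mul_div_assoc]
  exact norm_iteratedFDeriv_weightedAverage_le hU hUe hφ hT hc hφc k hf.1 (hf.2 k hk) X hX

end ScaledBound

/-! ### The Newtonian potential -/

section InverseNorm

variable {E : Type} [NormedAddCommGroup E] [InnerProductSpace ℝ E]

lemma contDiffAt_inv_norm {v : E} (hv : v ≠ 0) : ContDiffAt ℝ ∞ (fun w : E => ‖w‖⁻¹) v :=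
  (contDiffAt_norm ℝ hv).inv (norm_ne_zero_iff.2 hv)

/-- The derivatives of order `k` of a function homogeneous of degree `-1` are homogeneous of degree
`-(k + 1)`. -/
lemma norm_iteratedFDeriv_inv_norm_scale {v : E} (hv : v ≠ 0) {t : ℝ} (ht : 0 < t) (k : ℕ) :
    ‖iteratedFDeriv ℝ k (fun w : E => ‖w‖⁻¹) v‖ ≤
      t ^ (k + 1) * ‖iteratedFDeriv ℝ k (fun w : E => ‖w‖⁻¹) (t • v)‖ := by
  let g : E ≃L[ℝ] E := ContinuousLinearEquiv.smulLeft (Units.mk0 t ht.ne')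
  have hg : ∀ w, g w = t • w := fun w => rfl
  have h1 : (fun w : E => ‖w‖⁻¹) = t • ((fun w : E => ‖w‖⁻¹) ∘ g) := by
    ext w
    simp only [Pi.smul_apply, Function.comp_apply, hg, norm_smul, Real.norm_eq_abs, abs_of_pos ht,
      smul_eq_mul]
    field_simp
  have h2 := g.iteratedFDerivWithin_comp_right (fun w : E => ‖w‖⁻¹) uniqueDiffOn_univ
    (mem_univ (g v)) k
  rw [preimage_univ, iteratedFDerivWithin_univ, iteratedFDerivWithin_univ] at h2
  have hgv : g v ≠ 0 := by rw [hg]; exact smul_ne_zero ht.ne' hv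
  have hc : ContDiffAt ℝ k ((fun w : E => ‖w‖⁻¹) ∘ g) v :=
    ((contDiffAt_inv_norm hgv).comp v g.contDiff.contDiffAt).of_le (by exact_mod_cast le_top)
  have h3 : iteratedFDeriv ℝ k (fun w : E => ‖w‖⁻¹) v =
      t • iteratedFDeriv ℝ k ((fun w : E => ‖w‖⁻¹) ∘ g) v := by
    conv_lhs => rw [h1]
    exact iteratedFDeriv_const_smul_apply hc
  rw [h3, h2, norm_smul, Real.norm_eq_abs, abs_of_pos ht, pow_succ', mul_assoc]
  refine mul_le_mul_of_nonneg_left ?_ ht.le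
  refine (ContinuousMultilinearMap.norm_compContinuousLinearMap_le _ _).trans ?_
  rw [hg, mul_comm]
  refine mul_le_mul_of_nonneg_right ?_ (norm_nonneg _)
  rw [Finset.prod_const, Finset.card_univ, Fintype.card_fin]
  refine pow_le_pow_left₀ (norm_nonneg _) ?_ _
  refine ContinuousLinearMap.opNorm_le_bound _ ht.le fun w => ?_
  change ‖t • w‖ ≤ _
  rw [norm_smul, Real.norm_eq_abs, abs_of_pos ht]

/-- Homogeneity reduces the bound to the unit sphere, which is compact. -/
lemma exists_norm_iteratedFDeriv_inv_norm_le [FiniteDimensional ℝ E] (n : ℕ) :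
    ∃ c : ℝ, 0 ≤ c ∧ ∀ k ≤ n, ∀ v : E, v ≠ 0 →
      ‖iteratedFDeriv ℝ k (fun w : E => ‖w‖⁻¹) v‖ ≤ c / ‖v‖ ^ (k + 1) := by
  have : ProperSpace E := FiniteDimensional.proper ℝ E
  have hs : ∀ k : ℕ, ∃ c : ℝ, ∀ v ∈ Metric.sphere (0 : E) 1,
      ‖iteratedFDeriv ℝ k (fun w : E => ‖w‖⁻¹) v‖ ≤ c := fun k => by
    refine (isCompact_sphere 0 1).exists_bound_of_continuousOn fun v hv => ?_
    have hv0 : v ≠ 0 := by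
      rintro rfl
      simp at hv
    exact ((contDiffAt_inv_norm hv0).continuousAt_iteratedFDeriv
      (by exact_mod_cast le_top)).continuousWithinAt
  choose c hc using hs
  refine ⟨∑ k ∈ Finset.range (n + 1), |c k|, by positivity, fun k hk v hv => ?_⟩
  have hv' : 0 < ‖v‖ := norm_pos_iff.2 hv
  refine (norm_iteratedFDeriv_inv_norm_scale hv (inv_pos.2 hv') k).trans ?_
  rw [inv_pow, div_eq_inv_mul]
  refine mul_le_mul_of_nonneg_left ?_ (by positivity)
  refine (hc k _ ?_).trans ((le_abs_self _).trans ?_)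
  · simp [norm_smul, hv'.ne']
  · exact Finset.single_le_sum (f := fun k => |c k|) (fun i _ => abs_nonneg _)
      (Finset.mem_range.2 (by omega))

/-- The inverse distance of a map which stays away from the origin. -/
lemma exists_scaledBound_inv_norm {P : Type} [NormedAddCommGroup P] [NormedSpace ℝ P]
    [FiniteDimensional ℝ E] (n : ℕ) (D : ℝ) (hD : 1 ≤ D) :
    ∃ c : ℝ, 0 ≤ c ∧ ∀ (U : Set P) (f : P → E) (δ : ℝ), IsOpen U → 0 < δ → δ ≤ 1 →
      ScaledBound U n D 1 f → (∀ X ∈ U, δ ≤ ‖f X‖) →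
      ScaledBound U n (c / δ) δ (fun X => ‖f X‖⁻¹) := by
  obtain ⟨c, hc, hcb⟩ := exists_norm_iteratedFDeriv_inv_norm_le (E := E) n
  refine ⟨n.factorial * c * D ^ n, by positivity, fun U f δ hU hδ hδ1 hf hfδ => ?_⟩
  have hf0 : ∀ X ∈ U, f X ≠ 0 := fun X hX => norm_pos_iff.1 (hδ.trans_le (hfδ X hX))
  have hopen : IsOpen {v : E | v ≠ 0} := isOpen_ne
  have hg : ContDiffOn ℝ ∞ (fun w : E => ‖w‖⁻¹) {v : E | v ≠ 0} := fun v hv =>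
    (contDiffAt_inv_norm hv).contDiffWithinAt
  refine ⟨hg.comp hf.1 hf0, fun k hk X hX => ?_⟩
  -- Faà di Bruno's formula with a single bound for all outer derivatives of order `i ≤ k`: as `δ ≤
  -- 1`, the worst power is `δ ^ (k + 1)`.
  have h := norm_iteratedFDerivWithin_comp_le hg hf.1 (n := k) (by exact_mod_cast le_top)
    hopen.uniqueDiffOn hU.uniqueDiffOn hf0 hX (C := c / δ ^ (k + 1)) (D := D)
    (fun i hi => by
      rw [iteratedFDerivWithin_of_isOpen i hopen (hf0 X hX)]
      refine (hcb i (hi.trans hk) _ (hf0 X hX)).trans ?_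
      refine div_le_div_of_nonneg_left hc (by positivity) ?_
      calc δ ^ (k + 1) ≤ δ ^ (i + 1) := pow_le_pow_of_le_one hδ.le hδ1 (by omega)
        _ ≤ ‖f X‖ ^ (i + 1) := pow_le_pow_left₀ hδ.le (hfδ X hX) _)
    (fun i hi1 hi => by
      rw [iteratedFDerivWithin_of_isOpen i hU hX]
      refine (hf.2 i (hi.trans hk) X hX).trans ?_
      rw [one_pow, div_one]
      exact le_self_pow₀ hD (by omega))
  rw [iteratedFDerivWithin_of_isOpen k hU hX] at h
  refine h.trans ?_
  have hfac : (k.factorial : ℝ) ≤ n.factorial := by exact_mod_cast Nat.factorial_le hk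
  calc (k.factorial : ℝ) * (c / δ ^ (k + 1)) * D ^ k
      ≤ n.factorial * (c / δ ^ (k + 1)) * D ^ n := by gcongr
    _ = n.factorial * c * D ^ n / δ / δ ^ k := by
      rw [pow_succ']
      field_simp

end InverseNorm

/-! ### Kepler's equation -/

section Kepler

open Topology

/-- The left-hand side of Kepler's equation for the eccentric longitude `F`, with eccentricity
vector `z`. -/
def keplerEq (z : ℂ) (F : ℝ) : ℝ := F - z.re * Real.sin F + z.im * Real.cos F

/-- The eccentric longitude, as a function of the eccentricity vector and of the mean longitude. -/
def eccLong (z : ℂ) (l : ℝ) : ℝ := Function.invFun (keplerEq z) l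

lemma hasDerivAt_keplerEq (z : ℂ) (F : ℝ) :
    HasDerivAt (keplerEq z) (1 - z.re * Real.cos F - z.im * Real.sin F) F := by
  have := ((hasDerivAt_id F).sub ((Real.hasDerivAt_sin F).const_mul z.re)).add
    ((Real.hasDerivAt_cos F).const_mul z.im)
  convert! this using 1
  ring

lemma re_mul_cos_add_im_mul_sin_le (z : ℂ) (F : ℝ) : z.re * Real.cos F + z.im * Real.sin F ≤ ‖z‖ := by
  refine Real.le_sqrt_of_sq_le ?_ |>.trans_eq (Complex.norm_eq_sqrt_sq_add_sq z).symm
  nlinarith [sq_nonneg (z.re * Real.sin F - z.im * Real.cos F), Real.sin_sq_add_cos_sq F]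

lemma keplerEq_deriv_pos {z : ℂ} (hz : ‖z‖ < 1) (F : ℝ) :
    0 < 1 - z.re * Real.cos F - z.im * Real.sin F := by
  linarith [re_mul_cos_add_im_mul_sin_le z F]

lemma strictMono_keplerEq {z : ℂ} (hz : ‖z‖ < 1) : StrictMono (keplerEq z) :=
  strictMono_of_deriv_pos fun F => by
    rw [(hasDerivAt_keplerEq z F).deriv]
    exact keplerEq_deriv_pos hz F

lemma surjective_keplerEq (z : ℂ) : Function.Surjective (keplerEq z) := by
  have hc : Continuous (keplerEq z) := by unfold keplerEq; fun_prop
  have h1 : ∀ F, |z.re * Real.sin F| ≤ |z.re| := fun F => by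
    rw [abs_mul]
    exact mul_le_of_le_one_right (abs_nonneg _) (Real.abs_sin_le_one F)
  have h2 : ∀ F, |z.im * Real.cos F| ≤ |z.im| := fun F => by
    rw [abs_mul]
    exact mul_le_of_le_one_right (abs_nonneg _) (Real.abs_cos_le_one F)
  refine hc.surjective ?_ ?_
  · refine Filter.tendsto_atTop_mono (f := fun F => F + (-|z.re| - |z.im|)) (fun F => ?_)
      (Filter.tendsto_atTop_add_const_right _ _ Filter.tendsto_id)
    unfold keplerEq
    linarith [abs_le.1 (h1 F), abs_le.1 (h2 F), (abs_le.1 (h1 F)).2, (abs_le.1 (h2 F)).1]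
  · refine Filter.tendsto_atBot_mono (f := fun F => F + (|z.re| + |z.im|)) (fun F => ?_)
      (Filter.tendsto_atBot_add_const_right _ _ Filter.tendsto_id)
    unfold keplerEq
    linarith [(abs_le.1 (h1 F)).1, (abs_le.1 (h2 F)).2]

lemma keplerEq_eccLong (z : ℂ) (l : ℝ) : keplerEq z (eccLong z l) = l :=
  Function.invFun_eq (surjective_keplerEq z l)

lemma eccLong_unique {z : ℂ} (hz : ‖z‖ < 1) {F l : ℝ} (h : keplerEq z F = l) : eccLong z l = F :=
  (strictMono_keplerEq hz).injective ((keplerEq_eccLong z l).trans h.symm)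

lemma eccLong_add_two_pi {z : ℂ} (hz : ‖z‖ < 1) (l : ℝ) :
    eccLong z (l + 2 * Real.pi) = eccLong z l + 2 * Real.pi := by
  refine eccLong_unique hz ?_
  conv_rhs => rw [← keplerEq_eccLong z l]
  unfold keplerEq
  rw [Real.sin_add_two_pi, Real.cos_add_two_pi]
  ring

lemma eccentricAnomaly_eq_eccLong (e M : ℝ) : eccentricAnomaly e M = eccLong (e : ℂ) M := by
  unfold eccentricAnomaly eccLong
  congr 1
  ext F
  simp [keplerEq]

/-- Kepler's equation for the eccentric longitude, from that for the eccentric anomaly. -/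
lemma eccLong_eq_eccentricAnomaly_add {e ϖ : ℝ} (he0 : 0 ≤ e) (he1 : e < 1) (l : ℝ) :
    eccLong ((e : ℂ) * Complex.exp (ϖ * Complex.I)) l = eccentricAnomaly e (l - ϖ) + ϖ := by
  have hz : ‖(e : ℂ) * Complex.exp (ϖ * Complex.I)‖ < 1 := by
    rw [norm_mul, Complex.norm_exp_ofReal_mul_I, mul_one, Complex.norm_real, Real.norm_eq_abs,
      abs_of_nonneg he0]
    exact he1
  refine eccLong_unique hz ?_
  have h := keplerEq_eccLong (e : ℂ) (l - ϖ)
  rw [← eccentricAnomaly_eq_eccLong] at h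
  set E := eccentricAnomaly e (l - ϖ)
  unfold keplerEq at h ⊢
  rw [Complex.re_ofReal_mul, Complex.im_ofReal_mul, Complex.exp_ofReal_mul_I_re,
    Complex.exp_ofReal_mul_I_im, Real.sin_add, Real.cos_add]
  simp only [Complex.ofReal_re, Complex.ofReal_im, zero_mul, add_zero] at h
  have := Real.sin_sq_add_cos_sq ϖ
  linear_combination h - e * Real.sin E * this

/-- Implicit function theorem: the derivative of Kepler's equation in the eccentric longitude is
positive for `‖z‖ < 1`. Global uniqueness of the root identifies `eccLong` with the implicit
function. -/
lemma contDiffAt_eccLong {z : ℂ} (hz : ‖z‖ < 1) (l : ℝ) :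
    ContDiffAt ℝ ∞ (fun w : ℂ × ℝ => eccLong w.1 w.2) (z, l) := by
  set f : (ℂ × ℝ) × ℝ → ℝ := fun w =>
    w.2 - w.1.1.re * Real.sin w.2 + w.1.1.im * Real.cos w.2 - w.1.2 with hf
  have hre : ContDiff ℝ ∞ (fun w : (ℂ × ℝ) × ℝ => w.1.1.re) :=
    Complex.reCLM.contDiff.comp (contDiff_fst.comp contDiff_fst)
  have him : ContDiff ℝ ∞ (fun w : (ℂ × ℝ) × ℝ => w.1.1.im) :=
    Complex.imCLM.contDiff.comp (contDiff_fst.comp contDiff_fst)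
  have hfs : ContDiff ℝ ∞ f :=
    ((contDiff_snd.sub (hre.mul (Real.contDiff_sin.comp contDiff_snd))).add
      (him.mul (Real.contDiff_cos.comp contDiff_snd))).sub (contDiff_snd.comp contDiff_fst)
  set u : (ℂ × ℝ) × ℝ := ((z, l), eccLong z l) with hu
  have hd : (fderiv ℝ f u ∘L .inr ℝ (ℂ × ℝ) ℝ).IsInvertible := by
    set c := 1 - z.re * Real.cos (eccLong z l) - z.im * Real.sin (eccLong z l) with hc
    have hc0 : c ≠ 0 := (keplerEq_deriv_pos hz _).ne'
    have h1 : HasDerivAt (fun F => f ((z, l), F)) c (eccLong z l) :=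
      (hasDerivAt_keplerEq z (eccLong z l)).sub_const l
    have h2 : HasDerivAt (fun F => f ((z, l), F)) ((fderiv ℝ f u) (0, 1)) (eccLong z l) := by
      have h3 : HasFDerivAt f (fderiv ℝ f u) u :=
        ((hfs.differentiable (by simp)) u).hasFDerivAt
      exact h3.comp_hasDerivAt (eccLong z l)
        ((hasDerivAt_const _ (z, l)).prodMk (hasDerivAt_id (eccLong z l)))
    refine ⟨ContinuousLinearEquiv.unitsEquivAut ℝ (Units.mk0 c hc0), ?_⟩
    ext
    simp only [ContinuousLinearEquiv.coe_coe, ContinuousLinearEquiv.unitsEquivAut_apply,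
      Units.val_mk0, one_mul, ContinuousLinearMap.comp_apply, ContinuousLinearMap.inr_apply]
    exact h1.unique h2
  have hn0 : (∞ : WithTop ℕ∞) ≠ 0 := by simp
  have hψ := hfs.contDiffAt (x := u) |>.contDiffAt_implicitFunction hn0 hd
  have hev := hfs.contDiffAt (x := u) |>.eventually_apply_implicitFunction hn0 hd
  refine hψ.congr_of_eventuallyEq ?_
  have hnear : ∀ᶠ w : ℂ × ℝ in 𝓝 u.1, ‖w.1‖ < 1 :=
    (continuous_fst.norm.continuousAt (x := (z, l))).eventually_lt_const hz
  filter_upwards [hev, hnear] with w hw hw1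
  refine eccLong_unique hw1 ?_
  have hfu : f u = 0 := by
    have : f u = keplerEq z (eccLong z l) - l := rfl
    rw [this, keplerEq_eccLong, sub_self]
  rw [hfu] at hw
  exact sub_eq_zero.1 hw

end Kepler

/-! ### Rotations in complex notation -/

/-- The vector with horizontal part `w` and height `c`. -/
def horizontalVec (w : ℂ) (c : ℝ) : Fin 3 → ℝ := ![w.re, w.im, c]

lemma rot3_mulVec_horizontalVec (α : ℝ) (w : ℂ) (c : ℝ) :
    (rot3 α).mulVec (horizontalVec w c) = horizontalVec (Complex.exp (α * Complex.I) * w) c := by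
  ext i
  fin_cases i
  · simp [rot3, horizontalVec, Matrix.mulVec, dotProduct, Fin.sum_univ_three,
      Complex.exp_ofReal_mul_I_re, Complex.exp_ofReal_mul_I_im]
    ring
  · simp [rot3, horizontalVec, Matrix.mulVec, dotProduct, Fin.sum_univ_three,
      Complex.exp_ofReal_mul_I_re, Complex.exp_ofReal_mul_I_im]
    ring
  · simp [rot3, horizontalVec, Matrix.mulVec, dotProduct, Fin.sum_univ_three]

lemma rot1_mulVec_horizontalVec (α : ℝ) (w : ℂ) :
    (rot1 α).mulVec (horizontalVec w 0) =
      horizontalVec (w - Complex.I * (((1 - Real.cos α) * w.im : ℝ) : ℂ)) (Real.sin α * w.im) := by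
  ext i
  fin_cases i
  · simp [rot1, horizontalVec, Matrix.mulVec, dotProduct, Fin.sum_univ_three]
  · simp [rot1, horizontalVec, Matrix.mulVec, dotProduct, Fin.sum_univ_three,
      -Complex.ofReal_cos]
    ring
  · simp [rot1, horizontalVec, Matrix.mulVec, dotProduct, Fin.sum_univ_three]

/-! ### Elliptic motion in Poincaré variables -/

/-- The eccentricity vector `e exp (i ϖ)`. -/
def eccVec (p q : ℕ) (X : Phase) : ℂ :=
  ((Real.sqrt (2 - ‖x X‖ ^ 2 / Lam p q X) / Real.sqrt (Lam p q X) : ℝ) : ℂ) * x X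

/-- The position in the orbital plane, rotated onto the reference plane about the node line. -/
def planarPosition (p q : ℕ) (X : Phase) : ℂ :=
  ((Lam p q X ^ 2 : ℝ) : ℂ) *
    (Complex.exp (eccLong (eccVec p q X) (lam p q X) * Complex.I) *
        ((1 - ‖x X‖ ^ 2 / Lam p q X / 2 : ℝ) : ℂ) +
      x X ^ 2 * ((1 / (2 * Lam p q X) : ℝ) : ℂ) *
        Complex.exp (-(eccLong (eccVec p q X) (lam p q X) * Complex.I)) - eccVec p q X)

/-- The product of the distance to the node line by `√(Λ √(1 - e²) (1 - cos I))`. -/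
def nodeMoment (p q : ℕ) (X : Phase) : ℝ := ((starRingEnd ℂ) (y X) * planarPosition p q X).im

/-- The position of the particle by a formula which is smooth in the Poincaré variables. -/
def smoothPosition (p q : ℕ) (X : Phase) : Space :=
  WithLp.toLp 2 (horizontalVec
    (planarPosition p q X - Complex.I * y X * ((nodeMoment p q X / angMom p q X : ℝ) : ℂ))
    (nodeMoment p q X * Real.sqrt ((2 - ‖y X‖ ^ 2 / angMom p q X) / angMom p q X)))

/-- The set of elliptic, non-rectilinear motions of inclination less than `π`. -/
def ellipticRegion (p q : ℕ) : Set Phase :=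
  {X | 0 < Lam p q X ∧ ‖x X‖ ^ 2 < Lam p q X ∧ ‖y X‖ ^ 2 < 2 * angMom p q X}

/-! ### Agreement of the smooth formulas with the orbital elements -/

section EllipticRegion

variable {p q : ℕ} {X : Phase}

lemma angMom_pos (hX : X ∈ ellipticRegion p q) : 0 < angMom p q X := sub_pos.2 hX.2.1

lemma actionRatio_nonneg (hX : X ∈ ellipticRegion p q) : 0 ≤ ‖x X‖ ^ 2 / Lam p q X :=
  div_nonneg (sq_nonneg _) hX.1.le

lemma actionRatio_lt_one (hX : X ∈ ellipticRegion p q) : ‖x X‖ ^ 2 / Lam p q X < 1 :=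
  (div_lt_one hX.1).2 hX.2.1

lemma ecc_nonneg (X : Phase) : 0 ≤ ecc p q X := Real.sqrt_nonneg _

lemma one_sub_ecc_sq (hX : X ∈ ellipticRegion p q) :
    1 - ecc p q X ^ 2 = (1 - ‖x X‖ ^ 2 / Lam p q X) ^ 2 := by
  unfold ecc
  rw [Real.sq_sqrt]
  · ring
  · nlinarith [actionRatio_nonneg hX, actionRatio_lt_one hX]

lemma ecc_lt_one (hX : X ∈ ellipticRegion p q) : ecc p q X < 1 := by
  have h1 := one_sub_ecc_sq hX
  have h2 := actionRatio_lt_one hX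
  have : 0 < (1 - ‖x X‖ ^ 2 / Lam p q X) ^ 2 := by
    have : 0 < 1 - ‖x X‖ ^ 2 / Lam p q X := by linarith
    positivity
  nlinarith [ecc_nonneg (p := p) (q := q) X]

/-- With `s = ‖x‖² / Λ`, `e² = s (2 - s)`. The factor `‖x‖` extracted from the root combines with
the unit vector of argument `ϖ` into `x`, so the eccentricity vector is smooth at circular orbits
although `ϖ` is not. -/
lemma eccVec_eq (hX : X ∈ ellipticRegion p q) :
    eccVec p q X = (ecc p q X : ℂ) * Complex.exp (Complex.arg (x X) * Complex.I) := by
  have h1 := actionRatio_nonneg hX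
  have h2 := actionRatio_lt_one hX
  have h3 : ecc p q X = Real.sqrt (2 - ‖x X‖ ^ 2 / Lam p q X) / Real.sqrt (Lam p q X) * ‖x X‖ := by
    unfold ecc
    have : 1 - (1 - ‖x X‖ ^ 2 / Lam p q X) ^ 2 =
        (2 - ‖x X‖ ^ 2 / Lam p q X) * (‖x X‖ ^ 2 / Lam p q X) := by ring
    rw [this, Real.sqrt_mul (by linarith), Real.sqrt_div (sq_nonneg _),
      Real.sqrt_sq (norm_nonneg _)]
    ring
  have h4 := Complex.norm_mul_exp_arg_mul_I (x X)
  unfold eccVec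
  rw [h3]
  push_cast
  linear_combination -((Real.sqrt (2 - ‖x X‖ ^ 2 / Lam p q X) : ℂ) / Real.sqrt (Lam p q X)) * h4

lemma norm_eccVec_lt_one (hX : X ∈ ellipticRegion p q) : ‖eccVec p q X‖ < 1 := by
  rw [eccVec_eq hX, norm_mul, Complex.norm_exp_ofReal_mul_I, mul_one, Complex.norm_real,
    Real.norm_eq_abs, abs_of_nonneg (ecc_nonneg X)]
  exact ecc_lt_one hX

lemma orbitalPosition_eq (a e M : ℝ) :
    orbitalPosition a e M = horizontalVec ((a : ℂ) * ((Real.cos (eccentricAnomaly e M) - e : ℝ) +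
      Complex.I * ((Real.sqrt (1 - e ^ 2) * Real.sin (eccentricAnomaly e M) : ℝ) : ℂ))) 0 := by
  ext i
  fin_cases i
  · simp [orbitalPosition, horizontalVec, -Complex.ofReal_cos, -Complex.ofReal_sin,
      -Complex.ofReal_sub, -Complex.ofReal_mul]
  · simp [orbitalPosition, horizontalVec, -Complex.ofReal_cos, -Complex.ofReal_sin,
      -Complex.ofReal_sub, -Complex.ofReal_mul]
    ring
  · simp [orbitalPosition, horizontalVec]

/-- Since `√(1 - e²) = 1 - s`, one has `cos E + i (1 - s) sin E = (1 - s/2) exp(iE) + (s/2)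
exp(-iE)`. After the rotation by `ϖ` only the eccentric longitude `E + ϖ` and `(s/2) exp(2iϖ) = x² /
(2Λ)` occur. -/
lemma planarPosition_eq (hX : X ∈ ellipticRegion p q) :
    planarPosition p q X = Complex.exp (Complex.arg (x X) * Complex.I) *
      (((Lam p q X ^ 2 : ℝ) : ℂ) *
        ((Real.cos (eccentricAnomaly (ecc p q X) (lam p q X - Complex.arg (x X))) - ecc p q X : ℝ) +
        Complex.I * ((Real.sqrt (1 - ecc p q X ^ 2) *
          Real.sin (eccentricAnomaly (ecc p q X) (lam p q X - Complex.arg (x X))) : ℝ) : ℂ))) := by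
  have hΛ : ((Lam p q X : ℝ) : ℂ) ≠ 0 := by exact_mod_cast hX.1.ne'
  have hs2 := actionRatio_lt_one hX
  have hsq : Real.sqrt (1 - ecc p q X ^ 2) = 1 - ‖x X‖ ^ 2 / Lam p q X := by
    rw [one_sub_ecc_sq hX, Real.sqrt_sq (by linarith)]
  unfold planarPosition
  rw [hsq, eccVec_eq hX, eccLong_eq_eccentricAnomaly_add (ecc_nonneg X) (ecc_lt_one hX)]
  set E := eccentricAnomaly (ecc p q X) (lam p q X - Complex.arg (x X))
  have hx2 : x X ^ 2 = ((‖x X‖ : ℝ) : ℂ) ^ 2 * Complex.exp (Complex.arg (x X) * Complex.I) ^ 2 := by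
    rw [← mul_pow, Complex.norm_mul_exp_arg_mul_I]
  rw [hx2]
  set ϖ := Complex.arg (x X)
  have e1 : Complex.exp (((E + ϖ : ℝ) : ℂ) * Complex.I) =
      Complex.exp (E * Complex.I) * Complex.exp (ϖ * Complex.I) := by
    rw [← Complex.exp_add]; push_cast; ring_nf
  have e2 : Complex.exp (-(((E + ϖ : ℝ) : ℂ) * Complex.I)) * Complex.exp (ϖ * Complex.I) =
      Complex.exp (-(E * Complex.I)) := by
    rw [← Complex.exp_add]; push_cast; ring_nf
  have e3 : Complex.exp (E * Complex.I) = Real.cos E + Real.sin E * Complex.I := by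
    rw [Complex.exp_mul_I, Complex.ofReal_cos, Complex.ofReal_sin]
  have e4 : Complex.exp (-(E * Complex.I)) = Real.cos E - Real.sin E * Complex.I := by
    rw [← neg_mul, Complex.exp_mul_I, Complex.cos_neg, Complex.sin_neg, Complex.ofReal_cos,
      Complex.ofReal_sin]
    ring
  rw [e3] at e1
  rw [e4] at e2
  rw [e1]
  generalize Complex.exp (-(((E + ϖ : ℝ) : ℂ) * Complex.I)) = v at *
  generalize Complex.exp ((ϖ : ℂ) * Complex.I) = w at *
  generalize hcE : Real.cos E = cE at *
  generalize hsE : Real.sin E = sE at *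
  push_cast
  field_simp
  linear_combination (‖x X‖ : ℂ) ^ 2 * w * e2

/-- The tilt by `I` acts through the distance to the node line, `Im (exp(-iΩ) w)`. Both `1 - cos I =
‖y‖² / G` and `sin I` provide the factors `‖y‖` which, joined to `exp(±iΩ)`, form `y` and its
conjugate. No angle is left, and planar orbits are regular points. -/
lemma position_eq_smoothPosition (hX : X ∈ ellipticRegion p q) :
    position p q X = smoothPosition p q X := by
  have hG := angMom_pos hX
  have hy0 : 0 ≤ ‖y X‖ ^ 2 / angMom p q X := div_nonneg (sq_nonneg _) hG.le
  have hy2 : ‖y X‖ ^ 2 / angMom p q X < 2 := (div_lt_iff₀ hG).2 hX.2.2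
  have hcos : Real.cos (incl p q X) = 1 - ‖y X‖ ^ 2 / angMom p q X :=
    Real.cos_arccos (by linarith) (by linarith)
  have hsin : Real.sin (incl p q X) =
      ‖y X‖ * Real.sqrt ((2 - ‖y X‖ ^ 2 / angMom p q X) / angMom p q X) := by
    unfold incl
    rw [Real.sin_arccos]
    have : 1 - (1 - ‖y X‖ ^ 2 / angMom p q X) ^ 2 =
        ‖y X‖ ^ 2 * ((2 - ‖y X‖ ^ 2 / angMom p q X) / angMom p q X) := by ring
    rw [this, Real.sqrt_mul (sq_nonneg _), Real.sqrt_sq (norm_nonneg _)]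
  unfold position keplerPosition smoothPosition
  rw [orbitalPosition_eq, mul_assoc, ← Matrix.mulVec_mulVec, ← Matrix.mulVec_mulVec,
    rot3_mulVec_horizontalVec]
  have hexp : Complex.exp (((Complex.arg (x X) - Complex.arg (y X) : ℝ) : ℂ) * Complex.I) =
      Complex.exp (-(Complex.arg (y X) * Complex.I)) *
        Complex.exp (Complex.arg (x X) * Complex.I) := by
    rw [← Complex.exp_add]; push_cast; ring_nf
  rw [hexp, mul_assoc, ← planarPosition_eq hX, rot1_mulVec_horizontalVec,
    rot3_mulVec_horizontalVec, hcos, hsin]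
  set w := planarPosition p q X with hw
  set r := Complex.exp (-(Complex.arg (y X) * Complex.I)) with hr
  have hrr : Complex.exp (Complex.arg (y X) * Complex.I) * r = 1 := by
    rw [hr, ← Complex.exp_add]; simp
  have hyr : (starRingEnd ℂ) (y X) = ((‖y X‖ : ℝ) : ℂ) * r := by
    conv_lhs => rw [← Complex.norm_mul_exp_arg_mul_I (y X)]
    rw [map_mul, Complex.conj_ofReal, ← Complex.exp_conj, map_mul, Complex.conj_ofReal,
      Complex.conj_I, hr]
    congr 2
    ring
  have hm : nodeMoment p q X = ‖y X‖ * (r * w).im := by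
    unfold nodeMoment
    rw [← hw, hyr, mul_assoc, Complex.im_ofReal_mul]
  have hyy : y X = ((‖y X‖ : ℝ) : ℂ) * Complex.exp (Complex.arg (y X) * Complex.I) :=
    (Complex.norm_mul_exp_arg_mul_I _).symm
  rw [hm]
  congr 2
  · push_cast
    linear_combination w * hrr + Complex.I * ((‖y X‖ : ℂ) * (r * w).im / angMom p q X) * hyy
  · ring

end EllipticRegion

/-! ### Smoothness and periodicity of the positions -/

section Smoothness

open Topology

variable {p q : ℕ} {X : Phase}

lemma contDiff_theta : ContDiff ℝ ∞ theta := contDiff_fst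

lemma contDiff_u : ContDiff ℝ ∞ u := contDiff_fst.comp contDiff_snd

lemma contDiff_x : ContDiff ℝ ∞ x := contDiff_fst.comp (contDiff_snd.comp contDiff_snd)

lemma contDiff_y : ContDiff ℝ ∞ y :=
  contDiff_fst.comp (contDiff_snd.comp (contDiff_snd.comp contDiff_snd))

lemma contDiff_lamP : ContDiff ℝ ∞ lamP :=
  contDiff_fst.comp (contDiff_snd.comp (contDiff_snd.comp (contDiff_snd.comp contDiff_snd)))

lemma contDiff_Xi : ContDiff ℝ ∞ Xi :=
  contDiff_snd.comp (contDiff_snd.comp (contDiff_snd.comp (contDiff_snd.comp contDiff_snd)))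

lemma contDiff_Lam : ContDiff ℝ ∞ (Lam p q) := contDiff_const.add contDiff_u

lemma contDiff_lam : ContDiff ℝ ∞ (lam p q) :=
  contDiff_theta.add (contDiff_const.mul contDiff_lamP)

lemma contDiff_angMom : ContDiff ℝ ∞ (angMom p q) := contDiff_Lam.sub (contDiff_x.norm_sq ℝ)

lemma isOpen_ellipticRegion : IsOpen (ellipticRegion p q) := by
  refine (isOpen_lt continuous_const contDiff_Lam.continuous).inter
    ((isOpen_lt (contDiff_x.continuous.norm.pow 2) contDiff_Lam.continuous).inter
      (isOpen_lt (contDiff_y.continuous.norm.pow 2)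
        (continuous_const.mul contDiff_angMom.continuous)))

lemma ContDiffAt.ofReal {E : Type} [NormedAddCommGroup E] [NormedSpace ℝ E] {f : E → ℝ} {a : E}
    (hf : ContDiffAt ℝ ∞ f a) : ContDiffAt ℝ ∞ (fun b => (f b : ℂ)) a :=
  Complex.ofRealCLM.contDiff.contDiffAt.comp a hf

lemma contDiffAt_eccVec (hX : X ∈ ellipticRegion p q) : ContDiffAt ℝ ∞ (eccVec p q) X := by
  have h2 := actionRatio_lt_one hX
  have h1 : ContDiffAt ℝ ∞ (fun X => 2 - ‖x X‖ ^ 2 / Lam p q X) X :=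
    contDiffAt_const.sub ((contDiff_x.norm_sq ℝ).contDiffAt.div contDiff_Lam.contDiffAt hX.1.ne')
  refine ContDiffAt.mul (ContDiffAt.ofReal (ContDiffAt.div (h1.sqrt (by linarith))
    (contDiff_Lam.contDiffAt.sqrt hX.1.ne') ?_)) contDiff_x.contDiffAt
  exact (Real.sqrt_pos.2 hX.1).ne'

lemma contDiffAt_planarPosition (hX : X ∈ ellipticRegion p q) :
    ContDiffAt ℝ ∞ (planarPosition p q) X := by
  have hz := contDiffAt_eccVec hX
  have hF : ContDiffAt ℝ ∞ (fun X => eccLong (eccVec p q X) (lam p q X)) X :=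
    ContDiffAt.comp (g := fun w : ℂ × ℝ => eccLong w.1 w.2) X
      (contDiffAt_eccLong (norm_eccVec_lt_one hX) (lam p q X))
      (hz.prodMk contDiff_lam.contDiffAt)
  have hFI : ContDiffAt ℝ ∞
      (fun X => (eccLong (eccVec p q X) (lam p q X) : ℂ) * Complex.I) X :=
    (ContDiffAt.ofReal hF).mul contDiffAt_const
  have hs : ContDiffAt ℝ ∞ (fun X => ‖x X‖ ^ 2 / Lam p q X) X :=
    (contDiff_x.norm_sq ℝ).contDiffAt.div contDiff_Lam.contDiffAt hX.1.ne'
  refine (ContDiffAt.ofReal (contDiff_Lam.contDiffAt.pow 2)).mul (((hFI.cexp.mul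
    (ContDiffAt.ofReal (contDiffAt_const.sub (hs.div_const 2)))).add
    (((contDiff_x.contDiffAt.pow 2).mul (ContDiffAt.ofReal (contDiffAt_const.div
      (contDiffAt_const.mul contDiff_Lam.contDiffAt) ?_))).mul hFI.neg.cexp)).sub hz)
  exact mul_ne_zero two_ne_zero hX.1.ne'

lemma contDiffAt_horizontalVec {E : Type} [NormedAddCommGroup E] [NormedSpace ℝ E] {a : E}
    {w : E → ℂ} {c : E → ℝ} (hw : ContDiffAt ℝ ∞ w a) (hc : ContDiffAt ℝ ∞ c a) :
    ContDiffAt ℝ ∞ (fun b => (WithLp.toLp 2 (horizontalVec (w b) (c b)) : Space)) a := by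
  rw [contDiffAt_euclidean]
  intro i
  fin_cases i
  · exact Complex.reCLM.contDiff.contDiffAt.comp a hw
  · exact Complex.imCLM.contDiff.contDiffAt.comp a hw
  · exact hc

lemma contDiffOn_position : ContDiffOn ℝ ∞ (position p q) (ellipticRegion p q) := by
  have h : ContDiffOn ℝ ∞ (smoothPosition p q) (ellipticRegion p q) := by
    intro X hX
    have hG := angMom_pos hX
    have hw := contDiffAt_planarPosition hX
    have hy2 : ‖y X‖ ^ 2 / angMom p q X < 2 := (div_lt_iff₀ hG).2 hX.2.2
    have hm : ContDiffAt ℝ ∞ (nodeMoment p q) X :=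
      Complex.imCLM.contDiff.contDiffAt.comp X
        ((Complex.conjCLE.contDiff.contDiffAt.comp X contDiff_y.contDiffAt).mul hw)
    have hGs : ContDiffAt ℝ ∞ (angMom p q) X := contDiff_angMom.contDiffAt
    have hr : ContDiffAt ℝ ∞
        (fun X => (2 - ‖y X‖ ^ 2 / angMom p q X) / angMom p q X) X :=
      (contDiffAt_const.sub ((contDiff_y.norm_sq ℝ).contDiffAt.div hGs hG.ne')).div hGs hG.ne'
    refine (contDiffAt_horizontalVec (hw.sub ((contDiffAt_const.mul contDiff_y.contDiffAt).mul
      (ContDiffAt.ofReal (hm.div hGs hG.ne')))) (hm.mul (hr.sqrt ?_))).contDiffWithinAt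
    exact (div_pos (by linarith) hG).ne'
  exact h.congr fun X hX => position_eq_smoothPosition hX

lemma eccentricAnomaly_add_two_pi {e : ℝ} (he0 : 0 ≤ e) (he1 : e < 1) (M : ℝ) :
    eccentricAnomaly e (M + 2 * Real.pi) = eccentricAnomaly e M + 2 * Real.pi := by
  rw [eccentricAnomaly_eq_eccLong, eccentricAnomaly_eq_eccLong]
  refine eccLong_add_two_pi ?_ M
  rwa [Complex.norm_real, Real.norm_eq_abs, abs_of_nonneg he0]

lemma keplerPosition_add_two_pi {e : ℝ} (he0 : 0 ≤ e) (he1 : e < 1) (a I Om w M : ℝ) :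
    keplerPosition a e I Om w (M + 2 * Real.pi) = keplerPosition a e I Om w M := by
  unfold keplerPosition orbitalPosition
  rw [eccentricAnomaly_add_two_pi he0 he1, Real.cos_add_two_pi, Real.sin_add_two_pi]

lemma keplerPosition_add_int_mul_two_pi {e : ℝ} (he0 : 0 ≤ e) (he1 : e < 1) (a I Om w M : ℝ)
    (n : ℤ) : keplerPosition a e I Om w (M + n * (2 * Real.pi)) = keplerPosition a e I Om w M := by
  have h : Function.Periodic (fun M => keplerPosition a e I Om w M) (2 * Real.pi) :=
    keplerPosition_add_two_pi he0 he1 a I Om w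
  exact h.int_mul n M

/-! ### The orbit of the planet -/

section Planet

variable {e' : ℝ}

lemma planet_eq (e' l : ℝ) : planet e' l = WithLp.toLp 2 (horizontalVec
    ((Real.cos (eccLong (e' : ℂ) l) - e' : ℝ) +
      Complex.I * ((Real.sqrt (1 - e' ^ 2) * Real.sin (eccLong (e' : ℂ) l) : ℝ) : ℂ)) 0) := by
  have h3 : rot3 0 = 1 := by
    ext i j
    fin_cases i <;> fin_cases j <;> simp [rot3]
  have h1 : rot1 0 = 1 := by
    ext i j
    fin_cases i <;> fin_cases j <;> simp [rot1]
  unfold planet keplerPosition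
  rw [h3, h1, mul_one, mul_one, Matrix.one_mulVec, orbitalPosition_eq,
    eccentricAnomaly_eq_eccLong, Complex.ofReal_one, one_mul]

lemma contDiff_planet (he0 : 0 ≤ e') (he1 : e' < 1) : ContDiff ℝ ∞ (planet e') := by
  have hz : ‖(e' : ℂ)‖ < 1 := by rwa [Complex.norm_real, Real.norm_eq_abs, abs_of_nonneg he0]
  rw [show planet e' = _ from funext (planet_eq e'), contDiff_iff_contDiffAt]
  intro l
  have hF : ContDiffAt ℝ ∞ (fun l => eccLong (e' : ℂ) l) l :=
    ContDiffAt.comp (g := fun w : ℂ × ℝ => eccLong w.1 w.2) l (contDiffAt_eccLong hz l)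
      (contDiffAt_const.prodMk contDiffAt_id)
  exact contDiffAt_horizontalVec ((ContDiffAt.ofReal (hF.cos.sub contDiffAt_const)).add
    (contDiffAt_const.mul (ContDiffAt.ofReal (contDiffAt_const.mul hF.sin)))) contDiffAt_const

lemma planet_ne_zero (he0 : 0 ≤ e') (he1 : e' < 1) (l : ℝ) : planet e' l ≠ 0 := by
  intro h
  rw [planet_eq] at h
  have h0 : (Real.cos (eccLong (e' : ℂ) l) - e') = 0 := by
    have := congrArg (fun v : Space => v 0) h
    simpa [horizontalVec, -Complex.ofReal_cos, -Complex.ofReal_sin, -Complex.ofReal_sub] using this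
  have h1 : Real.sqrt (1 - e' ^ 2) * Real.sin (eccLong (e' : ℂ) l) = 0 := by
    have := congrArg (fun v : Space => v 1) h
    simpa [horizontalVec, -Complex.ofReal_cos, -Complex.ofReal_sin, -Complex.ofReal_sub,
      -Complex.ofReal_mul, -mul_eq_zero] using this
  have h2 : 0 < Real.sqrt (1 - e' ^ 2) := Real.sqrt_pos.2 (by nlinarith)
  have h3 : Real.sin (eccLong (e' : ℂ) l) = 0 := by
    rcases mul_eq_zero.1 h1 with h | h
    · exact absurd h h2.ne'
    · exact h
  nlinarith [Real.sin_sq_add_cos_sq (eccLong (e' : ℂ) l)]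

end Planet

/-! The phase space translations. -/

/-- The direction of the coordinate `λ'`. -/
def dirLamP : Phase := (0, 0, 0, 0, 1, 0)

/-- The direction of the coordinate `Ξ`. -/
def dirXi : Phase := (0, 0, 0, 0, 0, 1)

lemma setLamP_eq (X : Phase) (l : ℝ) : setLamP X l = X + (l - lamP X) • dirLamP := by
  simp [setLamP, dirLamP, theta, u, x, y, lamP, Xi, Prod.ext_iff]

lemma setLamP_add_eq (X : Phase) (s : ℝ) : setLamP X (lamP X + s) = X + s • dirLamP := by
  rw [setLamP_eq, add_sub_cancel_left]

lemma setXi_eq (X : Phase) (z : ℝ) : setXi X z = X + (z - Xi X) • dirXi := by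
  simp [setXi, dirXi, theta, u, x, y, lamP, Xi, Prod.ext_iff]

lemma position_eq_of_lam_eq_add {Y : Phase} (hX : X ∈ ellipticRegion p q) (hu : u Y = u X)
    (hx : x Y = x X) (hy : y Y = y X) (n : ℤ) (hl : lam p q Y = lam p q X + n * (2 * Real.pi)) :
    position p q Y = position p q X := by
  rw [show position p q X = _ from (keplerPosition_add_int_mul_two_pi
    (ecc_nonneg X) (ecc_lt_one hX) _ _ _ _ _ n).symm]
  unfold position incl ecc angMom Lam
  have h : lam p q X + n * (2 * Real.pi) - Complex.arg (x X) =
      lam p q X - Complex.arg (x X) + n * (2 * Real.pi) := by ring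
  rw [hu, hx, hy, hl, h]

lemma planet_add_int_mul_two_pi {e' : ℝ} (he0 : 0 ≤ e') (he1 : e' < 1) (l : ℝ) (n : ℤ) :
    planet e' (l + n * (2 * Real.pi)) = planet e' l :=
  keplerPosition_add_int_mul_two_pi he0 he1 _ _ _ _ _ n

lemma mem_ellipticRegion_congr {Y : Phase} (hu : u Y = u X) (hx : x Y = x X) (hy : y Y = y X) :
    Y ∈ ellipticRegion p q ↔ X ∈ ellipticRegion p q := by
  simp only [ellipticRegion, mem_ofPred_eq, angMom, Lam, hu, hx, hy]

/-- The translations which preserve the positions of the bodies: `a` periods in `λ`, `b` periods in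
`λ'`, and any displacement `z` of `Ξ`. -/
def translation (p q : ℕ) (a b : ℤ) (z : ℝ) : Phase :=
  (a * (2 * Real.pi) - b * (2 * Real.pi * p / q), 0, 0, 0, b * (2 * Real.pi), z)

lemma translation_one_zero_zero : translation p q 1 0 0 = shiftLam := by
  simp [translation, shiftLam]

lemma translation_zero_one_zero : translation p q 0 1 0 = shiftLamP p q := by
  simp [translation, shiftLamP]

/-- `p` turns of the particle with `q` turns of the planet restore `θ`; this is why the period in
`λ'` at fixed `θ` is `2πq`. -/
lemma translation_period (hq : 0 < q) :
    translation p q p q 0 = (2 * Real.pi * q) • dirLamP := by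
  have hq' : (q : ℝ) ≠ 0 := by exact_mod_cast hq.ne'
  simp only [translation, dirLamP, Int.cast_natCast]
  have h1 : (p : ℝ) * (2 * Real.pi) - q * (2 * Real.pi * p / q) = 0 := by
    field_simp
    ring
  rw [h1, mul_comm (q : ℝ)]
  simp

lemma translation_dirXi (z : ℝ) : translation p q 0 0 z = z • dirXi := by
  simp [translation, dirXi]

section Translation

variable (a b : ℤ) (z : ℝ)

@[simp] lemma u_add_translation : u (X + translation p q a b z) = u X := by simp [u, translation]

@[simp] lemma x_add_translation : x (X + translation p q a b z) = x X := by simp [x, translation]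

@[simp] lemma y_add_translation : y (X + translation p q a b z) = y X := by simp [y, translation]

@[simp] lemma lamP_add_translation :
    lamP (X + translation p q a b z) = lamP X + b * (2 * Real.pi) := by
  simp [lamP, translation]

lemma lam_add_translation :
    lam p q (X + translation p q a b z) = lam p q X + a * (2 * Real.pi) := by
  simp only [lam, theta, lamP, translation, Prod.fst_add, Prod.snd_add]
  ring

lemma position_add_translation (hX : X ∈ ellipticRegion p q) :
    position p q (X + translation p q a b z) = position p q X :=
  position_eq_of_lam_eq_add hX (by simp) (by simp) (by simp) a (lam_add_translation a b z)

lemma add_translation_mem_ellipticRegion :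
    X + translation p q a b z ∈ ellipticRegion p q ↔ X ∈ ellipticRegion p q :=
  mem_ellipticRegion_congr (by simp) (by simp) (by simp)

end Translation

end Smoothness

/-! ### A convex set of uniformly elliptic motions -/

section Core

open Topology

variable {p q : ℕ} {σ τ : ℝ}

lemma aRes_pos (hp : 0 < p) (hq : 0 < q) : 0 < aRes p q := by
  have : (0 : ℝ) < p := by exact_mod_cast hp
  have : (0 : ℝ) < q := by exact_mod_cast hq
  unfold aRes
  positivity

/-- The bound on `|u|` which keeps the motion elliptic. -/
def maxAction (p q : ℕ) (σ : ℝ) : ℝ := Real.sqrt (aRes p q) * (1 - max 0 (1 - σ / 2) ^ 2) / 2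

/-- The motions that are uniformly elliptic and uniformly non-retrograde. -/
def core (p q : ℕ) (σ τ : ℝ) : Set Phase :=
  {X | |u X| ≤ maxAction p q σ ∧ ‖x X‖ ≤ aRes p q ^ (1 / 4 : ℝ) * max 0 (1 - σ / 2) ∧
    ‖y X‖ ^ 2 ≤ 2 * max 0 (1 - τ / 2) * angMom p q X}

lemma max_zero_one_sub_lt_one (hσ : 0 < σ) : max 0 (1 - σ / 2) < 1 :=
  max_lt one_pos (by linarith)

lemma maxAction_pos (hp : 0 < p) (hq : 0 < q) (hσ : 0 < σ) : 0 < maxAction p q σ := by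
  have h1 := max_zero_one_sub_lt_one hσ
  have h2 : 0 ≤ max 0 (1 - σ / 2) := le_max_left _ _
  have h3 := Real.sqrt_pos.2 (aRes_pos hp hq)
  have : 0 < 1 - max 0 (1 - σ / 2) ^ 2 := by nlinarith
  unfold maxAction
  positivity

lemma rpow_quarter_sq (hp : 0 < p) (hq : 0 < q) :
    (aRes p q ^ (1 / 4 : ℝ)) ^ 2 = Real.sqrt (aRes p q) := by
  rw [← Real.rpow_natCast, ← Real.rpow_mul (aRes_pos hp hq).le, Real.sqrt_eq_rpow]
  norm_num

/-- `maxAction` is half of the gap between `√ã` and the largest allowed `‖x‖²`: one half is left to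
`u`, the other bounds the angular momentum from below. -/
lemma maxAction_le_angMom (hp : 0 < p) (hq : 0 < q) {X : Phase}
    (hu : |u X| ≤ maxAction p q σ)
    (hx : ‖x X‖ ≤ aRes p q ^ (1 / 4 : ℝ) * max 0 (1 - σ / 2)) :
    maxAction p q σ ≤ angMom p q X := by
  have h1 : ‖x X‖ ^ 2 ≤ Real.sqrt (aRes p q) * max 0 (1 - σ / 2) ^ 2 := by
    rw [← rpow_quarter_sq hp hq, ← mul_pow]
    exact pow_le_pow_left₀ (norm_nonneg _) hx 2
  have h2 := (abs_le.1 hu).1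
  unfold angMom Lam
  have h3 : Real.sqrt (aRes p q) * max 0 (1 - σ / 2) ^ 2 =
      Real.sqrt (aRes p q) - 2 * maxAction p q σ := by
    unfold maxAction
    ring
  linarith

lemma core_subset_ellipticRegion (hp : 0 < p) (hq : 0 < q) (hσ : 0 < σ) (hτ : 0 < τ) :
    core p q σ τ ⊆ ellipticRegion p q := by
  rintro X ⟨hu, hx, hy⟩
  have hG := (maxAction_pos hp hq hσ).trans_le (maxAction_le_angMom hp hq hu hx)
  have hΛ : ‖x X‖ ^ 2 < Lam p q X := sub_pos.1 hG
  refine ⟨(sq_nonneg _).trans_lt hΛ, hΛ, hy.trans_lt ?_⟩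
  have := max_zero_one_sub_lt_one hτ
  exact mul_lt_mul_of_pos_right (by linarith) hG

lemma isClosed_core : IsClosed (core p q σ τ) :=
  (isClosed_le contDiff_u.continuous.abs continuous_const).inter
    ((isClosed_le contDiff_x.continuous.norm continuous_const).inter
      (isClosed_le (contDiff_y.continuous.norm.pow 2)
        (continuous_const.mul contDiff_angMom.continuous)))

/-- Convexity turns derivative bounds on the core into Lipschitz bounds. In the third condition
`angMom` is concave and its coefficient is nonnegative, thanks to the truncation by `max 0`. -/
lemma convex_core : Convex ℝ (core p q σ τ) := by
  intro X hX Y hY a b ha hb hab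
  have hsq : ∀ z w : ℂ, ‖a • z + b • w‖ ^ 2 ≤ a * ‖z‖ ^ 2 + b * ‖w‖ ^ 2 := fun z w =>
    ((convexOn_norm convex_univ).pow (fun _ _ => norm_nonneg _) 2).2 (mem_univ z) (mem_univ w)
      ha hb hab
  have eu : u (a • X + b • Y) = a * u X + b * u Y := rfl
  have ex : x (a • X + b • Y) = a • x X + b • x Y := rfl
  have ey : y (a • X + b • Y) = a • y X + b • y Y := rfl
  refine ⟨?_, ?_, ?_⟩
  · have h1 := abs_le.1 hX.1
    have h2 := abs_le.1 hY.1
    rw [eu, abs_le]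
    have e : maxAction p q σ = a * maxAction p q σ + b * maxAction p q σ := by
      rw [← add_mul, hab, one_mul]
    constructor <;> rw [e] <;> nlinarith
  · rw [ex]
    refine (norm_add_le _ _).trans ?_
    rw [norm_smul, norm_smul, Real.norm_of_nonneg ha, Real.norm_of_nonneg hb]
    set c := aRes p q ^ (1 / 4 : ℝ) * max 0 (1 - σ / 2)
    calc a * ‖x X‖ + b * ‖x Y‖ ≤ a * c + b * c :=
          add_le_add (mul_le_mul_of_nonneg_left hX.2.1 ha) (mul_le_mul_of_nonneg_left hY.2.1 hb)
      _ = c := by rw [← add_mul, hab, one_mul]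
  · have h1 := hX.2.2
    have h2 := hY.2.2
    have h3 := hsq (y X) (y Y)
    have h4 := hsq (x X) (x Y)
    unfold angMom Lam at h1 h2 ⊢
    rw [ey, ex, eu]
    have h5 := mul_le_mul_of_nonneg_left h4 (le_max_left 0 (1 - τ / 2))
    have h6 := mul_le_mul_of_nonneg_left h1 ha
    have h7 := mul_le_mul_of_nonneg_left h2 hb
    have h8 : max 0 (1 - τ / 2) * Real.sqrt (aRes p q) =
        a * (max 0 (1 - τ / 2) * Real.sqrt (aRes p q)) +
          b * (max 0 (1 - τ / 2) * Real.sqrt (aRes p q)) := by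
      rw [← add_mul, hab, one_mul]
    linarith

lemma mem_core_congr {X Y : Phase} (hu : u Y = u X) (hx : x Y = x X) (hy : y Y = y X) :
    Y ∈ core p q σ τ ↔ X ∈ core p q σ τ := by
  simp only [core, mem_ofPred_eq, angMom, Lam, hu, hx, hy]

lemma exists_norm_le_of_mem_core (hp : 0 < p) (hq : 0 < q) (hσ : 0 < σ) :
    ∃ b : ℝ, 1 ≤ b ∧ ∀ X ∈ core p q σ τ, ‖x X‖ ≤ b ∧ ‖y X‖ ≤ b := by
  set c := aRes p q ^ (1 / 4 : ℝ) * max 0 (1 - σ / 2)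
  set d := 2 * max 0 (1 - τ / 2) * (Real.sqrt (aRes p q) + maxAction p q σ)
  have hd : 0 ≤ d := by
    have := maxAction_pos hp hq hσ
    positivity
  refine ⟨max c (1 + d), le_max_of_le_right (by linarith), fun X hX =>
    ⟨hX.2.1.trans (le_max_left _ _), le_max_of_le_right ?_⟩⟩
  have h1 : ‖y X‖ ^ 2 ≤ d := by
    refine hX.2.2.trans (mul_le_mul_of_nonneg_left ?_ (by positivity))
    unfold angMom Lam
    linarith [(abs_le.1 hX.1).2, sq_nonneg ‖x X‖]
  nlinarith [norm_nonneg (y X)]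

/-- Every phase point can be translated to a bounded set of angles and to `Ξ = 0`. -/
lemma exists_translation_mem (hq : 0 < q) (X : Phase) : ∃ (a b : ℤ) (z : ℝ),
    |theta (X + translation p q a b z)| ≤ 2 * Real.pi + (p : ℝ) / q * (2 * Real.pi) ∧
      |lamP (X + translation p q a b z)| ≤ 2 * Real.pi ∧
      Xi (X + translation p q a b z) = 0 := by
  have hpi := Real.pi_pos
  have hfloor : ∀ r : ℝ, ∃ n : ℤ, |r + n * (2 * Real.pi)| ≤ 2 * Real.pi := by
    intro r
    refine ⟨-⌊r / (2 * Real.pi)⌋, ?_⟩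
    have h1 := Int.floor_le (r / (2 * Real.pi))
    have h2 := Int.lt_floor_add_one (r / (2 * Real.pi))
    rw [le_div_iff₀ (by positivity)] at h1
    rw [div_lt_iff₀ (by positivity)] at h2
    push_cast
    rw [abs_le]
    constructor <;> linarith
  obtain ⟨a, ha⟩ := hfloor (lam p q X)
  obtain ⟨b, hb⟩ := hfloor (lamP X)
  refine ⟨a, b, -Xi X, ?_, ?_, ?_⟩
  · have h1 : theta (X + translation p q a b (-Xi X)) =
        lam p q X + a * (2 * Real.pi) - (p : ℝ) / q * (lamP X + b * (2 * Real.pi)) := by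
      simp only [theta, translation, lam, lamP, Prod.fst_add]
      ring
    rw [h1]
    refine (abs_sub _ _).trans (add_le_add ha ?_)
    rw [abs_mul, abs_of_nonneg (by positivity : (0 : ℝ) ≤ (p : ℝ) / q)]
    exact mul_le_mul_of_nonneg_left hb (by positivity)
  · rwa [lamP_add_translation]
  · simp [Xi, translation]

/-- `f` is smooth on the open set `R`, and both are invariant under the translations. -/
structure IsPeriodicSmooth {F : Type} [NormedAddCommGroup F] [NormedSpace ℝ F] (p q : ℕ)
    (R : Set Phase) (f : Phase → F) : Prop where
  isOpen : IsOpen R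
  contDiffOn : ContDiffOn ℝ ∞ f R
  mem_iff : ∀ X a b z, X + translation p q a b z ∈ R ↔ X ∈ R
  map_add : ∀ X ∈ R, ∀ a b z, f (X + translation p q a b z) = f X

lemma IsPeriodicSmooth.iteratedFDeriv_add {F : Type} [NormedAddCommGroup F] [NormedSpace ℝ F]
    {R : Set Phase} {f : Phase → F} (hf : IsPeriodicSmooth p q R f) (k : ℕ) {X : Phase}
    (hX : X ∈ R) (a b : ℤ) (z : ℝ) :
    iteratedFDeriv ℝ k f (X + translation p q a b z) = iteratedFDeriv ℝ k f X := by
  rw [← iteratedFDeriv_comp_add_right]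
  have : (fun Y => f (Y + translation p q a b z)) =ᶠ[𝓝 X] f := by
    filter_upwards [hf.isOpen.mem_nhds hX] with Y hY
    exact hf.map_add Y hY a b z
  exact (this.iteratedFDeriv (𝕜 := ℝ) k).eq_of_nhds

/-- Periodic smooth functions have bounded derivatives on invariant closed parts of the core. -/
lemma IsPeriodicSmooth.exists_bound {F : Type} [NormedAddCommGroup F] [NormedSpace ℝ F]
    (hp : 0 < p) (hq : 0 < q) (hσ : 0 < σ)
    {R K : Set Phase} {f : Phase → F} (hf : IsPeriodicSmooth p q R f) (hK : IsClosed K)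
    (hKR : K ⊆ R) (hKc : K ⊆ core p q σ τ)
    (hKm : ∀ X a b z, X + translation p q a b z ∈ K ↔ X ∈ K) (n : ℕ) :
    ∃ M : ℝ, 1 ≤ M ∧ ∀ k ≤ n, ∀ X ∈ K, ‖iteratedFDeriv ℝ k f X‖ ≤ M := by
  obtain ⟨β, hβ1, hβ⟩ := exists_norm_le_of_mem_core (p := p) (q := q) (τ := τ) hp hq hσ
  set r := 2 * Real.pi + (p : ℝ) / q * (2 * Real.pi)
  -- On the core `u`, `x`, `y` are bounded, so `K` is compact once the translations have brought the
  -- angles and `Ξ` into this box.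
  let box : Set Phase := {X | |theta X| ≤ r ∧ |lamP X| ≤ 2 * Real.pi ∧ Xi X = 0}
  have hbox : IsClosed box :=
    (isClosed_le contDiff_theta.continuous.abs continuous_const).inter
      ((isClosed_le contDiff_lamP.continuous.abs continuous_const).inter
        (isClosed_eq contDiff_Xi.continuous continuous_const))
  have hcomp : IsCompact (K ∩ box) := by
    refine Metric.isCompact_of_isClosed_isBounded (hK.inter hbox) ?_
    refine (Metric.isBounded_closedBall (x := (0 : Phase))
      (r := max r (max (maxAction p q σ) (max β (2 * Real.pi))))).subset fun X hX => ?_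
    have hb := hβ X (hKc hX.1)
    have hu := (hKc hX.1).1
    obtain ⟨h1, h2, h3⟩ := hX.2
    rw [mem_closedBall_zero_iff]
    have h3' : ‖Xi X‖ ≤ 2 * Real.pi := by
      rw [h3, norm_zero]
      positivity
    refine norm_prod_le_iff.2 ⟨le_max_of_le_left h1, norm_prod_le_iff.2
      ⟨le_max_of_le_right (le_max_of_le_left hu), norm_prod_le_iff.2
        ⟨le_max_of_le_right (le_max_of_le_right (le_max_of_le_left hb.1)), norm_prod_le_iff.2
          ⟨le_max_of_le_right (le_max_of_le_right (le_max_of_le_left hb.2)), norm_prod_le_iff.2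
            ⟨le_max_of_le_right (le_max_of_le_right (le_max_of_le_right h2)),
              le_max_of_le_right (le_max_of_le_right (le_max_of_le_right h3'))⟩⟩⟩⟩⟩
  have hex : ∀ k : ℕ, ∃ M : ℝ, ∀ X ∈ K ∩ box, ‖iteratedFDeriv ℝ k f X‖ ≤ M := fun k =>
    hcomp.exists_bound_of_continuousOn fun X hX =>
      ((hf.contDiffOn.contDiffAt (hf.isOpen.mem_nhds (hKR hX.1))).continuousAt_iteratedFDeriv
        (by exact_mod_cast le_top)).continuousWithinAt
  choose M hM using hex
  refine ⟨1 + ∑ k ∈ Finset.range (n + 1), |M k|, ?_, fun k hk X hX => ?_⟩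
  · have : 0 ≤ ∑ k ∈ Finset.range (n + 1), |M k| := by positivity
    linarith
  · obtain ⟨a, b, z, h⟩ := exists_translation_mem (p := p) hq X
    rw [← hf.iteratedFDeriv_add k (hKR hX) a b z]
    refine (hM k _ ⟨(hKm X a b z).2 hX, h⟩).trans ((le_abs_self _).trans ?_)
    have := Finset.single_le_sum (f := fun k => |M k|) (fun i _ => abs_nonneg _)
      (Finset.mem_range.2 (by omega : k < n + 1))
    linarith

lemma add_translation_mem_core (X : Phase) (a b : ℤ) (z : ℝ) :
    X + translation p q a b z ∈ core p q σ τ ↔ X ∈ core p q σ τ :=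
  mem_core_congr (by simp) (by simp) (by simp)

lemma isPeriodicSmooth_position :
    IsPeriodicSmooth p q (ellipticRegion p q) (position p q) where
  isOpen := isOpen_ellipticRegion
  contDiffOn := contDiffOn_position
  mem_iff := fun _ a b z => add_translation_mem_ellipticRegion a b z
  map_add := fun _ hX a b z => position_add_translation a b z hX

lemma isPeriodicSmooth_separation {e' : ℝ} (he0 : 0 ≤ e') (he1 : e' < 1) :
    IsPeriodicSmooth p q (ellipticRegion p q)
      (fun X => position p q X - planet e' (lamP X)) where
  isOpen := isOpen_ellipticRegion
  contDiffOn := contDiffOn_position.sub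
    ((contDiff_planet he0 he1).comp contDiff_lamP).contDiffOn
  mem_iff := fun _ a b z => add_translation_mem_ellipticRegion a b z
  map_add := fun X hX a b z => by
    rw [position_add_translation a b z hX, lamP_add_translation,
      planet_add_int_mul_two_pi he0 he1]

/-- The part of the perturbation (divided by `ε`) that is regular at collisions with the planet. -/
def regularPart (p q : ℕ) (e' : ℝ) (X : Phase) : ℝ :=
  ‖position p q X‖⁻¹ +
    inner ℝ (position p q X) (planet e' (lamP X)) / ‖planet e' (lamP X)‖ ^ 3

lemma isPeriodicSmooth_regularPart {e' : ℝ} (he0 : 0 ≤ e') (he1 : e' < 1) :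
    IsPeriodicSmooth p q (ellipticRegion p q ∩ {X | position p q X ≠ 0})
      (regularPart p q e') where
  isOpen := contDiffOn_position.continuousOn.isOpen_inter_preimage isOpen_ellipticRegion isOpen_ne
  contDiffOn := by
    have h1 : ContDiffOn ℝ ∞ (position p q) (ellipticRegion p q ∩ {X | position p q X ≠ 0}) :=
      contDiffOn_position.mono inter_subset_left
    have h2 : ContDiff ℝ ∞ fun X => planet e' (lamP X) :=
      (contDiff_planet he0 he1).comp contDiff_lamP
    intro X hX
    have h3 := h1 X hX
    refine ((h3.norm ℝ hX.2).inv (norm_ne_zero_iff.2 hX.2)).add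
      ((h3.inner ℝ h2.contDiffAt.contDiffWithinAt).div
        ((h2.contDiffAt.norm ℝ (planet_ne_zero he0 he1 _)).pow 3).contDiffWithinAt ?_)
    exact pow_ne_zero 3 (norm_ne_zero_iff.2 (planet_ne_zero he0 he1 _))
  mem_iff := fun X a b z => by
    constructor
    · rintro ⟨h1, h2⟩
      have h3 := (add_translation_mem_ellipticRegion a b z).1 h1
      refine ⟨h3, ?_⟩
      simp only [mem_ofPred_eq] at h2 ⊢
      rwa [position_add_translation a b z h3] at h2
    · rintro ⟨h1, h2⟩
      refine ⟨(add_translation_mem_ellipticRegion a b z).2 h1, ?_⟩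
      simp only [mem_ofPred_eq] at h2 ⊢
      rwa [position_add_translation a b z h1]
  map_add := fun X hX a b z => by
    unfold regularPart
    rw [position_add_translation a b z hX.1, lamP_add_translation,
      planet_add_int_mul_two_pi he0 he1]

lemma HP_eq (e' ε : ℝ) (X : Phase) : HP p q e' ε X =
    ε * (regularPart p q e' X - ‖position p q X - planet e' (lamP X)‖⁻¹) := by
  unfold HP regularPart
  ring

/-! ### The collisionless domains -/

variable {e' Δt ρ Δ κ : ℝ}

lemma norm_xt (X : Phase) : ‖xt X‖ = ‖x X‖ := by simp [xt]

/-- The core is built from the bounds at `κ = 2`. Constants found on it are therefore independent of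
`ρ`, `Δ` and `κ`. -/
lemma domain_subset_core (hp : 0 < p) (hq : 0 < q) (hσ : 0 < σ) (hτ : 0 < τ) (hκ : 0 < κ)
    (hκ2 : κ ≤ 2) (hρ : 0 < ρ) (hρ2 : 2 * ρ ≤ maxAction p q σ) :
    domain p q e' σ Δt τ ρ Δ κ ⊆ core p q σ τ := by
  rintro X ⟨hu, hx, hy, -⟩
  rw [norm_xt, max_self] at hx
  have ha : 0 ≤ aRes p q ^ (1 / 4 : ℝ) := by
    have := aRes_pos hp hq
    positivity
  have hu' : |u X| ≤ maxAction p q σ := hu.trans (by nlinarith)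
  have hmono : ∀ s : ℝ, 0 < s → 1 - s / κ ≤ max 0 (1 - s / 2) := fun s hs => by
    refine le_max_of_le_right ?_
    have : s / 2 ≤ s / κ := div_le_div_of_nonneg_left hs.le hκ hκ2
    linarith
  have hx' : ‖x X‖ ≤ aRes p q ^ (1 / 4 : ℝ) * max 0 (1 - σ / 2) :=
    hx.trans (mul_le_mul_of_nonneg_left (hmono σ hσ) ha)
  have hG := (maxAction_pos hp hq hσ).trans_le (maxAction_le_angMom hp hq hu' hx')
  refine ⟨hu', hx', hy.trans (mul_le_mul_of_nonneg_right ?_ hG.le)⟩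
  linarith [hmono τ hτ]

lemma add_smul_dirLamP_mem_domain {X : Phase} (s : ℝ)
    (hX : X ∈ domain p q e' σ Δt τ ρ Δ κ) :
    X + s • dirLamP ∈ domain p q e' σ Δt τ ρ Δ κ := by
  have h : X + s • dirLamP = setLamP X (lamP X + s) := (setLamP_add_eq X s).symm
  rw [h]
  exact hX

lemma add_translation_mem_domain (he0 : 0 ≤ e') (he1 : e' < 1)
    {X : Phase} (a b : ℤ) (z : ℝ)
    (hX : X ∈ domain p q e' σ Δt τ ρ Δ κ) (hXe : X ∈ ellipticRegion p q) :
    X + translation p q a b z ∈ domain p q e' σ Δt τ ρ Δ κ := by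
  have hpos : ∀ l, position p q (setLamP (X + translation p q a b z) l) =
      position p q (setLamP X (l - b * (2 * Real.pi))) := by
    intro l
    have h1 : setLamP (X + translation p q a b z) l =
        setLamP X (l - b * (2 * Real.pi)) + translation p q a b z := by
      simp [setLamP, translation, theta, u, x, y, Xi]
    rw [h1]
    exact position_add_translation a b z ((mem_ellipticRegion_congr rfl rfl rfl).2 hXe)
  have hplanet : ∀ l, planet e' l = planet e' (l - b * (2 * Real.pi)) := fun l => by
    rw [← planet_add_int_mul_two_pi he0 he1 (l - b * (2 * Real.pi)) b, sub_add_cancel]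
  obtain ⟨h1, h2, h3, h4, h5⟩ := hX
  refine ⟨by rwa [u_add_translation], ?_, ?_, fun l => ?_, fun l => ?_⟩
  · rw [norm_xt] at h2 ⊢
    rwa [x_add_translation]
  · unfold angMom Lam at h3 ⊢
    rwa [u_add_translation, x_add_translation, y_add_translation]
  · rw [hpos, hplanet]
    exact h4 _
  · rw [hpos]
    exact h5 _

/-- The perturbation and its first derivatives in terms of the distance to collisions. -/
lemma exists_scaledBound_HP (hp : 0 < p) (hq : 0 < q) (he0 : 0 ≤ e') (he1 : e' < 1) (hσ : 0 < σ)
    (hΔt : 0 < Δt) (hτ : 0 < τ) :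
    ∃ K : ℝ, 1 ≤ K ∧ ∀ (ε ρ Δ : ℝ) (U : Set Phase), 0 < ε → 0 < ρ → 0 < Δ → Δ ≤ 1 →
      2 * ρ ≤ maxAction p q σ → IsOpen U → U ⊆ domain p q e' σ Δt τ ρ Δ 2 →
      ScaledBound U 3 (K * ε / Δ) Δ (HP p q e' ε) := by
  have hcore := core_subset_ellipticRegion (p := p) (q := q) hp hq hσ hτ
  -- The separation vector has bounds uniform in `ε`, `ρ`, `Δ`; only the inverse of its norm brings
  -- in `Δ`. Three derivatives are kept because the corrected residual contains two θ-derivatives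
  -- and is differentiated once more.
  obtain ⟨D, hD1, hD⟩ := (isPeriodicSmooth_separation (p := p) (q := q) he0 he1).exists_bound
    hp hq hσ (isClosed_core (σ := σ) (τ := τ)) hcore subset_rfl add_translation_mem_core 3
  set K₂ : Set Phase := core p q σ τ ∩ {X | Δt / 2 ≤ ‖position p q X‖} with hK₂
  have hK₂c : IsClosed K₂ := by
    have h1 : ContinuousOn (fun X => ‖position p q X‖) (core p q σ τ) :=
      (contDiffOn_position.continuousOn.mono hcore).norm
    exact h1.preimage_isClosed_of_isClosed isClosed_core isClosed_Ici
  obtain ⟨N, hN1, hN⟩ := (isPeriodicSmooth_regularPart (p := p) (q := q) he0 he1).exists_bound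
    hp hq hσ hK₂c
    (fun X hX => ⟨hcore hX.1, norm_pos_iff.1 ((half_pos hΔt).trans_le hX.2)⟩) inter_subset_left
    (fun X a b z => by
      refine and_congr_left' (add_translation_mem_core X a b z) |>.trans ?_
      refine and_congr_right fun h => ?_
      simp only [mem_ofPred_eq]
      rw [position_add_translation a b z (hcore h)]) 3
  obtain ⟨c, hc, hcb⟩ := exists_scaledBound_inv_norm (P := Phase) (E := Space) 3 D hD1
  refine ⟨N + 16 * c, by linarith, fun ε ρ Δ U hε hρ hΔ hΔ1 hρ2 hU hUd => ?_⟩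
  have hUc : U ⊆ core p q σ τ :=
    hUd.trans (domain_subset_core hp hq hσ hτ two_pos le_rfl hρ hρ2)
  have hfar : ∀ X ∈ U, Δ / 2 ≤ ‖position p q X - planet e' (lamP X)‖ := fun X hX =>
    (hUd hX).2.2.2.1 (lamP X)
  have hr : ∀ X ∈ U, Δt / 2 ≤ ‖position p q X‖ := fun X hX => (hUd hX).2.2.2.2 (lamP X)
  have h1 : ScaledBound U 3 D 1 (fun X => position p q X - planet e' (lamP X)) :=
    ⟨(isPeriodicSmooth_separation he0 he1).contDiffOn.mono (hUc.trans hcore),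
      fun k hk X hX => by
        rw [one_pow, div_one]
        exact hD k hk X (hUc hX)⟩
  have h2 := hcb U _ (Δ / 2) hU (half_pos hΔ) (by linarith) h1 hfar
  -- The distance guaranteed for `κ = 2` is `Δ / 2`; rewriting the bound in terms of `Δ` costs `2 ^
  -- (k + 1) ≤ 16`.
  have h2' : ScaledBound U 3 (16 * c / Δ) Δ
      (fun X => ‖position p q X - planet e' (lamP X)‖⁻¹) := by
    refine ⟨h2.1, fun k hk X hX => (h2.2 k hk X hX).trans ?_⟩
    have h4 : (2 : ℝ) ^ k ≤ 2 ^ 3 := pow_le_pow_right₀ (by norm_num) hk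
    have h5 : c / (Δ / 2) / (Δ / 2) ^ k = 2 * 2 ^ k * c / Δ / Δ ^ k := by
      rw [div_pow]
      field_simp
    rw [h5]
    gcongr
    linarith
  have h3 : ScaledBound U 3 (N / Δ) Δ (regularPart p q e') := by
    refine ⟨(isPeriodicSmooth_regularPart he0 he1).contDiffOn.mono fun X hX =>
      ⟨hcore (hUc hX), norm_pos_iff.1 ((half_pos hΔt).trans_le (hr X hX))⟩, fun k hk X hX => ?_⟩
    refine (hN k hk X ⟨hUc hX, hr X hX⟩).trans ?_
    rw [div_div, ← pow_succ']
    exact le_div_self (by linarith) (by positivity) (pow_le_one₀ hΔ.le hΔ1)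
  have h4 := ((h3.sub h2' hU).const_mul hU ε).congr hU (g := HP p q e' ε)
    (fun X _ => HP_eq e' ε X)
  rw [abs_of_pos hε] at h4
  convert h4 using 1
  ring

/-- The inclination condition under a displacement `δ`: `r`, `s` are the old and new `‖y‖`, `G`,
`G'` the angular momenta, `n₁`, `n₂` the values of `1 - τ / κ`. The gain `2 * c * m` pays `(2b + 1)
δ` for `‖y‖²` and `2 (2b + 2) δ` for the angular momentum, together `(6b + 5) δ`. -/
lemma sq_norm_le_of_sq_norm_le {b δ G G' n₁ n₂ s r c m : ℝ} (hb : 1 ≤ b) (hδ : 0 ≤ δ) (hδ1 : δ ≤ 1)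
    (hs : 0 ≤ s) (hrb : r ≤ b) (hsr : s ≤ r + δ) (h : r ^ 2 ≤ 2 * n₁ * G)
    (hG : m ≤ G) (hG0 : 0 < m) (hGG : G - (2 * b + 2) * δ ≤ G') (hn : n₁ + c ≤ n₂) (hc : 0 ≤ c)
    (hn2 : n₂ ≤ 1) (hcδ : (6 * b + 5) * δ ≤ 2 * c * m) : s ^ 2 ≤ 2 * n₂ * G' := by
  have hsq : s ^ 2 ≤ r ^ 2 + (2 * b + 1) * δ := by
    have : s ^ 2 ≤ (r + δ) ^ 2 := pow_le_pow_left₀ hs hsr 2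
    nlinarith
  have hn1 : 0 ≤ n₁ := by
    by_contra hneg
    push Not at hneg
    nlinarith [sq_nonneg r]
  have e1 : n₂ * (G - (2 * b + 2) * δ) ≤ n₂ * G' := mul_le_mul_of_nonneg_left hGG (by linarith)
  have e2 : n₂ * ((2 * b + 2) * δ) ≤ 1 * ((2 * b + 2) * δ) :=
    mul_le_mul_of_nonneg_right hn2 (by positivity)
  have e3 : (n₁ + c) * G ≤ n₂ * G := mul_le_mul_of_nonneg_right hn (hG0.le.trans hG)
  have e4 : c * m ≤ c * G := mul_le_mul_of_nonneg_left hG hc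
  linarith

lemma setLamP_mem_core {X : Phase} (hX : X ∈ core p q σ τ) (l : ℝ) :
    setLamP X l ∈ core p q σ τ := hX

lemma norm_setLamP_sub_le (X Y : Phase) (l : ℝ) : ‖setLamP Y l - setLamP X l‖ ≤ ‖Y - X‖ := by
  have e : setLamP Y l - setLamP X l = ((Y - X).1, (Y - X).2.1, (Y - X).2.2.1, (Y - X).2.2.2.1, 0,
      (Y - X).2.2.2.2.2) := by
    simp [setLamP, theta, u, x, y, Xi]
  rw [e]
  generalize Y - X = Z
  simp only [Prod.norm_def, norm_zero]
  exact max_le_max le_rfl (max_le_max le_rfl (max_le_max le_rfl (max_le_max le_rfl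
    (max_le_max (norm_nonneg _) le_rfl))))

set_option maxHeartbeats 1000000 in
/-- A small displacement leads from a collisionless domain to a larger one. -/
lemma exists_thickening (hp : 0 < p) (hq : 0 < q) (hσ : 0 < σ)
    (hΔt : 0 < Δt) (hτ : 0 < τ) (e' : ℝ) :
    ∃ c : ℝ, 0 < c ∧ ∀ ρ Δ δ κ₁ κ₂ : ℝ, 0 < ρ → 0 < Δ → 2 * ρ ≤ maxAction p q σ →
      1 ≤ κ₁ → κ₁ + 1 / 12 ≤ κ₂ → κ₂ ≤ 2 → δ ≤ c → δ ≤ c * ρ → δ ≤ c * Δ →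
      ∀ X ∈ domain p q e' σ Δt τ ρ Δ κ₁, ∀ Y, ‖Y - X‖ ≤ δ →
        Y ∈ domain p q e' σ Δt τ ρ Δ κ₂ := by
  have hcore := core_subset_ellipticRegion (p := p) (q := q) hp hq hσ hτ
  obtain ⟨b, hb1, hb⟩ := exists_norm_le_of_mem_core (p := p) (q := q) (τ := τ) hp hq hσ
  obtain ⟨L, hL1, hL⟩ := (isPeriodicSmooth_position (p := p) (q := q)).exists_bound
    hp hq hσ (isClosed_core (σ := σ) (τ := τ)) hcore subset_rfl add_translation_mem_core 1
  have hLip : ∀ X ∈ core p q σ τ, ∀ Y ∈ core p q σ τ,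
      ‖position p q Y - position p q X‖ ≤ L * ‖Y - X‖ := by
    intro X hX Y hY
    refine convex_core.norm_image_sub_le_of_norm_fderiv_le (𝕜 := ℝ) (fun Z hZ => ?_)
      (fun Z hZ => ?_) hX hY
    · exact (contDiffOn_position.contDiffAt
        (isOpen_ellipticRegion.mem_nhds (hcore hZ))).differentiableAt (by simp)
    · simpa [norm_iteratedFDeriv_one] using hL 1 le_rfl Z hZ
  set A := aRes p q ^ (1 / 4 : ℝ) with hA
  have hA0 : 0 < A := by
    have := aRes_pos hp hq
    positivity
  have hu0 := maxAction_pos hp hq hσ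
  -- Apart from `1`, which makes `δ ≤ 1`, there is one threshold for each condition of the domain:
  -- `u`, `x`, `y`, the distance to the planet and the distance to the star.
  set c := min (min 1 (1 / 12)) (min (A * σ / 48) (min (τ * maxAction p q σ / 24 / (6 * b + 5))
    (min (1 / (48 * L)) (Δt / (48 * L))))) with hc
  have hc0 : 0 < c := by positivity
  have hc1 : c ≤ 1 := (min_le_left _ _).trans (min_le_left _ _)
  have hc2 : c ≤ 1 / 12 := (min_le_left _ _).trans (min_le_right _ _)
  have hc3 : c ≤ A * σ / 48 := (min_le_right _ _).trans (min_le_left _ _)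
  have hc4 : c ≤ τ * maxAction p q σ / 24 / (6 * b + 5) :=
    (min_le_right _ _).trans ((min_le_right _ _).trans (min_le_left _ _))
  have hc5 : c ≤ 1 / (48 * L) := (min_le_right _ _).trans ((min_le_right _ _).trans
    ((min_le_right _ _).trans (min_le_left _ _)))
  have hc6 : c ≤ Δt / (48 * L) := (min_le_right _ _).trans ((min_le_right _ _).trans
    ((min_le_right _ _).trans (min_le_right _ _)))
  refine ⟨c, hc0, fun ρ Δ δ κ₁ κ₂ hρ hΔ hρ2 hκ1 hκ12 hκ2 hδ hδρ hδΔ X hX Y hYX => ?_⟩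
  have hδ0 : 0 ≤ δ := (norm_nonneg _).trans hYX
  have hXc := domain_subset_core hp hq hσ hτ (by linarith) (by linarith) hρ hρ2 hX
  -- The difference `κ₂ - κ₁` is at least `1/12` and `κ₁ κ₂ ≤ 4`.
  have hgap : 1 / 48 ≤ 1 / κ₁ - 1 / κ₂ := by
    rw [div_sub_div _ _ (by linarith) (by linarith), div_le_div_iff₀ (by norm_num) (by nlinarith)]
    nlinarith
  have hgap' : ∀ s, 0 ≤ s → s / 48 ≤ s / κ₁ - s / κ₂ := fun s hs => by
    have := mul_le_mul_of_nonneg_left hgap hs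
    rw [mul_sub, mul_one_div, mul_one_div, mul_one_div] at this
    exact this
  have hdu : |u Y - u X| ≤ δ := ((norm_fst_le (Y - X).2).trans (norm_snd_le (Y - X))).trans hYX
  have hdx : ‖x Y - x X‖ ≤ δ :=
    ((norm_fst_le (Y - X).2.2).trans ((norm_snd_le (Y - X).2).trans (norm_snd_le _))).trans hYX
  have hdy : ‖y Y - y X‖ ≤ δ :=
    ((norm_fst_le (Y - X).2.2.2).trans ((norm_snd_le (Y - X).2.2).trans
      ((norm_snd_le (Y - X).2).trans (norm_snd_le _)))).trans hYX
  obtain ⟨h1, h2, h3, h4, h5⟩ := hX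
  rw [norm_xt, max_self] at h2
  have hu : |u Y| ≤ κ₂ * ρ := by
    have : |u Y| ≤ |u X| + |u Y - u X| := by
      have := abs_add_le (u X) (u Y - u X)
      rwa [add_sub_cancel] at this
    nlinarith
  have hx : ‖x Y‖ ≤ A * (1 - σ / κ₂) := by
    have h6 : ‖x Y‖ ≤ ‖x X‖ + ‖x Y - x X‖ := by
      have := norm_add_le (x X) (x Y - x X)
      rwa [add_sub_cancel] at this
    have h7 := mul_le_mul_of_nonneg_left (hgap' σ hσ.le) hA0.le
    have : A * (σ / 48) = A * σ / 48 := by ring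
    linarith
  have hy : ‖y Y‖ ^ 2 ≤ 2 * (1 - τ / κ₂) * angMom p q Y := by
    have h6 : ‖y Y‖ ≤ ‖y X‖ + ‖y Y - y X‖ := by
      have := norm_add_le (y X) (y Y - y X)
      rwa [add_sub_cancel] at this
    have h6' : ‖x Y‖ ≤ ‖x X‖ + ‖x Y - x X‖ := by
      have := norm_add_le (x X) (x Y - x X)
      rwa [add_sub_cancel] at this
    obtain ⟨hbx, hby⟩ := hb X hXc
    have hδ1 : δ ≤ 1 := hδ.trans hc1
    have hG := maxAction_le_angMom hp hq hXc.1 hXc.2.1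
    have hGY : angMom p q X - (2 * b + 2) * δ ≤ angMom p q Y := by
      have h8 : ‖x Y‖ ^ 2 ≤ ‖x X‖ ^ 2 + (2 * b + 1) * δ := by
        have h9 : ‖x Y‖ ^ 2 ≤ (‖x X‖ + δ) ^ 2 :=
          pow_le_pow_left₀ (norm_nonneg _) (h6'.trans (by linarith)) 2
        have h10 : ‖x X‖ * δ ≤ b * δ := mul_le_mul_of_nonneg_right hbx hδ0
        have h11 : δ * δ ≤ 1 * δ := mul_le_mul_of_nonneg_right hδ1 hδ0
        linarith
      unfold angMom Lam
      linarith [(abs_le.1 hdu).1]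
    have ht2 : 1 - τ / κ₁ + τ / 48 ≤ 1 - τ / κ₂ := by linarith [hgap' τ hτ.le]
    have ht3 : 1 - τ / κ₂ ≤ 1 := by
      have : 0 ≤ τ / κ₂ := div_nonneg hτ.le (by linarith)
      linarith
    have hδ4 : (6 * b + 5) * δ ≤ 2 * (τ / 48) * maxAction p q σ := by
      rw [le_div_iff₀ (by linarith)] at hc4
      have : (6 * b + 5) * δ ≤ (6 * b + 5) * c := mul_le_mul_of_nonneg_left hδ (by linarith)
      linarith
    exact sq_norm_le_of_sq_norm_le hb1 hδ0 hδ1 (norm_nonneg _) hby (by linarith) h3 hG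
      hu0 hGY ht2 (by positivity) ht3 hδ4
  -- The first three conditions place `Y` in the convex core, where the Lipschitz bound of the
  -- position becomes available for the two distance conditions.
  have hYc : Y ∈ core p q σ τ := by
    have ha : 0 ≤ A := hA0.le
    have hmono : ∀ s : ℝ, 0 < s → 1 - s / κ₂ ≤ max 0 (1 - s / 2) := fun s hs => by
      refine le_max_of_le_right ?_
      have : s / 2 ≤ s / κ₂ := div_le_div_of_nonneg_left hs.le (by linarith) hκ2
      linarith
    have hu' : |u Y| ≤ maxAction p q σ := hu.trans (by nlinarith)
    have hx' : ‖x Y‖ ≤ A * max 0 (1 - σ / 2) :=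
      hx.trans (mul_le_mul_of_nonneg_left (hmono σ hσ) ha)
    have hG := hu0.trans_le (maxAction_le_angMom hp hq hu' hx')
    refine ⟨hu', hx', hy.trans (mul_le_mul_of_nonneg_right ?_ hG.le)⟩
    linarith [hmono τ hτ]
  have hpos : ∀ l, ‖position p q (setLamP Y l) - position p q (setLamP X l)‖ ≤ L * δ := by
    intro l
    exact (hLip _ (setLamP_mem_core hXc l) _ (setLamP_mem_core hYc l)).trans
      (mul_le_mul_of_nonneg_left ((norm_setLamP_sub_le X Y l).trans hYX) (by linarith))
  refine ⟨hu, by rwa [norm_xt, max_self], hy, fun l => ?_, fun l => ?_⟩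
  · have h6 : ‖position p q (setLamP X l) - planet e' l‖ ≤
        ‖position p q (setLamP Y l) - planet e' l‖ +
          ‖position p q (setLamP Y l) - position p q (setLamP X l)‖ := by
      have := norm_sub_le (position p q (setLamP Y l) - planet e' l)
        (position p q (setLamP Y l) - position p q (setLamP X l))
      rwa [sub_sub_sub_cancel_left, ← neg_sub, norm_neg, ← norm_neg, neg_sub] at this
    have h7 : L * δ ≤ Δ / 48 := by
      rw [le_div_iff₀ (by positivity)] at hc5
      nlinarith
    linarith [h4 l, hpos l, hgap' Δ hΔ.le]
  · have h6 : ‖position p q (setLamP X l)‖ ≤ ‖position p q (setLamP Y l)‖ +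
          ‖position p q (setLamP Y l) - position p q (setLamP X l)‖ := by
      have := norm_sub_le (position p q (setLamP Y l))
        (position p q (setLamP Y l) - position p q (setLamP X l))
      rwa [sub_sub_cancel] at this
    have h7 : L * δ ≤ Δt / 48 := by
      rw [le_div_iff₀ (by positivity)] at hc6
      nlinarith
    linarith [h5 l, hpos l, hgap' Δt hΔt.le]

end Core

/-! ### Hamiltonian vector fields -/

section Hamiltonian

open Topology Metric

/-- The isomorphism of covectors with vectors defined by the symplectic form. -/
def symplecticGradient : (Phase →L[ℝ] ℝ) →L[ℝ] Phase :=
  LinearMap.toContinuousLinearMap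
    { toFun := fun α => (α (0, 1, 0, 0, 0, 0), -α (1, 0, 0, 0, 0, 0),
        -(Complex.I * ((α (0, 0, 1, 0, 0, 0) : ℂ) + Complex.I * (α (0, 0, Complex.I, 0, 0, 0) : ℂ))
          / 2),
        -(Complex.I * ((α (0, 0, 0, 1, 0, 0) : ℂ) + Complex.I * (α (0, 0, 0, Complex.I, 0, 0) : ℂ))
          / 2),
        α (0, 0, 0, 0, 0, 1), -α (0, 0, 0, 0, 1, 0))
      map_add' := fun α β => by
        simp only [add_apply, Complex.ofReal_add, Prod.mk_add_mk, Prod.mk.injEq]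
        refine ⟨trivial, ?_, ?_, ?_, trivial, ?_⟩ <;> ring
      map_smul' := fun c α => by
        simp only [smul_apply, smul_eq_mul, Complex.ofReal_mul, Prod.smul_mk,
          RingHom.id_apply, Complex.real_smul, Prod.mk.injEq]
        refine ⟨trivial, ?_, ?_, ?_, trivial, ?_⟩ <;> ring }

lemma hamVF_eq (f : Phase → ℝ) (X : Phase) : hamVF f X = symplecticGradient (fderiv ℝ f X) := rfl

lemma apply_eq (α : Phase →L[ℝ] ℝ) (w : Phase) : α w = theta w * α (1, 0, 0, 0, 0, 0) +
    u w * α (0, 1, 0, 0, 0, 0) + ((x w).re * α (0, 0, 1, 0, 0, 0) +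
    (x w).im * α (0, 0, Complex.I, 0, 0, 0)) + ((y w).re * α (0, 0, 0, 1, 0, 0) +
    (y w).im * α (0, 0, 0, Complex.I, 0, 0)) + lamP w * α (0, 0, 0, 0, 1, 0) +
    Xi w * α (0, 0, 0, 0, 0, 1) := by
  have h : w = theta w • (1, 0, 0, 0, 0, 0) + u w • (0, 1, 0, 0, 0, 0) +
      ((x w).re • (0, 0, 1, 0, 0, 0) + (x w).im • (0, 0, Complex.I, 0, 0, 0)) +
      ((y w).re • (0, 0, 0, 1, 0, 0) + (y w).im • (0, 0, 0, Complex.I, 0, 0)) +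
      lamP w • (0, 0, 0, 0, 1, 0) + Xi w • (0, 0, 0, 0, 0, 1) := by
    obtain ⟨a, b, z, z', c, d⟩ := w
    simp [theta, u, x, y, lamP, Xi, Complex.re_add_im]
  conv_lhs => rw [h]
  simp only [map_add, map_smul, smul_eq_mul]

/-- It converts the form on variational solutions into values of the Hessian of the generating
function, and it ties the signs in `hamVF` to `symplecticForm`. -/
lemma symplecticForm_symplecticGradient (α : Phase →L[ℝ] ℝ) (w : Phase) :
    symplecticForm (symplecticGradient α) w = α w := by
  rw [apply_eq α w]
  simp only [symplecticForm, xt, yt, theta, u, x, y, lamP, Xi, symplecticGradient,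
    LinearMap.coe_toContinuousLinearMap', LinearMap.coe_mk, AddHom.coe_mk]
  have h2 : (starRingEnd ℂ) 2 = 2 := Complex.conj_ofNat 2
  apply Complex.ext <;> simp [h2] <;> ring

lemma symplecticForm_antisymm (v w : Phase) : symplecticForm v w = -symplecticForm w v := by
  simp only [symplecticForm]
  push_cast
  ring

/-- The symplectic form as a bilinear map. -/
def symplecticBilin : Phase →ₗ[ℝ] Phase →ₗ[ℝ] ℂ :=
  LinearMap.mk₂ ℝ symplecticForm
    (fun v v' w => by
      simp only [symplecticForm, theta, u, x, y, xt, yt, lamP, Xi, Prod.fst_add, Prod.snd_add, map_add]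
      push_cast
      ring)
    (fun c v w => by
      simp only [symplecticForm, theta, u, x, y, xt, yt, lamP, Xi, Prod.smul_fst, Prod.smul_snd,
        smul_eq_mul, Complex.real_smul, map_mul, Complex.conj_ofReal]
      push_cast
      ring)
    (fun v w w' => by
      simp only [symplecticForm, theta, u, x, y, xt, yt, lamP, Xi, Prod.fst_add, Prod.snd_add, map_add]
      push_cast
      ring)
    (fun c v w => by
      simp only [symplecticForm, theta, u, x, y, xt, yt, lamP, Xi, Prod.smul_fst, Prod.smul_snd,
        smul_eq_mul, Complex.real_smul, map_mul, Complex.conj_ofReal]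
      push_cast
      ring)

/-- The symplectic form as a continuous bilinear map. -/
def symplecticCLM : Phase →L[ℝ] Phase →L[ℝ] ℂ :=
  LinearMap.toContinuousLinearMap (LinearMap.toContinuousLinearMap.toLinearMap ∘ₗ symplecticBilin)

lemma symplecticCLM_apply (v w : Phase) : symplecticCLM v w = symplecticForm v w := rfl

/-- The derivative of the form along two solutions is `L t v w - L t w v`, which vanishes by
symmetry of the Hessian. -/
lemma symplecticForm_eq_of_variational {L : ℝ → Phase →L[ℝ] Phase →L[ℝ] ℝ}
    (hL : ∀ t ∈ Icc (0 : ℝ) 1, ∀ a b, L t a b = L t b a) {v w : ℝ → Phase}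
    (hv : ∀ t ∈ Icc (0 : ℝ) 1,
      HasDerivWithinAt v (symplecticGradient (L t (v t))) (Icc 0 1) t)
    (hw : ∀ t ∈ Icc (0 : ℝ) 1,
      HasDerivWithinAt w (symplecticGradient (L t (w t))) (Icc 0 1) t) :
    symplecticForm (v 1) (w 1) = symplecticForm (v 0) (w 0) := by
  have hd : ∀ t ∈ Icc (0 : ℝ) 1,
      HasDerivWithinAt (fun t => symplecticCLM (v t) (w t)) 0 (Icc 0 1) t := by
    intro t ht
    have h := symplecticCLM.hasFDerivAt.comp_hasDerivWithinAt t (hv t ht) |>.clm_apply (hw t ht)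
    refine h.congr_deriv ?_
    rw [Function.comp_apply, symplecticCLM_apply, symplecticCLM_apply,
      symplecticForm_antisymm (v t), symplecticForm_symplecticGradient,
      symplecticForm_symplecticGradient, hL t ht, add_neg_cancel]
  have := norm_image_sub_le_of_norm_deriv_le_segment_01' (C := 0) hd
    (fun t _ => by simp)
  rw [norm_le_zero_iff, sub_eq_zero] at this
  exact this

end Hamiltonian

/-! ### Estimates along trajectories -/

section Trajectory

open Topology Metric

variable {E : Type} [NormedAddCommGroup E] [NormedSpace ℝ E] {V : E → E} {B : Set E}
  {γ w : ℝ → E} {ν : ℝ}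

lemma two_le_infty : minSmoothness ℝ 2 ≤ (∞ : WithTop ℕ∞) := by
  rw [minSmoothness_of_isRCLikeNormedField]
  have h (k : ℕ) : (k : WithTop ℕ∞) ≤ ∞ := by exact_mod_cast le_top
  exact h 2

/-- If `F` has the derivative `-h` along the field `V`, the derivative of `F` along a solution of
the variational equation satisfies the linearised identity. -/
lemma hasDerivWithinAt_fderiv_variational {F h : E → ℝ} (hB : IsOpen B)
    (hV : ContDiffOn ℝ ∞ V B) (hF : ContDiffOn ℝ ∞ F B) (hh : ContDiffOn ℝ ∞ h B)
    (hFV : ∀ X ∈ B, fderiv ℝ F X (V X) = -h X) {t : ℝ} (hγB : γ t ∈ B)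
    (hγ : HasDerivWithinAt γ (V (γ t)) (Icc 0 1) t)
    (hw : HasDerivWithinAt w (fderiv ℝ V (γ t) (w t)) (Icc 0 1) t) :
    HasDerivWithinAt (fun t => fderiv ℝ F (γ t) (w t)) (-fderiv ℝ h (γ t) (w t)) (Icc 0 1) t := by
  have hFat := hF.contDiffAt (hB.mem_nhds hγB)
  have hD : HasFDerivAt (fderiv ℝ F) (fderiv ℝ (fderiv ℝ F) (γ t)) (γ t) :=
    ((hFat.fderiv_right (m := ∞) (by simp)).differentiableAt (by simp)).hasFDerivAt
  have hV' : HasFDerivAt V (fderiv ℝ V (γ t)) (γ t) :=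
    ((hV.contDiffAt (hB.mem_nhds hγB)).differentiableAt (by simp)).hasFDerivAt
  have hh' : HasFDerivAt h (fderiv ℝ h (γ t)) (γ t) :=
    ((hh.contDiffAt (hB.mem_nhds hγB)).differentiableAt (by simp)).hasFDerivAt
  -- Differentiating `DF · V = -h` in the direction `w` gives `D²F(w, V) + DF(DV w) = -Dh w`. By
  -- symmetry of `D²F` the left side is the derivative of `DF(γ) w` along the flow.
  have h1 := hD.clm_apply hV'
  have h2 : (fun X => fderiv ℝ F X (V X)) =ᶠ[𝓝 (γ t)] fun X => -h X :=
    Filter.eventuallyEq_of_mem (hB.mem_nhds hγB) hFV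
  have h3 := (h1.congr_of_eventuallyEq h2.symm).unique hh'.fun_neg
  have h4 := congrArg (fun L : E →L[ℝ] ℝ => L (w t)) h3
  simp only [add_apply, ContinuousLinearMap.comp_apply, ContinuousLinearMap.flip_apply,
    neg_apply] at h4
  have hsymm : fderiv ℝ (fderiv ℝ F) (γ t) (w t) (V (γ t)) =
      fderiv ℝ (fderiv ℝ F) (γ t) (V (γ t)) (w t) :=
    (hFat.isSymmSndFDerivAt two_le_infty).eq _ _
  refine ((hD.comp_hasDerivWithinAt t hγ).clm_apply hw).congr_deriv ?_
  rw [← h4, hsymm, Function.comp_apply]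
  ring

/-- Solutions of a linear equation with a small operator stay near their initial value. -/
lemma norm_sub_le_of_linear {L : ℝ → E →L[ℝ] E} (hL : ∀ t ∈ Icc (0 : ℝ) 1, ‖L t‖ ≤ ν)
    (hν : ν ≤ 1 / 2) (hw : ∀ t ∈ Icc (0 : ℝ) 1, HasDerivWithinAt w (L t (w t)) (Icc 0 1) t) :
    ∀ t ∈ Icc (0 : ℝ) 1, ‖w t - w 0‖ ≤ 2 * ν * ‖w 0‖ ∧ ‖w t‖ ≤ 2 * ‖w 0‖ := by
  have hν0 : 0 ≤ ν := (norm_nonneg _).trans (hL 0 (by simp))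
  have hc : ContinuousOn w (Icc 0 1) := fun t ht => (hw t ht).continuousWithinAt
  -- In place of Grönwall's inequality: at its maximum, `‖w‖` is at most `‖w 0‖ + ν ‖w s‖`, and `ν ≤
  -- 1/2` absorbs the last term.
  obtain ⟨s, hs, hmax⟩ := isCompact_Icc.exists_isMaxOn (nonempty_Icc.2 zero_le_one) hc.norm
  have h1 : ∀ t ∈ Icc (0 : ℝ) 1, ‖w t - w 0‖ ≤ ν * ‖w s‖ := by
    intro t ht
    have := norm_image_sub_le_of_norm_deriv_le_segment' (C := ν * ‖w s‖) hw
      (fun r hr => ((L r).le_opNorm _).trans (mul_le_mul (hL r ⟨hr.1, hr.2.le⟩)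
        (hmax ⟨hr.1, hr.2.le⟩) (norm_nonneg _) hν0)) t ht
    refine this.trans ?_
    rw [sub_zero]
    exact mul_le_of_le_one_right (by positivity) ht.2
  have h2 : ‖w s‖ ≤ 2 * ‖w 0‖ := by
    have h3 : ‖w s‖ ≤ ‖w 0‖ + ‖w s - w 0‖ := by
      have := norm_add_le (w 0) (w s - w 0)
      rwa [add_sub_cancel] at this
    have h4 := h1 s hs
    have h5 : ν * ‖w s‖ ≤ 1 / 2 * ‖w s‖ := mul_le_mul_of_nonneg_right hν (norm_nonneg _)
    linarith
  intro t ht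
  have := mul_le_mul_of_nonneg_left h2 hν0
  exact ⟨(h1 t ht).trans (by linarith), (hmax ht).trans h2⟩

variable {g : E → ℝ} {a Δ M : ℝ} {X Y v v' : E}

lemma ScaledBound.abs_sub_le (hg : ScaledBound B 2 a Δ g) (hB : IsOpen B)
    (hball : closedBall X M ⊆ B) (hY : Y ∈ closedBall X M) : |g Y - g X| ≤ a / Δ * M := by
  have hM : 0 ≤ M := (dist_nonneg).trans hY
  have ha : 0 ≤ a / Δ := (norm_nonneg _).trans
    (hg.norm_fderiv_le one_le_two (hball (mem_closedBall_self hM)))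
  refine ((convex_closedBall X M).norm_image_sub_le_of_norm_fderiv_le (𝕜 := ℝ)
    (fun Z hZ => (hg.contDiffAt hB (hball hZ)).differentiableAt (by simp))
    (fun Z hZ => hg.norm_fderiv_le one_le_two (hball hZ)) (mem_closedBall_self hM) hY).trans
    (mul_le_mul_of_nonneg_left (by rwa [← dist_eq_norm]) ha)

/-- Moving the base point costs the second derivative times `M`; moving the vector costs the first
derivative times `ν`. -/
lemma ScaledBound.abs_fderiv_sub_le (hg : ScaledBound B 2 a Δ g) (hB : IsOpen B)
    (hball : closedBall X M ⊆ B) (hY : Y ∈ closedBall X M) (hv : ‖v' - v‖ ≤ 2 * ν * ‖v‖)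
    (hv' : ‖v'‖ ≤ 2 * ‖v‖) :
    |fderiv ℝ g Y v' - fderiv ℝ g X v| ≤ 2 * (a / Δ ^ 2 * M + a / Δ * ν) * ‖v‖ := by
  have hM : 0 ≤ M := (dist_nonneg).trans hY
  have hXB := hball (mem_closedBall_self hM)
  have ha : 0 ≤ a / Δ := (norm_nonneg _).trans (hg.norm_fderiv_le one_le_two hXB)
  have ha2 : 0 ≤ a / Δ ^ 2 := (norm_nonneg (fderiv ℝ (fderiv ℝ g) X)).trans (hg.norm_fderiv_fderiv_le le_rfl hXB)
  have h1 : ‖fderiv ℝ g Y - fderiv ℝ g X‖ ≤ a / Δ ^ 2 * M :=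
    ((convex_closedBall X M).norm_image_sub_le_of_norm_fderiv_le (𝕜 := ℝ)
      (fun Z hZ => ((hg.contDiffAt hB (hball hZ)).fderiv_right (m := ∞) (by simp)).differentiableAt
        (by simp))
      (fun Z hZ => hg.norm_fderiv_fderiv_le le_rfl (hball hZ)) (mem_closedBall_self hM) hY).trans
      (mul_le_mul_of_nonneg_left (by rwa [← dist_eq_norm]) ha2)
  have h2 : fderiv ℝ g Y v' - fderiv ℝ g X v =
      (fderiv ℝ g Y - fderiv ℝ g X) v' + fderiv ℝ g X (v' - v) := by
    rw [sub_apply, map_sub]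
    ring
  have h3 : ‖(fderiv ℝ g Y - fderiv ℝ g X) v'‖ ≤ a / Δ ^ 2 * M * (2 * ‖v‖) :=
    ((ContinuousLinearMap.le_opNorm _ _).trans
      (mul_le_mul h1 hv' (norm_nonneg _) (by positivity)))
  have h4 : ‖fderiv ℝ g X (v' - v)‖ ≤ a / Δ * (2 * ν * ‖v‖) :=
    ((ContinuousLinearMap.le_opNorm _ _).trans
      (mul_le_mul (hg.norm_fderiv_le one_le_two hXB) hv (norm_nonneg _) ha))
  rw [h2]
  refine (norm_add_le _ _).trans ((add_le_add h3 h4).trans (le_of_eq ?_))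
  ring

variable {F r f : E → ℝ} {b : ℝ}

/-- The value of a perturbed first integral `F` with derivative `-(g + r)` along the flow. -/
lemma abs_remainder_le (hB : IsOpen B) (hF : ContDiffOn ℝ ∞ F B)
    (hFV : ∀ X ∈ B, fderiv ℝ F X (V X) = -(g X + r X)) (hf : ScaledBound B 2 a Δ f)
    (hg : ScaledBound B 2 a Δ g) (hr : ∀ X ∈ B, |r X| ≤ b) (hball : closedBall (γ 0) M ⊆ B)
    (hγ : ∀ t ∈ Icc (0 : ℝ) 1, γ t ∈ closedBall (γ 0) M ∧
      HasDerivWithinAt γ (V (γ t)) (Icc 0 1) t) :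
    |F (γ 1) - F (γ 0) + g (γ 0) + (f (γ 1) - f (γ 0))| ≤ 2 * (a / Δ * M) + b := by
  -- Adding `t * g (γ 0)` removes the main term: the derivative becomes `g (γ 0) - g (γ t) - r (γ
  -- t)`.
  have h1 : ∀ t ∈ Icc (0 : ℝ) 1, HasDerivWithinAt (fun t => F (γ t) + t * g (γ 0))
      (-(g (γ t) + r (γ t)) + g (γ 0)) (Icc 0 1) t := by
    intro t ht
    have h2 : HasFDerivAt F (fderiv ℝ F (γ t)) (γ t) :=
      ((hF.contDiffAt (hB.mem_nhds (hball (hγ t ht).1))).differentiableAt (by simp)).hasFDerivAt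
    have h3 := h2.comp_hasDerivWithinAt t (hγ t ht).2
    rw [hFV _ (hball (hγ t ht).1)] at h3
    have h4 : HasDerivWithinAt (fun t : ℝ => t * g (γ 0)) (g (γ 0)) (Icc 0 1) t := by
      simpa using (hasDerivWithinAt_id t (Icc 0 1)).mul_const (g (γ 0))
    exact h3.add h4
  have h5 := norm_image_sub_le_of_norm_deriv_le_segment_01' (C := a / Δ * M + b) h1
    (fun t ht => by
      have ht' : t ∈ Icc (0 : ℝ) 1 := ⟨ht.1, ht.2.le⟩
      have h6 := abs_le.1 (hg.abs_sub_le hB hball (hγ t ht').1)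
      have h7 := abs_le.1 (hr _ (hball (hγ t ht').1))
      rw [Real.norm_eq_abs, abs_le]
      constructor <;> linarith [h6.1, h6.2, h7.1, h7.2])
  have h8 := hf.abs_sub_le hB hball (hγ 1 (by simp)).1
  rw [Real.norm_eq_abs, abs_le] at h5
  rw [abs_le] at h8 ⊢
  constructor <;> linarith [h5.1, h5.2, h8.1, h8.2]

/-- The argument of `abs_remainder_le` applied to the differential of `F` on a variational solution.
The bound on `r` is asked only for vectors close to `w 0`, so that it may single out the
`u`-component of `w 0`. -/
lemma abs_fderiv_remainder_le (hB : IsOpen B) (hV : ContDiffOn ℝ ∞ V B)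
    (hDV : ∀ X ∈ B, ‖fderiv ℝ V X‖ ≤ ν) (hν : ν ≤ 1 / 2) (hF : ContDiffOn ℝ ∞ F B)
    (hFV : ∀ X ∈ B, fderiv ℝ F X (V X) = -(g X + r X)) (hf : ScaledBound B 2 a Δ f)
    (hg : ScaledBound B 2 a Δ g) (hrs : ContDiffOn ℝ ∞ r B)
    (hball : closedBall (γ 0) M ⊆ B)
    (hr : ∀ X ∈ B, ∀ v', ‖v' - w 0‖ ≤ 2 * ν * ‖w 0‖ → ‖v'‖ ≤ 2 * ‖w 0‖ → |fderiv ℝ r X v'| ≤ b)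
    (hγ : ∀ t ∈ Icc (0 : ℝ) 1, γ t ∈ closedBall (γ 0) M ∧
      HasDerivWithinAt γ (V (γ t)) (Icc 0 1) t)
    (hw : ∀ t ∈ Icc (0 : ℝ) 1, HasDerivWithinAt w (fderiv ℝ V (γ t) (w t)) (Icc 0 1) t) :
    |fderiv ℝ F (γ 1) (w 1) - fderiv ℝ F (γ 0) (w 0) + fderiv ℝ g (γ 0) (w 0) +
      (fderiv ℝ f (γ 1) (w 1) - fderiv ℝ f (γ 0) (w 0))| ≤
      4 * (a / Δ ^ 2 * M + a / Δ * ν) * ‖w 0‖ + b := by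
  have hγB : ∀ t ∈ Icc (0 : ℝ) 1, γ t ∈ B := fun t ht => hball (hγ t ht).1
  have hwb := norm_sub_le_of_linear (fun t ht => hDV _ (hγB t ht)) hν hw
  have h1 : ∀ t ∈ Icc (0 : ℝ) 1, HasDerivWithinAt
      (fun t => fderiv ℝ F (γ t) (w t) + t * fderiv ℝ g (γ 0) (w 0))
      (-(fderiv ℝ g (γ t) (w t) + fderiv ℝ r (γ t) (w t)) + fderiv ℝ g (γ 0) (w 0))
      (Icc 0 1) t := by
    intro t ht
    have h3 := hasDerivWithinAt_fderiv_variational (h := fun X => g X + r X) hB hV hF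
      (hg.1.add hrs) hFV (hγB t ht) (hγ t ht).2 (hw t ht)
    rw [fderiv_fun_add ((hg.contDiffAt hB (hγB t ht)).differentiableAt (by simp))
      ((hrs.contDiffAt (hB.mem_nhds (hγB t ht))).differentiableAt (by simp)), add_apply] at h3
    have h4 : HasDerivWithinAt (fun t : ℝ => t * fderiv ℝ g (γ 0) (w 0))
        (fderiv ℝ g (γ 0) (w 0)) (Icc 0 1) t := by
      simpa using (hasDerivWithinAt_id t (Icc 0 1)).mul_const (fderiv ℝ g (γ 0) (w 0))
    exact h3.add h4
  have h5 := norm_image_sub_le_of_norm_deriv_le_segment_01'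
    (C := 2 * (a / Δ ^ 2 * M + a / Δ * ν) * ‖w 0‖ + b) h1 (fun t ht => by
      have ht' : t ∈ Icc (0 : ℝ) 1 := ⟨ht.1, ht.2.le⟩
      have h6 := abs_le.1 (hg.abs_fderiv_sub_le hB hball (hγ t ht').1 (hwb t ht').1 (hwb t ht').2)
      have h7 := abs_le.1 (hr _ (hγB t ht') _ (hwb t ht').1 (hwb t ht').2)
      rw [Real.norm_eq_abs, abs_le]
      constructor <;> linarith [h6.1, h6.2, h7.1, h7.2])
  have h8 := hf.abs_fderiv_sub_le hB hball (hγ 1 (by simp)).1 (hwb 1 (by simp)).1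
    (hwb 1 (by simp)).2
  rw [Real.norm_eq_abs, abs_le] at h5
  rw [abs_le] at h8 ⊢
  constructor <;> linarith [h5.1, h5.2, h8.1, h8.2]

end Trajectory

/-! ### Generating functions of averaging transformations -/

section Generator

open Topology Metric

variable {p q : ℕ} {e' ε a Δ ρ β : ℝ} {A B : Set Phase} {S : Phase → ℝ}

/-- The direction of the coordinate `θ`. -/
def dirTheta : Phase := (1, 0, 0, 0, 0, 0)

/-- The frequency of the resonant angle in the Keplerian approximation. -/
def freq (p q : ℕ) (X : Phase) : ℝ := (Lam p q X ^ 3)⁻¹ - (p : ℝ) / q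

/-- The perturbation without its mean. -/
def oscillatingPart (p q : ℕ) (e' ε : ℝ) (X : Phase) : ℝ := HP p q e' ε X - HPbar p q e' ε X

/-- The error in the homological equation for the generating function `S`. -/
def residual (p q : ℕ) (e' ε : ℝ) (S : Phase → ℝ) (X : Phase) : ℝ :=
  fderiv ℝ S X dirLamP + freq p q X * fderiv ℝ S X dirTheta - oscillatingPart p q e' ε X

/-- `S` is a periodic function that solves the homological equation approximately on `B`. -/
structure IsGenerator (p q : ℕ) (e' ε : ℝ) (B : Set Phase) (a Δ ρ β : ℝ) (S : Phase → ℝ) :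
    Prop where
  contDiffOn : ContDiffOn ℝ ∞ S B
  map_add : ∀ X ∈ B, ∀ a b z, S (X + translation p q a b z) = S X
  norm_fderiv_le : ∀ X ∈ B, ‖fderiv ℝ S X‖ ≤ a / Δ
  norm_fderiv_fderiv_le : ∀ X ∈ B, ‖fderiv ℝ (fderiv ℝ S) X‖ ≤ a / Δ ^ 2
  -- No factor `1 / Δ` in this direction: it is the source of the better bound `ε / Δ` for the
  -- displacement of `Ξ`.
  abs_fderiv_lamP_le : ∀ X ∈ B, |fderiv ℝ S X dirLamP| ≤ a
  abs_residual_le : ∀ X ∈ B, |residual p q e' ε S X| ≤ a * (ρ / Δ)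
  -- The loss in the `u`-derivative: `β = 1` for `S0`, `β = 0` after the correction.
  abs_fderiv_residual_le : ∀ X ∈ B, ∀ v,
    |fderiv ℝ (residual p q e' ε S) X v| ≤ a / Δ * (ρ / Δ * ‖v‖ + β * |u v|)

/-- The part of the Hamiltonian that is explicitly integrable. -/
def keplerHamiltonian (p q : ℕ) (X : Phase) : ℝ := Xi X + HK p q X

lemma contDiffOn_keplerHamiltonian :
    ContDiffOn ℝ ∞ (keplerHamiltonian p q) {X | 0 < Lam p q X} := by
  intro X hX
  refine (contDiff_Xi.contDiffAt.add (ContDiffAt.sub (contDiffAt_const.div (contDiffAt_const.mul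
    (contDiff_Lam.contDiffAt.pow 2)) ?_)
    (contDiffAt_const.mul contDiff_u.contDiffAt))).contDiffWithinAt
  exact mul_ne_zero two_ne_zero (pow_ne_zero 2 (ne_of_gt hX))

lemma fderiv_keplerHamiltonian {X : Phase} (hX : 0 < Lam p q X) (v : Phase) :
    fderiv ℝ (keplerHamiltonian p q) X v = Xi v + freq p q X * u v := by
  have hd : DifferentiableAt ℝ (keplerHamiltonian p q) X :=
    (contDiffOn_keplerHamiltonian.contDiffAt
      ((isOpen_lt continuous_const contDiff_Lam.continuous).mem_nhds hX)).differentiableAt (by simp)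
  have hl : HasDerivAt (fun t : ℝ => X + t • v) v 0 := by
    simpa using ((hasDerivAt_id (0 : ℝ)).smul_const v).const_add X
  have h0 : X + (0 : ℝ) • v = X := by simp
  have h1 : HasDerivAt (fun t : ℝ => keplerHamiltonian p q (X + t • v))
      (fderiv ℝ (keplerHamiltonian p q) X v) 0 := by
    have := hd.hasFDerivAt
    rw [← h0] at this
    have h2 := this.comp_hasDerivAt (0 : ℝ) hl
    rwa [h0] at h2
  have h3 : HasDerivAt (fun t : ℝ => Lam p q X + t * u v) (u v) 0 := by
    simpa using ((hasDerivAt_id (0 : ℝ)).mul_const (u v)).const_add (Lam p q X)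
  have h4 : HasDerivAt (fun t : ℝ => keplerHamiltonian p q (X + t • v))
      (Xi v + freq p q X * u v) 0 := by
    have h5 : HasDerivAt (fun t : ℝ => Xi X + t * Xi v) (Xi v) 0 := by
      simpa using ((hasDerivAt_id (0 : ℝ)).mul_const (Xi v)).const_add (Xi X)
    have h6 : HasDerivAt (fun t : ℝ => (p : ℝ) / q * (u X + t * u v)) ((p : ℝ) / q * u v) 0 := by
      simpa using (((hasDerivAt_id (0 : ℝ)).mul_const (u v)).const_add (u X)).const_mul ((p : ℝ) / q)
    have h7 := ((hasDerivAt_const (0 : ℝ) (-1 : ℝ)).fun_div ((h3.fun_pow 2).const_mul 2)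
      (by simpa using hX.ne'))
    have h8 := h5.fun_add (h7.fun_sub h6)
    refine (h8.congr_deriv ?_).congr_of_eventuallyEq (Filter.Eventually.of_forall fun t => ?_)
    · unfold freq
      have := hX.ne'
      simp only [zero_mul, add_zero]
      field_simp
      ring
    · simp only [keplerHamiltonian, HK, Xi, u, Lam, Prod.snd_add, Prod.fst_add, Prod.smul_snd,
        Prod.smul_fst, smul_eq_mul]
      ring
  exact h1.unique h4

lemma Xi_symplecticGradient (α : Phase →L[ℝ] ℝ) : Xi (symplecticGradient α) = -α dirLamP := rfl

lemma u_symplecticGradient (α : Phase →L[ℝ] ℝ) : u (symplecticGradient α) = -α dirTheta := rfl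

lemma lamP_symplecticGradient (α : Phase →L[ℝ] ℝ) : lamP (symplecticGradient α) = α dirXi := rfl

/-- The homological equation; `residual` is defined so that it holds exactly. -/
lemma fderiv_keplerHamiltonian_hamVF {X : Phase} (hX : 0 < Lam p q X) :
    fderiv ℝ (keplerHamiltonian p q) X (hamVF S X) =
      -(oscillatingPart p q e' ε X + residual p q e' ε S X) := by
  rw [fderiv_keplerHamiltonian hX, hamVF_eq, Xi_symplecticGradient, u_symplecticGradient]
  unfold residual
  ring

lemma contDiffOn_freq : ContDiffOn ℝ ∞ (freq p q) {X | 0 < Lam p q X} := fun _ hX =>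
  (((contDiff_Lam.contDiffAt.pow 3).inv (pow_ne_zero 3 (ne_of_gt hX))).sub
    contDiffAt_const).contDiffWithinAt

lemma fderiv_add_of_eqOn {F : Type} [NormedAddCommGroup F] [NormedSpace ℝ F] {f : Phase → F}
    (hB : IsOpen B) {τ : Phase} (h : ∀ X ∈ B, f (X + τ) = f X) {X : Phase} (hX : X ∈ B) :
    fderiv ℝ f (X + τ) = fderiv ℝ f X := by
  rw [← fderiv_comp_add_right]
  exact Filter.EventuallyEq.fderiv_eq (Filter.eventuallyEq_of_mem (hB.mem_nhds hX) h)

lemma norm_theta_le (X : Phase) : |theta X| ≤ ‖X‖ := norm_fst_le X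

lemma norm_u_le (X : Phase) : |u X| ≤ ‖X‖ := (norm_fst_le X.2).trans (norm_snd_le X)

lemma norm_x_le (X : Phase) : ‖x X‖ ≤ ‖X‖ :=
  (norm_fst_le X.2.2).trans ((norm_snd_le X.2).trans (norm_snd_le X))

lemma norm_y_le (X : Phase) : ‖y X‖ ≤ ‖X‖ :=
  (norm_fst_le X.2.2.2).trans ((norm_snd_le X.2.2).trans ((norm_snd_le X.2).trans (norm_snd_le X)))

lemma norm_coord_sub_le (W : Var) (X Y : Phase) : ‖coord W Y - coord W X‖ ≤ ‖Y - X‖ := by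
  cases W with
  | theta =>
    refine le_trans (le_of_eq ?_) (norm_theta_le (Y - X))
    rw [← Real.norm_eq_abs, ← Complex.norm_real]
    simp [coord, theta]
  | u =>
    refine le_trans (le_of_eq ?_) (norm_u_le (Y - X))
    rw [← Real.norm_eq_abs, ← Complex.norm_real]
    simp [coord, u]
  | xt =>
    refine le_trans (le_of_eq ?_) (norm_x_le (Y - X))
    simp only [coord, xt]
    rw [← mul_sub, ← map_sub, norm_mul, RCLike.norm_conj]
    simp [x]
  | x => exact norm_x_le (Y - X)
  | yt =>
    refine le_trans (le_of_eq ?_) (norm_y_le (Y - X))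
    simp only [coord, yt]
    rw [← mul_sub, ← map_sub, norm_mul, RCLike.norm_conj]
    simp [y]
  | y => exact norm_y_le (Y - X)

/-- A bound on the differential gives bounds on the partial derivatives. -/
lemma norm_partialD_le {f : Phase → ℝ} {X : Phase} {c d : ℝ}
    (h : ∀ v, |fderiv ℝ f X v| ≤ c * ‖v‖ + d * |u v|) {s : Var → ℝ} (hs : ∀ W, 0 ≤ s W)
    (hd : d ≤ s .u) (W : Var) : ‖partialD f X W‖ ≤ c + s W := by
  have hθ := h (1, 0, 0, 0, 0, 0)
  have hu := h (0, 1, 0, 0, 0, 0)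
  have hx := h (0, 0, 1, 0, 0, 0)
  have hx' := h (0, 0, Complex.I, 0, 0, 0)
  have hy := h (0, 0, 0, 1, 0, 0)
  have hy' := h (0, 0, 0, Complex.I, 0, 0)
  simp only [u, Prod.norm_def, norm_zero, norm_one, Complex.norm_I, abs_zero, abs_one, max_self,
    mul_zero, mul_one, add_zero, zero_le_one, max_eq_left, max_eq_right] at hθ hu hx hx' hy hy'
  have key : ∀ r s : ℝ, |r| ≤ c → |s| ≤ c → ‖((r : ℂ) + Complex.I * (s : ℂ)) / 2‖ ≤ c ∧
      ‖((r : ℂ) - Complex.I * (s : ℂ)) / 2‖ ≤ c := by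
    intro r s hr hs
    have hr' : ‖(r : ℂ)‖ ≤ c := by rwa [Complex.norm_real]
    have hs' : ‖Complex.I * (s : ℂ)‖ ≤ c := by
      rwa [norm_mul, Complex.norm_I, one_mul, Complex.norm_real]
    have h2 : ‖(2 : ℂ)‖ = 2 := by simp
    constructor <;> rw [norm_div, h2]
    · linarith [norm_add_le (r : ℂ) (Complex.I * (s : ℂ))]
    · linarith [norm_sub_le (r : ℂ) (Complex.I * (s : ℂ))]
  have hsW := hs W
  cases W with
  | theta =>
    simp only [partialD, Complex.norm_real, Real.norm_eq_abs]
    linarith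
  | u =>
    simp only [partialD, Complex.norm_real, Real.norm_eq_abs]
    linarith
  | xt =>
    simp only [partialD]
    rw [mul_div_assoc, norm_mul, Complex.norm_I, one_mul]
    linarith [(key _ _ hx hx').1]
  | x =>
    simp only [partialD]
    linarith [(key _ _ hx hx').2]
  | yt =>
    simp only [partialD]
    rw [mul_div_assoc, norm_mul, Complex.norm_I, one_mul]
    linarith [(key _ _ hy hy').1]
  | y =>
    simp only [partialD]
    linarith [(key _ _ hy hy').2]

end Generator

/-! ### The time-one map and the remainder of the transformed Hamiltonian -/

section Transformation

open Topology Metric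

variable {p q : ℕ} {e' ε a Δ ρ β ν M : ℝ} {A B : Set Phase} {S : Phase → ℝ} {Φ : Phase → Phase}

/-- The remainder of the averaged Hamiltonian after the transformation `Φ`. -/
def remainder (p q : ℕ) (e' ε : ℝ) (Φ : Phase → Phase) (X : Phase) : ℝ :=
  keplerHamiltonian p q (Φ X) - keplerHamiltonian p q X + oscillatingPart p q e' ε X +
    (HP p q e' ε (Φ X) - HP p q e' ε X)

lemma hamiltonian_comp_eq (X : Phase) : Xi (Φ X) + H p q e' ε (Φ X) =
    Xi X + Hbar p q e' ε X + remainder p q e' ε Φ X := by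
  unfold remainder keplerHamiltonian oscillatingPart H Hbar
  ring

lemma contDiffOn_residual (hB : IsOpen B) (hS : ContDiffOn ℝ ∞ S B)
    (hBL : B ⊆ {X | 0 < Lam p q X}) (hg : ContDiffOn ℝ ∞ (oscillatingPart p q e' ε) B) :
    ContDiffOn ℝ ∞ (residual p q e' ε S) B := by
  have h := hS.fderiv_of_isOpen hB (m := ∞) (by simp)
  exact ((h.clm_apply contDiffOn_const).add ((contDiffOn_freq.mono hBL).mul
    (h.clm_apply contDiffOn_const))).sub hg

/-- The properties of the time-one map of a small Hamiltonian flow with a flow domain in `B`. -/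
structure IsSmallFlow (S : Phase → ℝ) (Φ : Phase → Phase) (A B : Set Phase) (M : ℝ) : Prop where
  contDiffOn : ContDiffOn ℝ ∞ Φ A
  injOn : InjOn Φ A
  trajectory : ∀ X ∈ A, ∃ γ : ℝ → Phase, γ 0 = X ∧ γ 1 = Φ X ∧
    (∀ t ∈ Icc (0 : ℝ) 1, γ t ∈ closedBall X M ∧
      HasDerivWithinAt γ (hamVF S (γ t)) (Icc 0 1) t) ∧
    ∀ v, ∃ w : ℝ → Phase, w 0 = v ∧ w 1 = fderiv ℝ Φ X v ∧
      ∀ t ∈ Icc (0 : ℝ) 1, HasDerivWithinAt w (fderiv ℝ (hamVF S) (γ t) (w t)) (Icc 0 1) t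

lemma contDiffOn_hamVF (hB : IsOpen B) (hS : ContDiffOn ℝ ∞ S B) :
    ContDiffOn ℝ ∞ (hamVF S) B :=
  symplecticGradient.contDiff.comp_contDiffOn (hS.fderiv_of_isOpen hB (m := ∞) (by simp))

lemma fderiv_hamVF (hB : IsOpen B) (hS : ContDiffOn ℝ ∞ S B) {X : Phase} (hX : X ∈ B) :
    fderiv ℝ (hamVF S) X = symplecticGradient.comp (fderiv ℝ (fderiv ℝ S) X) := by
  have h : HasFDerivAt (fderiv ℝ S) (fderiv ℝ (fderiv ℝ S) X) X :=
    (((hS.contDiffAt (hB.mem_nhds hX)).fderiv_right (m := ∞) (by simp)).differentiableAt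
      (by simp)).hasFDerivAt
  exact (symplecticGradient.hasFDerivAt.comp X h).fderiv

/-- A bound on the symplectic gradient. -/
def gradientBound : ℝ := ‖symplecticGradient‖ + 1

lemma one_le_gradientBound : 1 ≤ gradientBound := le_add_of_nonneg_left (norm_nonneg symplecticGradient)

lemma norm_hamVF_le {X : Phase} {b : ℝ} (h : ‖fderiv ℝ S X‖ ≤ b) :
    ‖hamVF S X‖ ≤ gradientBound * b := by
  have hb := (norm_nonneg _).trans h
  refine (symplecticGradient.le_opNorm _).trans ?_
  unfold gradientBound
  gcongr
  linarith

lemma norm_fderiv_hamVF_le (hB : IsOpen B) (hS : ContDiffOn ℝ ∞ S B) {X : Phase} (hX : X ∈ B)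
    {b : ℝ} (h : ‖fderiv ℝ (fderiv ℝ S) X‖ ≤ b) :
    ‖fderiv ℝ (hamVF S) X‖ ≤ gradientBound * b := by
  have hb := (norm_nonneg (fderiv ℝ (fderiv ℝ S) X)).trans h
  rw [fderiv_hamVF hB hS hX]
  refine (ContinuousLinearMap.opNorm_comp_le _ _).trans ?_
  unfold gradientBound
  gcongr
  linarith

lemma IsSmallFlow.isSymplecticOn (h : IsSmallFlow S Φ A B M) (hB : IsOpen B)
    (hS : ContDiffOn ℝ ∞ S B) (hAB : ∀ X ∈ A, closedBall X M ⊆ B) : IsSymplecticOn Φ A := by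
  refine ⟨h.contDiffOn, h.injOn, fun X hX v w => ?_⟩
  obtain ⟨γ, -, -, hγ, hvar⟩ := h.trajectory X hX
  obtain ⟨v', hv0, hv1, hv⟩ := hvar v
  obtain ⟨w', hw0, hw1, hw⟩ := hvar w
  have hγB : ∀ t ∈ Icc (0 : ℝ) 1, γ t ∈ B := fun t ht => hAB X hX (hγ t ht).1
  rw [← hv1, ← hw1, ← hv0, ← hw0]
  refine symplecticForm_eq_of_variational (L := fun t => fderiv ℝ (fderiv ℝ S) (γ t))
    (fun t ht b c => ?_) (fun t ht => ?_) (fun t ht => ?_)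
  · exact ((hS.contDiffAt (hB.mem_nhds (hγB t ht))).isSymmSndFDerivAt two_le_infty).eq b c
  · have := hv t ht
    rwa [fderiv_hamVF hB hS (hγB t ht)] at this
  · have := hw t ht
    rwa [fderiv_hamVF hB hS (hγB t ht)] at this

lemma IsSmallFlow.norm_sub_le (h : IsSmallFlow S Φ A B M) {X : Phase} (hX : X ∈ A) :
    ‖Φ X - X‖ ≤ M := by
  obtain ⟨γ, -, h1, hγ, -⟩ := h.trajectory X hX
  rw [← h1, ← dist_eq_norm]
  exact (hγ 1 (by simp)).1

/-- The velocity of `Ξ` is `-∂S/∂λ'`. -/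
lemma IsSmallFlow.abs_Xi_sub_le (h : IsSmallFlow S Φ A B M) (hAB : ∀ X ∈ A, closedBall X M ⊆ B)
    (hS : ∀ X ∈ B, |fderiv ℝ S X dirLamP| ≤ a) {X : Phase} (hX : X ∈ A) :
    |Xi (Φ X) - Xi X| ≤ a := by
  obtain ⟨γ, h0, h1, hγ, -⟩ := h.trajectory X hX
  let L : Phase →L[ℝ] ℝ := (ContinuousLinearMap.snd ℝ ℝ ℝ).comp ((ContinuousLinearMap.snd ℝ ℂ _).comp
    ((ContinuousLinearMap.snd ℝ ℂ _).comp ((ContinuousLinearMap.snd ℝ ℝ _).comp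
      (ContinuousLinearMap.snd ℝ ℝ _))))
  have hd : ∀ t ∈ Icc (0 : ℝ) 1,
      HasDerivWithinAt (fun t => Xi (γ t)) (Xi (hamVF S (γ t))) (Icc 0 1) t := fun t ht =>
    L.hasFDerivAt.comp_hasDerivWithinAt t (hγ t ht).2
  have := norm_image_sub_le_of_norm_deriv_le_segment_01' (C := a) hd (fun t ht => by
    rw [hamVF_eq, Xi_symplecticGradient, norm_neg]
    exact hS _ (hAB X hX (hγ t ⟨ht.1, ht.2.le⟩).1))
  rwa [h0, h1] at this

lemma IsSmallFlow.lamP_eq (h : IsSmallFlow S Φ A B M) (hAB : ∀ X ∈ A, closedBall X M ⊆ B)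
    (hS : ∀ X ∈ B, fderiv ℝ S X dirXi = 0) {X : Phase} (hX : X ∈ A) : lamP (Φ X) = lamP X := by
  obtain ⟨γ, h0, h1, hγ, -⟩ := h.trajectory X hX
  let L : Phase →L[ℝ] ℝ := (ContinuousLinearMap.fst ℝ ℝ ℝ).comp ((ContinuousLinearMap.snd ℝ ℂ _).comp
    ((ContinuousLinearMap.snd ℝ ℂ _).comp ((ContinuousLinearMap.snd ℝ ℝ _).comp
      (ContinuousLinearMap.snd ℝ ℝ _))))
  have hd : ∀ t ∈ Icc (0 : ℝ) 1,
      HasDerivWithinAt (fun t => lamP (γ t)) (lamP (hamVF S (γ t))) (Icc 0 1) t := fun t ht =>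
    L.hasFDerivAt.comp_hasDerivWithinAt t (hγ t ht).2
  have := norm_image_sub_le_of_norm_deriv_le_segment_01' (C := 0) hd (fun t ht => by
    rw [hamVF_eq, lamP_symplecticGradient, hS _ (hAB X hX (hγ t ⟨ht.1, ht.2.le⟩).1), norm_zero])
  rw [h0, h1, norm_le_zero_iff, sub_eq_zero] at this
  exact this

/-- By periodicity of `S` a translated trajectory is again a trajectory, so uniqueness applies. -/
lemma IsSmallFlow.map_add (h : IsSmallFlow S Φ A B M) (hB : IsOpen B)
    (hS : ContDiffOn ℝ ∞ S B) (hDV : ∀ X ∈ B, ‖fderiv ℝ (hamVF S) X‖ ≤ 1 / 2)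
    (hAB : ∀ X ∈ A, closedBall X M ⊆ B) {τ X : Phase} (hτ : ∀ X ∈ B, S (X + τ) = S X)
    (hX : X ∈ A) (hXτ : X + τ ∈ A) : Φ (X + τ) = Φ X + τ := by
  obtain ⟨γ, h0, h1, hγ, -⟩ := h.trajectory X hX
  obtain ⟨ζ, k0, k1, hζ, -⟩ := h.trajectory _ hXτ
  have hlip := lipschitzOnWith_of_norm_fderiv_le_half hB (contDiffOn_hamVF hB hS) hDV
    (convex_closedBall (X + τ) M) (hAB _ hXτ)
  have heq : EqOn ζ (fun t => γ t + τ) (Icc 0 1) := by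
    refine trajectory_unique hlip hζ (fun t ht => ⟨?_, ?_⟩) (Or.inl ?_)
    · have := (hγ t ht).1
      rw [mem_closedBall] at this ⊢
      rwa [dist_add_right]
    · have e : hamVF S (γ t + τ) = hamVF S (γ t) := by
        rw [hamVF_eq, hamVF_eq, fderiv_add_of_eqOn hB hτ (hAB X hX (hγ t ht).1)]
      rw [e]
      exact (hγ t ht).2.add_const τ
    · simp only [k0, h0]
  have h2 : ζ 1 = γ 1 + τ := heq (by simp)
  rw [← k1, h2, h1]

lemma IsSmallFlow.contDiffOn_remainder (h : IsSmallFlow S Φ A B M)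
    (hBL : B ⊆ {X | 0 < Lam p q X}) (hΦB : MapsTo Φ A B) (hAB : A ⊆ B)
    (hHP : ContDiffOn ℝ ∞ (HP p q e' ε) B) (hg : ContDiffOn ℝ ∞ (oscillatingPart p q e' ε) B) :
    ContDiffOn ℝ ∞ (remainder p q e' ε Φ) A := by
  have hF := contDiffOn_keplerHamiltonian.mono hBL
  exact (((hF.comp h.contDiffOn hΦB).sub (hF.mono hAB)).add (hg.mono hAB)).add
    ((hHP.comp h.contDiffOn hΦB).sub (hHP.mono hAB))

lemma fderiv_remainder {X : Phase} (hF : DifferentiableAt ℝ (keplerHamiltonian p q) X)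
    (hF' : DifferentiableAt ℝ (keplerHamiltonian p q) (Φ X)) (hΦ : DifferentiableAt ℝ Φ X)
    (hg : DifferentiableAt ℝ (oscillatingPart p q e' ε) X)
    (hHP : DifferentiableAt ℝ (HP p q e' ε) X) (hHP' : DifferentiableAt ℝ (HP p q e' ε) (Φ X))
    (v : Phase) : fderiv ℝ (remainder p q e' ε Φ) X v =
      fderiv ℝ (keplerHamiltonian p q) (Φ X) (fderiv ℝ Φ X v) -
        fderiv ℝ (keplerHamiltonian p q) X v + fderiv ℝ (oscillatingPart p q e' ε) X v +
        (fderiv ℝ (HP p q e' ε) (Φ X) (fderiv ℝ Φ X v) - fderiv ℝ (HP p q e' ε) X v) := by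
  have h := (((hF'.hasFDerivAt.comp X hΦ.hasFDerivAt).sub hF.hasFDerivAt).add
    hg.hasFDerivAt).add ((hHP'.hasFDerivAt.comp X hΦ.hasFDerivAt).sub hHP.hasFDerivAt)
  have h' : HasFDerivAt (remainder p q e' ε Φ) _ X := h
  rw [h'.fderiv]
  rfl

lemma IsGenerator.exists_isSmallFlow (hS : IsGenerator p q e' ε B a Δ ρ β S) (hA : IsOpen A)
    (hB : IsOpen B) (ha : 0 < a) (hΔ : 0 < Δ) (hν : gradientBound * (a / Δ ^ 2) ≤ 1 / 2)
    (hAB : ∀ X ∈ A, closedBall X (4 * (gradientBound * (a / Δ))) ⊆ B) :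
    ∃ Φ, IsSmallFlow S Φ A B (gradientBound * (a / Δ)) := by
  have hj : 0 < gradientBound := one_pos.trans_le one_le_gradientBound
  obtain ⟨φ, hφ, hsm, hinj, hvar⟩ := exists_flow hA hB (contDiffOn_hamVF hB hS.contDiffOn)
    (M := gradientBound * (a / Δ)) (by positivity)
    (fun X hX => norm_hamVF_le (hS.norm_fderiv_le X hX))
    (fun X hX => (norm_fderiv_hamVF_le hB hS.contDiffOn hX
      (hS.norm_fderiv_fderiv_le X hX)).trans hν) hAB
  exact ⟨fun X => φ X 1, hsm, hinj, fun X hX => ⟨φ X, (hφ X hX).1, rfl, (hφ X hX).2, hvar X hX⟩⟩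

/-- The translations include arbitrary displacements of `Ξ`. This is what makes the flow preserve
`λ'`. -/
lemma IsGenerator.fderiv_dirXi (hS : IsGenerator p q e' ε B a Δ ρ β S) (hB : IsOpen B)
    {X : Phase} (hX : X ∈ B) : fderiv ℝ S X dirXi = 0 := by
  have hl : HasDerivAt (fun t : ℝ => X + t • dirXi) dirXi 0 := by
    simpa using ((hasDerivAt_id (0 : ℝ)).smul_const dirXi).const_add X
  have h0 : X + (0 : ℝ) • dirXi = X := by simp
  have h1 : HasFDerivAt S (fderiv ℝ S X) (X + (0 : ℝ) • dirXi) := by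
    rw [h0]
    exact ((hS.contDiffOn.contDiffAt (hB.mem_nhds hX)).differentiableAt (by simp)).hasFDerivAt
  have h2 := h1.comp_hasDerivAt (0 : ℝ) hl
  have h3 : (S ∘ fun t : ℝ => X + t • dirXi) = fun _ => S X := funext fun t => by
    rw [Function.comp_apply, ← translation_dirXi (p := p) (q := q)]
    exact hS.map_add X hX 0 0 t
  rw [h3] at h2
  exact h2.unique (hasDerivAt_const _ _)

/-- The bounds on the remainder of an averaging transformation. -/
lemma IsGenerator.remainder_bounds (hS : IsGenerator p q e' ε B a Δ ρ β S) (hA : IsOpen A)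
    (hB : IsOpen B) (ha : 0 < a) (hΔ : 0 < Δ) (hρ : 0 < ρ) (hβ0 : 0 ≤ β) (hβ1 : β ≤ 1)
    (hν : gradientBound * (a / Δ ^ 2) ≤ 1 / 2)
    (hAB : ∀ X ∈ A, closedBall X (gradientBound * (a / Δ)) ⊆ B)
    (hBL : B ⊆ {X | 0 < Lam p q X}) (hHP : ScaledBound B 2 a Δ (HP p q e' ε))
    (hg : ScaledBound B 2 a Δ (oscillatingPart p q e' ε))
    (hΦ : IsSmallFlow S Φ A B (gradientBound * (a / Δ))) {X : Phase} (hX : X ∈ A) :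
    |remainder p q e' ε Φ X| ≤ a * (2 * (gradientBound * (a / Δ ^ 2)) + ρ / Δ) ∧
      ∀ v, |fderiv ℝ (remainder p q e' ε Φ) X v| ≤
        a / Δ * (10 * (gradientBound * (a / Δ ^ 2)) + 2 * (ρ / Δ)) * ‖v‖ + a / Δ * β * |u v| := by
  have hj : 0 < gradientBound := one_pos.trans_le one_le_gradientBound
  set ν := gradientBound * (a / Δ ^ 2) with hνdef
  have hν0 : 0 < ν := by positivity
  have hF := contDiffOn_keplerHamiltonian.mono hBL
  have hFV : ∀ X ∈ B, fderiv ℝ (keplerHamiltonian p q) X (hamVF S X) =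
      -(oscillatingPart p q e' ε X + residual p q e' ε S X) := fun X hX =>
    fderiv_keplerHamiltonian_hamVF (hBL hX)
  obtain ⟨γ, h0, h1, hγ, hvar⟩ := hΦ.trajectory X hX
  subst h0
  have hball := hAB _ hX
  have hXB : γ 0 ∈ B := hball (mem_closedBall_self (by positivity))
  have hΦB : γ 1 ∈ B := hball (hγ 1 (by simp)).1
  constructor
  · have := abs_remainder_le hB hF hFV hHP hg hS.abs_residual_le hball hγ
    unfold remainder
    rw [← h1]
    refine this.trans (le_of_eq ?_)
    rw [hνdef]
    field_simp
  · intro v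
    obtain ⟨w, hw0, hw1, hw⟩ := hvar v
    have hd : ∀ {f : Phase → ℝ}, ContDiffOn ℝ ∞ f B → ∀ {Y}, Y ∈ B → DifferentiableAt ℝ f Y :=
      fun hf Y hY => (hf.contDiffAt (hB.mem_nhds hY)).differentiableAt (by simp)
    rw [fderiv_remainder (hd hF hXB) (by rw [← h1]; exact hd hF hΦB)
      ((hΦ.contDiffOn.contDiffAt (hA.mem_nhds hX)).differentiableAt (by simp)) (hd hg.1 hXB)
      (hd hHP.1 hXB) (by rw [← h1]; exact hd hHP.1 hΦB), ← hw1, ← h1, ← hw0]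
    -- Along the flow the `u`-component changes by at most `2 * ν * ‖w 0‖`. The loss `β` thus stays
    -- attached to `|u (w 0)|`, up to a term of the size of `ν`.
    have hr : ∀ Y ∈ B, ∀ v', ‖v' - w 0‖ ≤ 2 * ν * ‖w 0‖ → ‖v'‖ ≤ 2 * ‖w 0‖ →
        |fderiv ℝ (residual p q e' ε S) Y v'| ≤
          a / Δ * (ρ / Δ * (2 * ‖w 0‖) + β * |u (w 0)| + 2 * ν * ‖w 0‖) := by
      intro Y hY v' hv1 hv2
      refine (hS.abs_fderiv_residual_le Y hY v').trans ?_
      have h3 : |u v'| ≤ |u (w 0)| + 2 * ν * ‖w 0‖ := by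
        have h4 : |u v' - u (w 0)| ≤ 2 * ν * ‖w 0‖ := (norm_u_le (v' - w 0)).trans hv1
        have h5 := abs_add_le (u (w 0)) (u v' - u (w 0))
        rw [add_sub_cancel] at h5
        linarith
      have h6 : β * |u v'| ≤ β * |u (w 0)| + 2 * ν * ‖w 0‖ := by
        have h7 := mul_le_mul_of_nonneg_left h3 hβ0
        have h8 : β * (2 * ν * ‖w 0‖) ≤ 1 * (2 * ν * ‖w 0‖) :=
          mul_le_mul_of_nonneg_right hβ1 (by positivity)
        linarith
      have h9 : ρ / Δ * ‖v'‖ ≤ ρ / Δ * (2 * ‖w 0‖) := by gcongr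
      exact mul_le_mul_of_nonneg_left (by linarith) (by positivity)
    have := abs_fderiv_remainder_le hB (contDiffOn_hamVF hB hS.contDiffOn)
      (fun X hX => norm_fderiv_hamVF_le hB hS.contDiffOn hX (hS.norm_fderiv_fderiv_le X hX))
      hν hF hFV hHP hg (contDiffOn_residual hB hS.contDiffOn hBL hg.1) hball hr hγ hw
    refine this.trans (le_of_eq ?_)
    have e : a / Δ ^ 2 * (gradientBound * (a / Δ)) = a / Δ * ν := by
      rw [hνdef]
      ring
    rw [e]
    ring

end Transformation

/-! ### From a generator to the averaging transformation -/

section Averaging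

open Topology Metric

variable {p q : ℕ} {e' σ Δt τ : ℝ}

/-- A generator on the collisionless domain defines an averaging transformation. -/
theorem exists_isAveraging_of_isGenerator (hp : 0 < p) (hq : 0 < q) (he0 : 0 ≤ e') (he1 : e' < 1)
    (hσ : 0 < σ) (hΔt : 0 < Δt) (hτ : 0 < τ) {K : ℝ} (hK : 1 ≤ K) :
    ∃ C₀ : ℝ, 1 ≤ C₀ ∧ ∀ {C ε ρ Δ β : ℝ} {slack : Var → ℝ} {S : Phase → ℝ}, C₀ ≤ C → 0 < ε →
      0 < ρ → 0 < Δ → Δ ≤ 1 → 2 * ρ ≤ maxAction p q σ → C * ε < ρ * Δ ^ 2 → C * ε < Δ ^ 3 →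
      0 ≤ β → β ≤ 1 → (∀ W, 0 ≤ slack W) → β ≤ (ε / Δ ^ 3 + ρ / Δ) + slack .u →
      ScaledBound (interior (domain p q e' σ Δt τ ρ Δ 2)) 2 (K * ε / Δ) Δ (HP p q e' ε) →
      ScaledBound (interior (domain p q e' σ Δt τ ρ Δ 2)) 2 (K * ε / Δ) Δ
        (oscillatingPart p q e' ε) →
      IsGenerator p q e' ε (interior (domain p q e' σ Δt τ ρ Δ 2)) (K * ε / Δ) Δ ρ β S →
      ∃ (Φ : Phase → Phase) (R : Phase → ℝ),
        IsAveraging p q e' σ Δt τ ε ρ Δ C slack S Φ R := by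
  obtain ⟨c, hc, hthick⟩ := exists_thickening (p := p) (q := q) hp hq hσ hΔt hτ e'
  set j := gradientBound with hj_def
  have hj1 : 1 ≤ j := one_le_gradientBound
  -- The first summand covers the remainder: `10` and `2` come from `IsGenerator.remainder_bounds`,
  -- and one more from the slack. The second makes four times the displacement admissible in
  -- `exists_thickening`.
  refine ⟨K * (10 * (j * K) + 3) + 4 * (j * K) / c, ?_, ?_⟩
  · have h1 : 1 * 1 ≤ K * (10 * (j * K) + 3) :=
      mul_le_mul hK (by nlinarith) zero_le_one (by linarith)
    have h2 : 0 ≤ 4 * (j * K) / c := by positivity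
    linarith
  intro C ε ρ Δ β slack S hC hε hρ hΔ hΔ1 hρ2 hCρ hCΔ hβ0 hβ1 hs hβs hHP hg hS
  set B := interior (domain p q e' σ Δt τ ρ Δ 2) with hBdef
  -- Halfway between `4/3` and `3/2`, in steps of `1/12` as `exists_thickening` requires.
  set A := interior (domain p q e' σ Δt τ ρ Δ (17 / 12)) with hAdef
  have hjK : 0 < j * K := by positivity
  have hjK1 : 1 ≤ j * K := by nlinarith
  have hC1 : 4 * (j * K) / c ≤ C := by
    have : 0 ≤ K * (10 * (j * K) + 3) := by positivity
    linarith
  have hC2 : K * (10 * (j * K) + 3) ≤ C := by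
    have : 0 ≤ 4 * (j * K) / c := by positivity
    linarith
  have hC3 : 2 * (j * K) ≤ C := by nlinarith
  have hsmall : ∀ b, C * ε < b → 4 * (j * K * ε) ≤ c * b := by
    intro b hb
    have h1 := (mul_le_mul_of_nonneg_right hC1 hε.le).trans hb.le
    rw [div_mul_eq_mul_div, div_le_iff₀ hc] at h1
    linarith
  -- The displacement is of order `ε / Δ²`: the hypothesis on `ρ Δ²` compares it with `ρ`, that on
  -- `Δ³` with `Δ`.
  have hM : 4 * (j * (K * ε / Δ / Δ)) = 4 * (j * K * ε) / Δ ^ 2 := by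
    field_simp
  have hMρ : 4 * (j * (K * ε / Δ / Δ)) ≤ c * ρ := by
    rw [hM, div_le_iff₀ (by positivity)]
    linarith [hsmall _ hCρ]
  have hMΔ : 4 * (j * (K * ε / Δ / Δ)) ≤ c * Δ := by
    rw [hM, div_le_iff₀ (by positivity)]
    have := hsmall _ hCΔ
    have e : c * Δ ^ 3 = c * Δ * Δ ^ 2 := by ring
    linarith
  have hMc : 4 * (j * (K * ε / Δ / Δ)) ≤ c :=
    hMΔ.trans (mul_le_of_le_one_right hc.le hΔ1)
  have hM0 : 0 ≤ j * (K * ε / Δ / Δ) := by positivity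
  have hν : j * (K * ε / Δ / Δ ^ 2) ≤ 1 / 2 := by
    have e : j * (K * ε / Δ / Δ ^ 2) = j * K * ε / Δ ^ 3 := by
      field_simp
    rw [e, div_le_iff₀ (by positivity)]
    have := mul_le_mul_of_nonneg_right hC3 hε.le
    linarith
  have hcore : ∀ {κ}, 0 < κ → κ ≤ 2 → domain p q e' σ Δt τ ρ Δ κ ⊆ ellipticRegion p q :=
    fun hκ hκ2 => (domain_subset_core hp hq hσ hτ hκ hκ2 hρ hρ2).trans
      (core_subset_ellipticRegion hp hq hσ hτ)
  have hint : ∀ κ₁ κ₂ : ℝ, 1 ≤ κ₁ → κ₁ + 1 / 12 ≤ κ₂ → κ₂ ≤ 2 →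
      domain p q e' σ Δt τ ρ Δ κ₁ ⊆ interior (domain p q e' σ Δt τ ρ Δ κ₂) := by
    intro κ₁ κ₂ h1 h2 h3 X hX
    rw [mem_interior_iff_mem_nhds, Metric.mem_nhds_iff]
    refine ⟨min c (min (c * ρ) (c * Δ)), by positivity, fun Y hY => ?_⟩
    exact hthick ρ Δ _ κ₁ κ₂ hρ hΔ hρ2 h1 h2 h3 (min_le_left _ _)
      ((min_le_right _ _).trans (min_le_left _ _)) ((min_le_right _ _).trans (min_le_right _ _))
      X hX Y (by rw [← dist_eq_norm]; exact (mem_ball.1 hY).le)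
  have hA43 : domain p q e' σ Δt τ ρ Δ (4 / 3) ⊆ A := hint _ _ (by norm_num) (by norm_num)
    (by norm_num)
  have hB32 : domain p q e' σ Δt τ ρ Δ (3 / 2) ⊆ B := hint _ _ (by norm_num) (by norm_num) le_rfl
  have hAB4 : ∀ X ∈ A, closedBall X (4 * (j * (K * ε / Δ / Δ))) ⊆ B := by
    intro X hX Y hY
    refine hB32 (hthick ρ Δ _ (17 / 12) (3 / 2) hρ hΔ hρ2 (by norm_num) (by norm_num) (by norm_num)
      hMc hMρ hMΔ X (interior_subset hX) Y ?_)
    rw [← dist_eq_norm]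
    exact hY
  have hAB : ∀ X ∈ A, closedBall X (j * (K * ε / Δ / Δ)) ⊆ B := fun X hX =>
    (closedBall_subset_closedBall (by linarith)).trans (hAB4 X hX)
  have hBL : B ⊆ {X | 0 < Lam p q X} := fun X hX => (hcore two_pos le_rfl (interior_subset hX)).1
  have ha : 0 < K * ε / Δ := by positivity
  obtain ⟨Φ, hΦ⟩ := hS.exists_isSmallFlow isOpen_interior isOpen_interior ha hΔ hν hAB4
  have hDV : ∀ X ∈ B, ‖fderiv ℝ (hamVF S) X‖ ≤ 1 / 2 := fun X hX =>
    (norm_fderiv_hamVF_le isOpen_interior hS.contDiffOn hX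
      (hS.norm_fderiv_fderiv_le X hX)).trans hν
  have hAB' : A ⊆ B := fun X hX => hAB X hX (mem_closedBall_self hM0)
  have hΦB : MapsTo Φ A B := fun X hX => hAB X hX (by
    rw [mem_closedBall, dist_eq_norm]
    exact hΦ.norm_sub_le hX)
  have hequiv : ∀ X ∈ domain p q e' σ Δt τ ρ Δ (4 / 3), ∀ a b z,
      Φ (X + translation p q a b z) = Φ X + translation p q a b z := fun X hX a b z =>
    hΦ.map_add isOpen_interior hS.contDiffOn hDV hAB (fun Y hY => hS.map_add Y hY a b z) (hA43 hX)
      (hA43 (add_translation_mem_domain he0 he1 a b z hX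
        (hcore (by norm_num) (by norm_num) hX)))
  refine ⟨Φ, remainder p q e' ε Φ, A, B, isOpen_interior, isOpen_interior, hA43, hB32,
    hS.contDiffOn, fun X hX => ⟨?_, ?_, fun z => ?_⟩, fun X hX => ?_,
    hΦ.isSymplecticOn isOpen_interior hS.contDiffOn hAB, fun X hX => ?_,
    fun X hX => ⟨?_, ?_, ?_⟩, fun X hX => ⟨?_, fun W => ?_⟩, fun X _ => hamiltonian_comp_eq X,
    hΦ.contDiffOn_remainder hBL hΦB hAB' hHP.1 hg.1, fun X hX => ⟨?_, fun W => ?_⟩⟩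
  · rw [← translation_one_zero_zero (p := p) (q := q)]
    exact hS.map_add X (hB32 hX) _ _ _
  · rw [← translation_zero_one_zero]
    exact hS.map_add X (hB32 hX) _ _ _
  · rw [setXi_eq, ← translation_dirXi (p := p) (q := q)]
    exact hS.map_add X (hB32 hX) _ _ _
  · obtain ⟨γ, h0, h1, hγ, -⟩ := hΦ.trajectory X hX
    exact ⟨γ, h0, h1, fun t ht => ⟨hAB X hX (hγ t ht).1, (hγ t ht).2⟩⟩
  · exact hthick ρ Δ _ (4 / 3) (3 / 2) hρ hΔ hρ2 (by norm_num) (by norm_num) (by norm_num)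
      (by linarith) (by linarith) (by linarith) X hX _ (hΦ.norm_sub_le (hA43 hX))
  · rw [← translation_one_zero_zero (p := p) (q := q)]
    exact hequiv X hX _ _ _
  · rw [← translation_zero_one_zero]
    exact hequiv X hX _ _ _
  · exact hΦ.lamP_eq hAB (fun Y hY => hS.fderiv_dirXi isOpen_interior hY) (hA43 hX)
  · refine (hΦ.abs_Xi_sub_le hAB hS.abs_fderiv_lamP_le (hA43 hX)).trans ?_
    rw [mul_div_assoc]
    exact mul_le_mul_of_nonneg_right (by nlinarith) (by positivity)
  · refine (norm_coord_sub_le W X (Φ X)).trans ((hΦ.norm_sub_le (hA43 hX)).trans ?_)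
    have e : j * (K * ε / Δ / Δ) = j * K * (ε / Δ ^ 2) := by
      field_simp
    rw [e]
    exact mul_le_mul_of_nonneg_right (by linarith) (by positivity)
  all_goals
    have hR := hS.remainder_bounds isOpen_interior isOpen_interior ha hΔ hρ hβ0 hβ1 hν hAB hBL hHP
      hg hΦ (hA43 hX)
    have e1 : j * (K * ε / Δ / Δ ^ 2) = j * K * (ε / Δ ^ 3) := by
      field_simp
    rw [← hj_def, e1] at hR
    have hη1 : 0 ≤ ε / Δ ^ 3 := by positivity
    have hη2 : 0 ≤ ρ / Δ := by positivity
    have hjη := mul_nonneg hjK.le hη1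
    have hjρ := mul_nonneg hjK.le hη2
  · refine hR.1.trans ?_
    have h1 : 2 * (j * K * (ε / Δ ^ 3)) + ρ / Δ ≤
        (10 * (j * K) + 3) * (ε / Δ ^ 3 + ρ / Δ) := by linarith
    calc K * ε / Δ * (2 * (j * K * (ε / Δ ^ 3)) + ρ / Δ)
        ≤ K * ε / Δ * ((10 * (j * K) + 3) * (ε / Δ ^ 3 + ρ / Δ)) :=
          mul_le_mul_of_nonneg_left h1 ha.le
      _ = K * (10 * (j * K) + 3) * (ε / Δ * (ε / Δ ^ 3 + ρ / Δ)) := by ring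
      _ ≤ _ := mul_le_mul_of_nonneg_right hC2 (by positivity)
  · have hb : 0 ≤ K * ε / Δ / Δ := by positivity
    have hη0 : 0 ≤ ε / Δ ^ 3 + ρ / Δ := by positivity
    refine (norm_partialD_le hR.2 (s := fun W => K * ε / Δ / Δ * (ε / Δ ^ 3 + ρ / Δ + slack W))
      (fun W => mul_nonneg hb (add_nonneg hη0 (hs W)))
      (mul_le_mul_of_nonneg_left hβs hb) W).trans ?_
    have hsW := mul_nonneg hjK.le (hs W)
    have h1 : 10 * (j * K * (ε / Δ ^ 3)) + 2 * (ρ / Δ) + (ε / Δ ^ 3 + ρ / Δ + slack W) ≤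
        (10 * (j * K) + 3) * (ε / Δ ^ 3 + ρ / Δ + slack W) := by linarith [hs W]
    calc _ = K * ε / Δ / Δ * (10 * (j * K * (ε / Δ ^ 3)) + 2 * (ρ / Δ) +
          (ε / Δ ^ 3 + ρ / Δ + slack W)) := by ring
      _ ≤ K * ε / Δ / Δ * ((10 * (j * K) + 3) * (ε / Δ ^ 3 + ρ / Δ + slack W)) :=
          mul_le_mul_of_nonneg_left h1 hb
      _ = K * (10 * (j * K) + 3) * (ε / Δ ^ 2 * (ε / Δ ^ 3 + ρ / Δ + slack W)) := by
          field_simp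
      _ ≤ _ := mul_le_mul_of_nonneg_right hC2
          (mul_nonneg (by positivity) (add_nonneg hη0 (hs W)))

end Averaging

/-! ### Primitives of the oscillating part of the perturbation -/

section Primitive

open Topology Metric

variable {p q : ℕ} {e' ε σ Δt τ ρ Δ a : ℝ} {U : Set Phase} {X : Phase}

/-- Open sets of elliptic motions that are invariant under the translations and under the motion of
the planet. -/
structure IsInvariantDomain (p q : ℕ) (U : Set Phase) : Prop where
  isOpen : IsOpen U
  add_smul_mem : ∀ X ∈ U, ∀ s : ℝ, X + s • dirLamP ∈ U
  add_translation_mem : ∀ X ∈ U, ∀ a b z, X + translation p q a b z ∈ U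
  subset_ellipticRegion : U ⊆ ellipticRegion p q

lemma add_mem_interior {D : Set Phase} {v : Phase} (hD : ∀ X ∈ D, X + v ∈ D)
    (hX : X ∈ interior D) : X + v ∈ interior D := by
  have h : (fun Y => Y + v) '' interior D ⊆ D := by
    rintro _ ⟨Y, hY, rfl⟩
    exact hD Y (interior_subset hY)
  exact interior_maximal h ((Homeomorph.addRight v).isOpenMap _ isOpen_interior)
    (mem_image_of_mem _ hX)

lemma isInvariantDomain_interior_domain (he0 : 0 ≤ e') (he1 : e' < 1)
    (hsub : domain p q e' σ Δt τ ρ Δ 2 ⊆ ellipticRegion p q) :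
    IsInvariantDomain p q (interior (domain p q e' σ Δt τ ρ Δ 2)) where
  isOpen := isOpen_interior
  add_smul_mem := fun _ hX s => add_mem_interior (fun _ hY => add_smul_dirLamP_mem_domain s hY) hX
  add_translation_mem := fun _ hX a b z => add_mem_interior
    (fun _ hY => add_translation_mem_domain he0 he1 a b z hY (hsub hY)) hX
  subset_ellipticRegion := interior_subset.trans hsub

lemma HP_add_translation (he0 : 0 ≤ e') (he1 : e' < 1) (hX : X ∈ ellipticRegion p q) (a b : ℤ)
    (z : ℝ) : HP p q e' ε (X + translation p q a b z) = HP p q e' ε X := by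
  unfold HP
  rw [position_add_translation a b z hX, lamP_add_translation, planet_add_int_mul_two_pi he0 he1]

/-- The common period in `λ'` of the two motions. -/
def period (q : ℕ) : ℝ := 2 * Real.pi * q

lemma period_pos (hq : 0 < q) : 0 < period q := by
  have : (0 : ℝ) < q := by exact_mod_cast hq
  have := Real.pi_pos
  unfold period
  positivity

lemma setLamP_add_smul (s l : ℝ) : setLamP (X + s • dirLamP) l = setLamP X l := by
  simp [setLamP, theta, u, x, y, Xi, dirLamP]

lemma HPbar_add_smul (s : ℝ) : HPbar p q e' ε (X + s • dirLamP) = HPbar p q e' ε X := by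
  unfold HPbar
  simp only [setLamP_add_smul]

/-- The mean is moved from the interval starting at `0` to the one starting at `λ'` by periodicity.
In this form the smoothness and bounds of weighted averages apply. -/
lemma HPbar_eq_weightedAverage (hq : 0 < q) (he0 : 0 ≤ e') (he1 : e' < 1)
    (hX : X ∈ ellipticRegion p q) : HPbar p q e' ε X =
      weightedAverage (period q) (fun _ => 1 / period q) dirLamP (HP p q e' ε) X := by
  have hper : Function.Periodic (fun l => HP p q e' ε (setLamP X l)) (period q) := by
    intro l
    have h : setLamP X (l + period q) = setLamP X l + translation p q p q 0 := by
      rw [translation_period hq, setLamP_eq, setLamP_eq, add_assoc, ← add_smul]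
      congr 2
      unfold period
      ring
    simp only [h]
    have hl : setLamP X l ∈ ellipticRegion p q := (mem_ellipticRegion_congr rfl rfl rfl).2 hX
    exact HP_add_translation he0 he1 hl _ _ _
  have h1 := hper.intervalIntegral_add_eq 0 (lamP X)
  rw [zero_add] at h1
  have h2 := intervalIntegral.integral_comp_add_left (a := 0) (b := period q)
    (fun l => HP p q e' ε (setLamP X l)) (lamP X)
  rw [add_zero] at h2
  unfold HPbar weightedAverage
  simp only [smul_eq_mul]
  rw [intervalIntegral.integral_const_mul]
  unfold period at *
  rw [h1, ← h2]
  simp only [setLamP_add_eq]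

lemma weightedAverage_add {T : ℝ} {φ : ℝ → ℝ} {f : Phase → ℝ} {v : Phase}
    (hU : IsInvariantDomain p q U) (hf : ∀ Y ∈ U, f (Y + v) = f Y) (hX : X ∈ U) :
    weightedAverage T φ dirLamP f (X + v) = weightedAverage T φ dirLamP f X := by
  unfold weightedAverage
  congr 1
  funext s
  rw [add_right_comm, hf _ (hU.add_smul_mem X hX s)]

lemma oscillatingPart_add_translation (hq : 0 < q) (he0 : 0 ≤ e') (he1 : e' < 1)
    (hU : IsInvariantDomain p q U) (hX : X ∈ U) (a b : ℤ) (z : ℝ) :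
    oscillatingPart p q e' ε (X + translation p q a b z) = oscillatingPart p q e' ε X := by
  unfold oscillatingPart
  rw [HP_add_translation he0 he1 (hU.subset_ellipticRegion hX), HPbar_eq_weightedAverage hq he0 he1
    (hU.subset_ellipticRegion (hU.add_translation_mem X hX a b z)), HPbar_eq_weightedAverage hq he0
    he1 (hU.subset_ellipticRegion hX), weightedAverage_add hU
    (fun Y hY => HP_add_translation he0 he1 (hU.subset_ellipticRegion hY) a b z) hX]

lemma oscillatingPart_add_period (hq : 0 < q) (he0 : 0 ≤ e') (he1 : e' < 1)
    (hU : IsInvariantDomain p q U) (hX : X ∈ U) :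
    oscillatingPart p q e' ε (X + period q • dirLamP) = oscillatingPart p q e' ε X := by
  unfold period
  rw [← translation_period hq]
  exact oscillatingPart_add_translation hq he0 he1 hU hX _ _ _

/-- The vanishing mean disposes of the integrals of constant weights left by integrations by parts.
-/
lemma weightedAverage_const_oscillatingPart (hq : 0 < q) (he0 : 0 ≤ e') (he1 : e' < 1)
    (hU : IsInvariantDomain p q U) (hHP : ContDiffOn ℝ ∞ (HP p q e' ε) U) (hX : X ∈ U) (c : ℝ) :
    weightedAverage (period q) (fun _ => c) dirLamP (oscillatingPart p q e' ε) X = 0 := by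
  have hT := (period_pos hq).ne'
  have h1 := HPbar_eq_weightedAverage (ε := ε) hq he0 he1 (hU.subset_ellipticRegion hX)
  have hcont : Continuous fun s : ℝ => HP p q e' ε (X + s • dirLamP) :=
    hHP.continuousOn.comp_continuous (by fun_prop) (hU.add_smul_mem X hX)
  unfold weightedAverage at h1 ⊢
  unfold oscillatingPart
  simp only [smul_eq_mul, HPbar_add_smul] at h1 ⊢
  rw [intervalIntegral.integral_const_mul] at h1 ⊢
  rw [intervalIntegral.integral_sub (hcont.intervalIntegrable _ _)
    (continuous_const.intervalIntegrable _ _), intervalIntegral.integral_const, h1]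
  simp only [sub_zero, smul_eq_mul]
  field_simp
  ring

lemma scaledBound_oscillatingPart (hq : 0 < q) (he0 : 0 ≤ e') (he1 : e' < 1)
    (hU : IsInvariantDomain p q U) {n : ℕ} (hHP : ScaledBound U n a Δ (HP p q e' ε)) :
    ScaledBound U n (2 * a) Δ (oscillatingPart p q e' ε) := by
  have hT := period_pos hq
  have h1 := hHP.weightedAverage hU.isOpen (e := dirLamP) (φ := fun _ => 1 / period q)
    (T := period q) (c := 1 / period q) hU.add_smul_mem continuous_const hT.le (by positivity)
    (fun s _ => by rw [abs_of_pos (by positivity)])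
  have h2 := h1.congr hU.isOpen (g := HPbar p q e' ε) (fun X hX =>
    HPbar_eq_weightedAverage hq he0 he1 (hU.subset_ellipticRegion hX))
  rw [mul_one_div_cancel hT.ne', one_mul] at h2
  rw [two_mul]
  exact hHP.sub h2 hU.isOpen

lemma S0_eq_weightedAverage : S0 p q e' ε X =
    weightedAverage (period q) (fun s => s / period q) dirLamP (oscillatingPart p q e' ε) X := by
  unfold S0 weightedAverage oscillatingPart
  rw [← intervalIntegral.integral_const_mul]
  refine intervalIntegral.integral_congr fun s _ => ?_
  simp only [setLamP_add_eq, HPbar_add_smul, smul_eq_mul]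
  unfold period
  ring

lemma S0_add_translation (hq : 0 < q) (he0 : 0 ≤ e') (he1 : e' < 1)
    (hU : IsInvariantDomain p q U) (hX : X ∈ U) (a b : ℤ) (z : ℝ) :
    S0 p q e' ε (X + translation p q a b z) = S0 p q e' ε X := by
  rw [S0_eq_weightedAverage, S0_eq_weightedAverage]
  exact weightedAverage_add hU
    (fun Y hY => oscillatingPart_add_translation hq he0 he1 hU hY a b z) hX

lemma scaledBound_S0 (hq : 0 < q) (hU : IsInvariantDomain p q U) {n : ℕ}
    (hg : ScaledBound U n a Δ (oscillatingPart p q e' ε)) :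
    ScaledBound U n (period q * a) Δ (S0 p q e' ε) := by
  have hT := period_pos hq
  have h1 := hg.weightedAverage hU.isOpen (e := dirLamP) (φ := fun s => s / period q)
    (T := period q) (c := 1) hU.add_smul_mem (by fun_prop) hT.le zero_le_one
    (fun s hs => by
      rw [abs_of_nonneg (div_nonneg hs.1 hT.le)]
      exact div_le_one_of_le₀ hs.2 hT.le)
  rw [mul_one] at h1
  exact h1.congr hU.isOpen fun X _ => S0_eq_weightedAverage

/-- `S0` is a primitive of the oscillating part of the perturbation. -/
lemma fderiv_S0_dirLamP (hq : 0 < q) (he0 : 0 ≤ e') (he1 : e' < 1)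
    (hU : IsInvariantDomain p q U) (hHP : ContDiffOn ℝ ∞ (HP p q e' ε) U)
    (hg : ContDiffOn ℝ ∞ (oscillatingPart p q e' ε) U) (hX : X ∈ U) :
    fderiv ℝ (S0 p q e' ε) X dirLamP = oscillatingPart p q e' ε X := by
  have hT := (period_pos hq).ne'
  have h : S0 p q e' ε = weightedAverage (period q) (fun s => s / period q) dirLamP
      (oscillatingPart p q e' ε) := funext fun X => S0_eq_weightedAverage
  -- The weight `s / T` rises from `0` to `1`: by periodicity the boundary term is the oscillating
  -- part itself, and the remaining integral is its mean, which vanishes.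
  rw [h, fderiv_weightedAverage_apply_self hU.isOpen hU.add_smul_mem
    (φ := fun s => s / period q) (φ' := fun _ => 1 / period q) (fun s => (hasDerivAt_id s).div_const _) continuous_const hg hX,
    weightedAverage_const_oscillatingPart hq he0 he1 hU hHP hX,
    oscillatingPart_add_period hq he0 he1 hU hX, div_self hT]
  ring

/-- A primitive of `S0`. -/
def secondPrimitive (p q : ℕ) (e' ε : ℝ) : Phase → ℝ :=
  weightedAverage (period q) (fun s => s * (period q - s) / (2 * period q)) dirLamP
    (oscillatingPart p q e' ε)

lemma scaledBound_secondPrimitive (hq : 0 < q) (hU : IsInvariantDomain p q U) {n : ℕ}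
    (hg : ScaledBound U n a Δ (oscillatingPart p q e' ε)) :
    ScaledBound U n (period q * period q * a) Δ (secondPrimitive p q e' ε) := by
  have hT := period_pos hq
  refine hg.weightedAverage hU.isOpen hU.add_smul_mem (by fun_prop) hT.le hT.le (fun s hs => ?_)
  rw [abs_of_nonneg (div_nonneg (mul_nonneg hs.1 (sub_nonneg.2 hs.2)) (by positivity)),
    div_le_iff₀ (by positivity)]
  nlinarith [hs.1, hs.2]

/-- The weight `s (T - s) / (2T)` vanishes at both ends and has derivative `1/2 - s/T`. The constant
`1/2` contributes nothing against a function of zero mean. -/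
lemma fderiv_secondPrimitive_dirLamP (hq : 0 < q) (he0 : 0 ≤ e') (he1 : e' < 1)
    (hU : IsInvariantDomain p q U) (hHP : ContDiffOn ℝ ∞ (HP p q e' ε) U)
    (hg : ContDiffOn ℝ ∞ (oscillatingPart p q e' ε) U) (hX : X ∈ U) :
    fderiv ℝ (secondPrimitive p q e' ε) X dirLamP = S0 p q e' ε X := by
  have hT := (period_pos hq).ne'
  have hφ : ∀ s, HasDerivAt (fun s => s * (period q - s) / (2 * period q))
      (1 / 2 - s / period q) s := fun s => by
    have h := ((hasDerivAt_id s).mul ((hasDerivAt_id s).const_sub (period q))).div_const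
      (2 * period q)
    refine h.congr_deriv ?_
    simp only [id]
    field_simp
    ring
  have hcont : Continuous fun s : ℝ => oscillatingPart p q e' ε (X + s • dirLamP) :=
    hg.continuousOn.comp_continuous (by fun_prop) (hU.add_smul_mem X hX)
  have h0 := weightedAverage_const_oscillatingPart hq he0 he1 hU hHP hX (1 / 2)
  have h1 : weightedAverage (period q) (fun s => 1 / 2 - s / period q) dirLamP
      (oscillatingPart p q e' ε) X = -S0 p q e' ε X := by
    rw [S0_eq_weightedAverage, ← zero_sub, ← h0]
    unfold weightedAverage
    simp only [smul_eq_mul, sub_mul]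
    exact intervalIntegral.integral_sub ((continuous_const.mul hcont).intervalIntegrable _ _)
      (((continuous_id.div_const _).mul hcont).intervalIntegrable _ _)
  unfold secondPrimitive
  rw [fderiv_weightedAverage_apply_self hU.isOpen hU.add_smul_mem hφ (by fun_prop) hg hX, h1]
  simp

lemma secondPrimitive_add_translation (hq : 0 < q) (he0 : 0 ≤ e') (he1 : e' < 1)
    (hU : IsInvariantDomain p q U) (hX : X ∈ U) (a b : ℤ) (z : ℝ) :
    secondPrimitive p q e' ε (X + translation p q a b z) = secondPrimitive p q e' ε X :=
  weightedAverage_add hU (fun _ hY => oscillatingPart_add_translation hq he0 he1 hU hY a b z) hX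

end Primitive

/-! ### The generating functions -/

section Generators

open Topology Metric

variable {p q : ℕ} {e' ε σ τ ρ Δ a c : ℝ} {U : Set Phase} {X : Phase}

lemma isPeriodicSmooth_freq : IsPeriodicSmooth p q (ellipticRegion p q) (freq p q) where
  isOpen := isOpen_ellipticRegion
  contDiffOn := contDiffOn_freq.mono fun _ hX => hX.1
  mem_iff := fun _ a b z => add_translation_mem_ellipticRegion a b z
  map_add := fun X _ a b z => by
    unfold freq Lam
    rw [u_add_translation]

lemma freq_congr {Y : Phase} (h : u X = u Y) : freq p q X = freq p q Y := by
  unfold freq Lam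
  rw [h]

/-- Exact resonance: at `u = 0`, `Λ³ = ã^(3/2) = q/p`. -/
lemma freq_zero (hp : 0 < p) (hq : 0 < q) : freq p q 0 = 0 := by
  have hp' : (0 : ℝ) < p := by exact_mod_cast hp
  have hq' : (0 : ℝ) < q := by exact_mod_cast hq
  have h : Lam p q 0 ^ 3 = (q : ℝ) / p := by
    have : u 0 = 0 := rfl
    unfold Lam aRes
    rw [this, add_zero, Real.sqrt_eq_rpow, ← Real.rpow_mul (by positivity), ← Real.rpow_natCast,
      ← Real.rpow_mul (by positivity)]
    norm_num
  unfold freq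
  rw [h, inv_div, sub_self]

/-- The part of a vector along the coordinate `u`. -/
def projU : Phase →L[ℝ] Phase :=
  ((ContinuousLinearMap.fst ℝ ℝ _).comp (ContinuousLinearMap.snd ℝ ℝ _)).smulRight
    ((0, 1, 0, 0, 0, 0) : Phase)

lemma projU_apply (X : Phase) : projU X = (0, u X, 0, 0, 0, 0) := by
  simp [projU, u]

lemma u_projU (X : Phase) : u (projU X) = u X := by
  rw [projU_apply]
  rfl

lemma norm_projU (X : Phase) : ‖projU X‖ = |u X| := by
  rw [projU_apply]
  simp [Prod.norm_def]

lemma projU_mem_core (hp : 0 < p) (hq : 0 < q) (hσ : 0 < σ) (hX : X ∈ core p q σ τ) :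
    projU X ∈ core p q σ τ := by
  have hx : x (projU X) = 0 := by
    rw [projU_apply]
    rfl
  have hy : y (projU X) = 0 := by
    rw [projU_apply]
    rfl
  have hu : |u (projU X)| ≤ maxAction p q σ := by
    rw [u_projU]
    exact hX.1
  have hx' : ‖x (projU X)‖ ≤ aRes p q ^ (1 / 4 : ℝ) * max 0 (1 - σ / 2) := by
    rw [hx, norm_zero]
    have := aRes_pos hp hq
    positivity
  have hG := (maxAction_pos hp hq hσ).trans_le (maxAction_le_angMom hp hq hu hx')
  refine ⟨hu, hx', ?_⟩
  rw [hy, norm_zero, zero_pow two_ne_zero]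
  have : 0 ≤ max 0 (1 - τ / 2) := le_max_left _ _
  have := hG.le
  positivity

lemma zero_mem_core (hp : 0 < p) (hq : 0 < q) (hσ : 0 < σ) : (0 : Phase) ∈ core p q σ τ := by
  have hu : |u (0 : Phase)| ≤ maxAction p q σ := by
    have := (maxAction_pos hp hq hσ).le
    simpa [u] using this
  have hx : ‖x (0 : Phase)‖ ≤ aRes p q ^ (1 / 4 : ℝ) * max 0 (1 - σ / 2) := by
    have h0 : x (0 : Phase) = 0 := rfl
    rw [h0, norm_zero]
    have := aRes_pos hp hq
    positivity
  refine ⟨hu, hx, ?_⟩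
  have hG := (maxAction_pos hp hq hσ).le.trans (maxAction_le_angMom hp hq hu hx)
  have h0 : y (0 : Phase) = 0 := rfl
  rw [h0, norm_zero, zero_pow two_ne_zero]
  have : 0 ≤ max 0 (1 - τ / 2) := le_max_left _ _
  positivity

/-- Bounds on the frequency and on its derivatives. -/
lemma exists_freq_bound (hp : 0 < p) (hq : 0 < q) (hσ : 0 < σ) (hτ : 0 < τ) :
    ∃ c : ℝ, 1 ≤ c ∧ ∀ X ∈ core p q σ τ, (∀ k ≤ 2, ‖iteratedFDeriv ℝ k (freq p q) X‖ ≤ c) ∧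
      |freq p q X| ≤ c * |u X| ∧ ∀ v, |fderiv ℝ (freq p q) X v| ≤ c * |u v| := by
  have hcore := core_subset_ellipticRegion (p := p) (q := q) hp hq hσ hτ
  obtain ⟨c, hc1, hc⟩ := (isPeriodicSmooth_freq (p := p) (q := q)).exists_bound hp hq hσ
    (isClosed_core (σ := σ) (τ := τ)) hcore subset_rfl add_translation_mem_core 2
  have hd : ∀ Z ∈ core p q σ τ, DifferentiableAt ℝ (freq p q) Z := fun Z hZ =>
    (isPeriodicSmooth_freq.contDiffOn.contDiffAt
      (isOpen_ellipticRegion.mem_nhds (hcore hZ))).differentiableAt (by simp)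
  have hD : ∀ Z ∈ core p q σ τ, ‖fderiv ℝ (freq p q) Z‖ ≤ c := fun Z hZ => by
    simpa [norm_iteratedFDeriv_one] using hc 1 one_le_two Z hZ
  refine ⟨c, hc1, fun X hX => ⟨fun k hk => hc k hk X hX, ?_, fun v => ?_⟩⟩
  -- The frequency depends on `u` only, so `X` may be replaced by its projection to the `u`-axis, at
  -- distance `|u X|` from the origin, where the frequency vanishes.
  · have h1 := convex_core.norm_image_sub_le_of_norm_fderiv_le (𝕜 := ℝ) hd hD
      (zero_mem_core hp hq hσ) (projU_mem_core hp hq hσ hX)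
    rwa [freq_zero hp hq, sub_zero, sub_zero, norm_projU,
      freq_congr (X := projU X) (Y := X) (u_projU X), Real.norm_eq_abs] at h1
  · have h1 : (freq p q) ∘ projU = freq p q := funext fun Z => freq_congr (u_projU Z)
    have h2 := ((hd _ (projU_mem_core hp hq hσ hX)).hasFDerivAt.comp X
      projU.hasFDerivAt).fderiv
    rw [h1] at h2
    rw [h2, ContinuousLinearMap.comp_apply, ← norm_projU]
    exact ContinuousLinearMap.le_of_opNorm_le _ (hD _ (projU_mem_core hp hq hσ hX)) _

/-- The smallness of the frequency and the direction of its gradient are recorded separately. The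
term `c * |u v| * b`, which carries no factor `ρ` of its own, is the origin of the loss in the
`u`-derivative. -/
lemma freq_mul_bounds {f : Phase → ℝ} {b b' : ℝ} (hω : DifferentiableAt ℝ (freq p q) X)
    (hf : DifferentiableAt ℝ f X) (hω1 : |freq p q X| ≤ c * ρ)
    (hω2 : ∀ v, |fderiv ℝ (freq p q) X v| ≤ c * |u v|) (hf1 : |f X| ≤ b)
    (hf2 : ‖fderiv ℝ f X‖ ≤ b') : |freq p q X * f X| ≤ c * ρ * b ∧
      ∀ v, |fderiv ℝ (fun Y => freq p q Y * f Y) X v| ≤ c * ρ * (b' * ‖v‖) + c * |u v| * b := by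
  have hcρ := (abs_nonneg _).trans hω1
  constructor
  · rw [abs_mul]
    exact mul_le_mul hω1 hf1 (abs_nonneg _) hcρ
  · intro v
    rw [fderiv_fun_mul hω hf, add_apply, smul_apply, smul_apply, smul_eq_mul, smul_eq_mul]
    refine (abs_add_le _ _).trans (add_le_add ?_ ?_)
    · rw [abs_mul]
      exact mul_le_mul hω1 (ContinuousLinearMap.le_of_opNorm_le _ hf2 v) (abs_nonneg _) hcρ
    · rw [abs_mul, mul_comm]
      exact mul_le_mul (hω2 v) hf1 (abs_nonneg _) ((abs_nonneg _).trans (hω2 v))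

lemma norm_dirTheta : ‖dirTheta‖ = 1 := by simp [dirTheta, Prod.norm_def]

lemma u_dirTheta : u dirTheta = 0 := rfl

lemma u_dirLamP : u dirLamP = 0 := rfl

/-- The zero-mean primitive of the perturbation is a generator. -/
lemma isGenerator_S0 (hq : 0 < q) (he0 : 0 ≤ e') (he1 : e' < 1) (hU : IsInvariantDomain p q U)
    (hΔ : 0 < Δ) (hρ : 0 < ρ) (ha : 0 < a) (hc : 1 ≤ c)
    (hω1 : ∀ X ∈ U, |freq p q X| ≤ c * ρ)
    (hω2 : ∀ X ∈ U, ∀ v, |fderiv ℝ (freq p q) X v| ≤ c * |u v|)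
    (hHP : ContDiffOn ℝ ∞ (HP p q e' ε) U)
    (hg : ScaledBound U 3 a Δ (oscillatingPart p q e' ε)) {a' : ℝ} (ha1 : a ≤ a')
    (ha2 : c * (period q * a) ≤ a') : IsGenerator p q e' ε U a' Δ ρ 1 (S0 p q e' ε) := by
  have hT := period_pos hq
  have hS := scaledBound_S0 hq hU hg
  have hTa : period q * a ≤ a' := le_trans (le_mul_of_one_le_left (by positivity) hc) ha2
  have hf := hS.fderiv_apply hU.isOpen dirTheta
  rw [norm_dirTheta, one_mul] at hf
  have hprim := fun X (hX : X ∈ U) => fderiv_S0_dirLamP hq he0 he1 hU hHP hg.1 hX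
  -- The λ'-derivative of `S0` cancels the oscillating part exactly.
  have hres : EqOn (residual p q e' ε (S0 p q e' ε))
      (fun X => freq p q X * fderiv ℝ (S0 p q e' ε) X dirTheta) U := fun X hX => by
    unfold residual
    rw [hprim X hX]
    ring
  have hbounds : ∀ X ∈ U, _ := fun X hX => freq_mul_bounds (c := c) (ρ := ρ)
    ((isPeriodicSmooth_freq.contDiffOn.contDiffAt
      (isOpen_ellipticRegion.mem_nhds (hU.subset_ellipticRegion hX))).differentiableAt (by simp))
    ((hf.contDiffAt hU.isOpen hX).differentiableAt (by simp)) (hω1 X hX) (hω2 X hX)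
    (hf.norm_le hX) (hf.norm_fderiv_le one_le_two hX)
  refine ⟨hS.1, fun X hX a b z => S0_add_translation hq he0 he1 hU hX a b z, fun X hX => ?_,
    fun X hX => ?_, fun X hX => ?_, fun X hX => ?_, fun X hX v => ?_⟩
  · exact (hS.norm_fderiv_le (by norm_num) hX).trans (by gcongr)
  · exact (hS.norm_fderiv_fderiv_le (by norm_num) hX).trans (by gcongr)
  · rw [hprim X hX]
    exact (hg.norm_le hX).trans ha1
  · rw [hres hX]
    refine (hbounds X hX).1.trans ?_
    calc c * ρ * (period q * a / Δ) = c * (period q * a) * (ρ / Δ) := by ring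
      _ ≤ a' * (ρ / Δ) := by gcongr
  · rw [Filter.EventuallyEq.fderiv_eq (Filter.eventuallyEq_of_mem (hU.isOpen.mem_nhds hX) hres)]
    refine ((hbounds X hX).2 v).trans ?_
    calc _ = c * (period q * a) / Δ * (ρ / Δ * ‖v‖ + 1 * |u v|) := by
          field_simp
      _ ≤ _ := by gcongr

/-- The correction which removes the first term of the residual of `S0`. -/
def correction (p q : ℕ) (e' ε : ℝ) (X : Phase) : ℝ :=
  -(freq p q X * fderiv ℝ (secondPrimitive p q e' ε) X dirTheta)

/-- In a direction without `u`-component the frequency is constant. -/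
lemma fderiv_correction {v : Phase} (hv : u v = 0) (hω : DifferentiableAt ℝ (freq p q) X)
    (hω2 : ∀ v, |fderiv ℝ (freq p q) X v| ≤ c * |u v|)
    (hf : DifferentiableAt ℝ (fun Y => fderiv ℝ (secondPrimitive p q e' ε) Y dirTheta) X) :
    fderiv ℝ (correction p q e' ε) X v = -(freq p q X *
      fderiv ℝ (fun Y => fderiv ℝ (secondPrimitive p q e' ε) Y dirTheta) X v) := by
  have h0 : fderiv ℝ (freq p q) X v = 0 := by
    have := hω2 v
    rw [hv, abs_zero, mul_zero] at this
    exact abs_nonpos_iff.1 this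
  have h1 : HasFDerivAt (correction p q e' ε) _ X := (hω.hasFDerivAt.fun_mul hf.hasFDerivAt).fun_neg
  rw [h1.fderiv, neg_apply, add_apply, smul_apply, smul_apply, h0, smul_zero, add_zero,
    smul_eq_mul]

/-- Mixed derivatives commute, so the λ'-derivative of the correction cancels `freq * ∂S0/∂θ`. What
is left is `-freq²` times the second θ-derivative of the second primitive, and differentiating
`freq²` in `u` leaves one small factor. -/
lemma isGenerator_S0_add_correction (hq : 0 < q) (he0 : 0 ≤ e') (he1 : e' < 1)
    (hU : IsInvariantDomain p q U)
    (hΔ : 0 < Δ) (hΔ1 : Δ ≤ 1) (hρ : 0 < ρ) (hρΔ : ρ ≤ Δ) (ha : 0 < a) (hc : 1 ≤ c)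
    (hω0 : ∀ X ∈ U, ∀ k ≤ 2, ‖iteratedFDeriv ℝ k (freq p q) X‖ ≤ c)
    (hω1 : ∀ X ∈ U, |freq p q X| ≤ c * ρ)
    (hω2 : ∀ X ∈ U, ∀ v, |fderiv ℝ (freq p q) X v| ≤ c * |u v|)
    (hHP : ContDiffOn ℝ ∞ (HP p q e' ε) U)
    (hg : ScaledBound U 3 a Δ (oscillatingPart p q e' ε)) {a' : ℝ}
    (ha1 : a + c * (period q * a) + 8 * c ^ 2 * (period q * (period q * a)) ≤ a') :
    IsGenerator p q e' ε U a' Δ ρ 0 (fun X => S0 p q e' ε X + correction p q e' ε X) := by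
  have hT := period_pos hq
  set T := period q with hTdef
  have hS := scaledBound_S0 hq hU hg
  have hQ := scaledBound_secondPrimitive hq hU hg
  have hQθ := hQ.fderiv_apply hU.isOpen dirTheta
  rw [norm_dirTheta, one_mul] at hQθ
  have hωs : ContDiffOn ℝ ∞ (freq p q) U :=
    isPeriodicSmooth_freq.contDiffOn.mono hU.subset_ellipticRegion
  -- Here `ρ ≤ Δ` enters: the frequency itself is at most `c * Δ`, which compensates the factor `1 /
  -- Δ` of the θ-derivative and keeps the correction of the size of `S0`.
  have hω : ScaledBound U 2 (c * Δ) Δ (freq p q) := by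
    refine ⟨hωs, fun k hk X hX => ?_⟩
    rcases Nat.eq_zero_or_pos k with rfl | hk0
    · rw [norm_iteratedFDeriv_zero, pow_zero, div_one]
      exact (hω1 X hX).trans (by gcongr)
    · refine (hω0 X hX k hk).trans ?_
      rw [le_div_iff₀ (by positivity)]
      exact mul_le_mul_of_nonneg_left (pow_le_of_le_one hΔ.le hΔ1 hk0.ne') (by linarith)
  have hC := (hω.mul hQθ hU.isOpen hΔ).neg
  have e1 : 2 ^ 2 * (c * Δ * (T * T * a / Δ)) = 4 * c * (T * (T * a)) := by
    field_simp
    norm_num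
  rw [e1] at hC
  have hC' : ScaledBound U 2 (4 * c * (T * (T * a))) Δ (correction p q e' ε) := hC
  have hdω : ∀ X ∈ U, DifferentiableAt ℝ (freq p q) X := fun X hX =>
    (hωs.contDiffAt (hU.isOpen.mem_nhds hX)).differentiableAt (by simp)
  have hdQ : ∀ X ∈ U, DifferentiableAt ℝ
      (fun Y => fderiv ℝ (secondPrimitive p q e' ε) Y dirTheta) X := fun X hX =>
    (hQθ.contDiffAt hU.isOpen hX).differentiableAt (by simp)
  have hdS : ∀ X ∈ U, DifferentiableAt ℝ (S0 p q e' ε) X := fun X hX =>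
    (hS.contDiffAt hU.isOpen hX).differentiableAt (by simp)
  have hdC : ∀ X ∈ U, DifferentiableAt ℝ (correction p q e' ε) X := fun X hX =>
    (hC'.contDiffAt hU.isOpen hX).differentiableAt (by simp)
  have hcomm : ∀ X ∈ U, fderiv ℝ (fun Y => fderiv ℝ (secondPrimitive p q e' ε) Y dirTheta) X
      dirLamP = fderiv ℝ (S0 p q e' ε) X dirTheta := by
    intro X hX
    have hQat := hQ.contDiffAt hU.isOpen hX
    have hd : DifferentiableAt ℝ (fderiv ℝ (secondPrimitive p q e' ε)) X :=
      (hQat.fderiv_right (m := ∞) (by simp)).differentiableAt (by simp)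
    have happ : ∀ v w, fderiv ℝ (fun Y => fderiv ℝ (secondPrimitive p q e' ε) Y v) X w =
        fderiv ℝ (fderiv ℝ (secondPrimitive p q e' ε)) X w v := fun v w => by
      rw [fderiv_clm_apply hd (differentiableAt_const v)]
      simp
    have hev : (fun Y => fderiv ℝ (secondPrimitive p q e' ε) Y dirLamP) =ᶠ[𝓝 X] S0 p q e' ε :=
      Filter.eventuallyEq_of_mem (hU.isOpen.mem_nhds hX) fun Y hY =>
        fderiv_secondPrimitive_dirLamP hq he0 he1 hU hHP hg.1 hY
    rw [happ, (hQat.isSymmSndFDerivAt two_le_infty).eq, ← happ, hev.fderiv_eq]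
  have hClamP : ∀ X ∈ U, fderiv ℝ (correction p q e' ε) X dirLamP =
      -(freq p q X * fderiv ℝ (S0 p q e' ε) X dirTheta) := fun X hX => by
    rw [fderiv_correction u_dirLamP (hdω X hX) (hω2 X hX) (hdQ X hX), hcomm X hX]
  have hprim := fun X (hX : X ∈ U) => fderiv_S0_dirLamP hq he0 he1 hU hHP hg.1 hX
  have hSθ := hS.fderiv_apply hU.isOpen dirTheta
  have hCθ := hC'.fderiv_apply (n := 1) hU.isOpen dirTheta
  rw [norm_dirTheta, one_mul] at hSθ hCθ
  have hQθθ := hQθ.fderiv_apply (n := 1) hU.isOpen dirTheta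
  rw [norm_dirTheta, one_mul] at hQθθ
  have hadd : ∀ X ∈ U, fderiv ℝ (fun X => S0 p q e' ε X + correction p q e' ε X) X =
      fderiv ℝ (S0 p q e' ε) X + fderiv ℝ (correction p q e' ε) X := fun X hX =>
    fderiv_fun_add (hdS X hX) (hdC X hX)
  have hres : EqOn (residual p q e' ε (fun X => S0 p q e' ε X + correction p q e' ε X))
      (fun X => freq p q X * fderiv ℝ (correction p q e' ε) X dirTheta) U := fun X hX => by
    unfold residual
    rw [hadd X hX, add_apply, add_apply, hprim X hX, hClamP X hX]
    ring
  -- Unlike `hCθ`, this bound keeps the factor `ρ`; it is the one multiplied by the derivative of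
  -- the frequency.
  have hCθ' : ∀ X ∈ U, |fderiv ℝ (correction p q e' ε) X dirTheta| ≤
      c * ρ * (T * T * a / Δ / Δ) := fun X hX => by
    rw [fderiv_correction u_dirTheta (hdω X hX) (hω2 X hX) (hdQ X hX), abs_neg, abs_mul]
    exact mul_le_mul (hω1 X hX) (hQθθ.norm_le hX) (abs_nonneg _) (by positivity)
  have hbounds : ∀ X ∈ U, _ := fun X hX => freq_mul_bounds (c := c) (ρ := ρ) (hdω X hX)
    ((hCθ.contDiffAt hU.isOpen hX).differentiableAt (by simp)) (hω1 X hX) (hω2 X hX)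
    (hCθ' X hX) (hCθ.norm_fderiv_le le_rfl hX)
  have hsum := (hS.mono subset_rfl (by norm_num : 2 ≤ 3) le_rfl hΔ.le).add hC' hU.isOpen
  have hp1 : 0 < c * (T * a) := by positivity
  have hp2 : 0 < T * (T * a) := by positivity
  have hcc : c ≤ c ^ 2 := by nlinarith
  have hp3 : c * (T * (T * a)) ≤ c ^ 2 * (T * (T * a)) := by gcongr
  have hp4 : T * a ≤ c * (T * a) := le_mul_of_one_le_left (by positivity) hc
  have hp5 : 0 < c * (T * (T * a)) := by positivity
  have hsum' : T * a + 4 * c * (T * (T * a)) ≤ a' := by linarith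
  refine ⟨hsum.1, fun X hX b b' z => ?_, fun X hX => ?_, fun X hX => ?_, fun X hX => ?_,
    fun X hX => ?_, fun X hX v => ?_⟩
  · have h1 : freq p q (X + translation p q b b' z) = freq p q X := freq_congr (by simp)
    unfold correction
    rw [S0_add_translation hq he0 he1 hU hX, h1, fderiv_add_of_eqOn hU.isOpen
      (fun Y hY => secondPrimitive_add_translation hq he0 he1 hU hY b b' z) hX]
  · exact (hsum.norm_fderiv_le one_le_two hX).trans (by gcongr)
  · exact (hsum.norm_fderiv_fderiv_le le_rfl hX).trans (by gcongr)
  · rw [hadd X hX, add_apply, hprim X hX, hClamP X hX]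
    have h1 : |freq p q X * fderiv ℝ (S0 p q e' ε) X dirTheta| ≤ c * (T * a) := by
      rw [abs_mul]
      calc |freq p q X| * |fderiv ℝ (S0 p q e' ε) X dirTheta| ≤ c * Δ * (T * a / Δ) :=
            mul_le_mul ((hω1 X hX).trans (by gcongr)) (hSθ.norm_le hX) (abs_nonneg _)
              (by positivity)
        _ = c * (T * a) := by field_simp
    have h2 := hg.norm_le hX
    rw [Real.norm_eq_abs] at h2
    rw [← sub_eq_add_neg]
    refine (abs_sub _ _).trans ((add_le_add h2 h1).trans ?_)
    linarith
  · rw [hres hX, abs_mul]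
    calc |freq p q X| * |fderiv ℝ (correction p q e' ε) X dirTheta|
        ≤ c * ρ * (4 * c * (T * (T * a)) / Δ) :=
          mul_le_mul (hω1 X hX) (hCθ.norm_le hX) (abs_nonneg _) (by positivity)
      _ = 4 * (c ^ 2 * (T * (T * a))) * (ρ / Δ) := by ring
      _ ≤ a' * (ρ / Δ) := mul_le_mul_of_nonneg_right (by linarith) (by positivity)
  · rw [Filter.EventuallyEq.fderiv_eq (Filter.eventuallyEq_of_mem (hU.isOpen.mem_nhds hX) hres)]
    refine ((hbounds X hX).2 v).trans ?_
    calc c * ρ * (4 * c * (T * (T * a)) / Δ / Δ * ‖v‖) + c * |u v| * (c * ρ * (T * T * a / Δ / Δ))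
        ≤ c * ρ * (4 * c * (T * (T * a)) / Δ / Δ * ‖v‖) +
          c * ‖v‖ * (c * ρ * (T * T * a / Δ / Δ)) := by
          have := norm_u_le v
          gcongr
      _ = 5 * (c ^ 2 * (T * (T * a))) / Δ * (ρ / Δ * ‖v‖ + 0 * |u v|) := by
          field_simp
          ring
      _ ≤ _ := by
          gcongr
          linarith

end Generators

end ResonantAveraging

end

/-! ### Choice of the constant and of the generating function -/

open ResonantAveraging

theorem theorem1 (p q : ℕ) (hp : 0 < p) (hq : 0 < q) (hpq : Nat.Coprime p q)
    (e' σ Δt τ : ℝ) (he0 : 0 ≤ e') (he1 : e' < 1) (hσ : 0 < σ) (hΔt : 0 < Δt) (hτ : 0 < τ) :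
    ∃ C : ℝ, 1 ≤ C ∧ ∀ ε ρ Δ : ℝ, 0 < ε → 0 < ρ → 0 < Δ →
      C * ε < 1 → C * ρ < 1 → C * Δ < 1 → C * ε < ρ * Δ ^ 2 → C * ε < Δ ^ 3 →
      (∃ (S : ResonantAveraging.Phase → ℝ) (Φ : ResonantAveraging.Phase → ResonantAveraging.Phase) (R : ResonantAveraging.Phase → ℝ),
        ResonantAveraging.IsAveraging p q e' σ Δt τ ε ρ Δ C (fun _ => ρ) S Φ R) ∧
      ∃ (Φ : ResonantAveraging.Phase → ResonantAveraging.Phase) (R : ResonantAveraging.Phase → ℝ),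
        ResonantAveraging.IsAveraging p q e' σ Δt τ ε ρ Δ C (ResonantAveraging.slackAtU ρ) (ResonantAveraging.S0 p q e' ε) Φ R := by
  obtain ⟨K, hK, hHP⟩ := exists_scaledBound_HP (p := p) (q := q) hp hq he0 he1 hσ hΔt hτ
  obtain ⟨c, hc, hω⟩ := exists_freq_bound (p := p) (q := q) hp hq hσ hτ
  have hT := period_pos hq
  have hu := maxAction_pos hp hq hσ
  set T := period q
  -- The constant of `isGenerator_S0_add_correction` with `c` doubled, since `|u| ≤ 2 * ρ` for `κ =
  -- 2`, and `a` doubled, since the mean is subtracted from the perturbation.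
  set L := 2 + c * 2 * (T * 2) + 8 * (c * 2) ^ 2 * (T * (T * 2)) with hL
  have hL1 : 1 ≤ L := by
    have : 0 ≤ c * 2 * (T * 2) + 8 * (c * 2) ^ 2 * (T * (T * 2)) := by positivity
    linarith
  obtain ⟨C₀, hC₀, hmain⟩ := exists_isAveraging_of_isGenerator (p := p) (q := q) hp hq he0 he1 hσ
    hΔt hτ (K := L * K) (one_le_mul_of_one_le_of_one_le hL1 hK)
  have hu2 : 0 < 2 / maxAction p q σ := by positivity
  -- The added term makes `C * ρ < 1` imply `2 * ρ ≤ maxAction p q σ`, so that the domains lie in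
  -- the core.
  refine ⟨C₀ + 2 / maxAction p q σ, by linarith, ?_⟩
  intro ε ρ Δ hε hρ hΔ _ hCρ hCΔ hερ hεΔ
  have hC : C₀ ≤ C₀ + 2 / maxAction p q σ := by linarith
  set C := C₀ + 2 / maxAction p q σ with hCdef
  have hΔ1 : Δ ≤ 1 := by nlinarith
  have hρ2 : 2 * ρ ≤ maxAction p q σ := by
    have h1 : 2 / maxAction p q σ * ρ ≤ C * ρ := by gcongr; linarith
    have h2 := h1.trans hCρ.le
    rwa [div_mul_eq_mul_div, div_le_one hu] at h2
  set U := interior (domain p q e' σ Δt τ ρ Δ 2)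
  have hUc : U ⊆ core p q σ τ := interior_subset.trans
    (domain_subset_core hp hq hσ hτ two_pos le_rfl hρ hρ2)
  have hU : IsInvariantDomain p q U := isInvariantDomain_interior_domain he0 he1
    ((domain_subset_core hp hq hσ hτ two_pos le_rfl hρ hρ2).trans
      (core_subset_ellipticRegion hp hq hσ hτ))
  have hP := hHP ε ρ Δ U hε hρ hΔ hΔ1 hρ2 isOpen_interior interior_subset
  have hg := scaledBound_oscillatingPart hq he0 he1 hU hP
  have ha : 0 < K * ε / Δ := by positivity
  have hLa : L * K * ε / Δ = L * (K * ε / Δ) := by ring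
  have h2L : 2 ≤ L := by
    have : 0 ≤ c * 2 * (T * 2) + 8 * (c * 2) ^ 2 * (T * (T * 2)) := by positivity
    linarith
  have hP' : ScaledBound U 2 (L * K * ε / Δ) Δ (HP p q e' ε) :=
    hP.mono subset_rfl (by norm_num) (by rw [hLa]; exact le_mul_of_one_le_left ha.le hL1) hΔ.le
  have hg' : ScaledBound U 2 (L * K * ε / Δ) Δ (oscillatingPart p q e' ε) :=
    hg.mono subset_rfl (by norm_num) (by rw [hLa]; gcongr) hΔ.le
  have hω0 : ∀ X ∈ U, ∀ k ≤ 2, ‖iteratedFDeriv ℝ k (freq p q) X‖ ≤ c * 2 := fun X hX k hk =>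
    ((hω X (hUc hX)).1 k hk).trans (by linarith)
  have hω1 : ∀ X ∈ U, |freq p q X| ≤ c * 2 * ρ := fun X hX => by
    have h1 : |u X| ≤ 2 * ρ := (interior_subset hX : X ∈ domain p q e' σ Δt τ ρ Δ 2).1
    refine (hω X (hUc hX)).2.1.trans ?_
    rw [mul_assoc]
    gcongr
  have hω2 : ∀ X ∈ U, ∀ v, |fderiv ℝ (freq p q) X v| ≤ c * 2 * |u v| := fun X hX v =>
    ((hω X (hUc hX)).2.2 v).trans (by gcongr; linarith)
  have hSgen : IsGenerator p q e' ε U (L * K * ε / Δ) Δ ρ 1 (S0 p q e' ε) := by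
    refine isGenerator_S0 hq he0 he1 hU hΔ hρ (by positivity) (by linarith) hω1 hω2 hP.1 hg
      (by rw [hLa]; gcongr) ?_
    rw [hLa]
    have h3 : c * 2 * (T * 2) ≤ L := by
      have : 0 ≤ 8 * (c * 2) ^ 2 * (T * (T * 2)) := by positivity
      linarith
    calc c * 2 * (T * (2 * (K * ε / Δ))) = c * 2 * (T * 2) * (K * ε / Δ) := by ring
      _ ≤ _ := by gcongr
  have hslackU : ∀ W, 0 ≤ slackAtU ρ W := fun W => by
    cases W <;> simp only [slackAtU] <;> positivity
  have hη1 : 0 ≤ ε / Δ ^ 3 := by positivity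
  have hη2 : 0 ≤ ρ / Δ := by positivity
  refine ⟨?_, hmain hC hε hρ hΔ hΔ1 hρ2 hερ hεΔ zero_le_one le_rfl hslackU
    (by simp only [slackAtU]; linarith) hP' hg' hSgen⟩
  -- If `Δ ≤ ρ`, the loss `β = 1` of `S0` is at most `ρ / Δ`, a part of `η`. Otherwise `ρ < Δ` and
  -- the correction is admissible.
  rcases le_or_gt Δ ρ with hle | hlt
  · refine ⟨S0 p q e' ε, hmain hC hε hρ hΔ hΔ1 hρ2 hερ hεΔ zero_le_one le_rfl (fun _ => hρ.le)
      ?_ hP' hg' hSgen⟩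
    have : 1 ≤ ρ / Δ := (one_le_div hΔ).2 hle
    linarith
  · refine ⟨fun X => S0 p q e' ε X + correction p q e' ε X, hmain hC hε hρ hΔ hΔ1 hρ2 hερ hεΔ
      le_rfl zero_le_one (fun _ => hρ.le) (by positivity) hP' hg' ?_⟩
    refine isGenerator_S0_add_correction hq he0 he1 hU hΔ hΔ1 hρ hlt.le (by positivity)
      (by linarith) hω0 hω1 hω2 hP.1 hg (le_of_eq ?_)
    rw [hLa, hL]
    ring
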